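/- Let $\mathcal X,\mathcal H$ be finite sets, $A\in\mathbb N$, and let $e,\pi$ be policies: maps assigning to each $x\in\mathcal X$ a probability vector $(e_a(x))_{a\le A}$, resp. $(\pi_a(x))_{a\le A}$ ($e$ is the behavior policy, $\pi$ the target policy). A transition law $P$ gives for each $(x,h,a)\in\mathcal X\times\mathcal H\times\{1,\dots,A\}$ a probability measure $P(x,h,a)$ on $\mathbb R\times\mathcal X\times\mathcal H$, the law of $(Y_t,X_{t+1},H_{t+1})$ given $(X_t,H_t,W_t)=(x,h,a)$; under a policy $\rho$ it induces a transition operator $P^\rho$ on distributions on $\mathcal X\times\mathcal H$. Let $\mathcal D$ be a probability distribution on transition laws. Assume that, for constants $\zeta,t_0,M_1,M_2$: * (overlap) $\pi_a(x)\le e^{\zeta}e_a(x)$ for all $x,a$; * (mixing) for $\mathcal D$-almost every $P$ and for each $\rho\in\{\pi,e\}$ there is $0<\tau\le t_0$ with $\|f'P^\rho-fP^\rho\|_{TV}\le e^{-1/\tau}\|f'-f\|_{TV}$ for all distributions $f,f'$ on $\mathcal X\times\mathcal H$; * (moments) for $\mathcal D$-almost every $P$ and all $(x,h,a)$, a real variable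 $Y$ distributed as the first coordinate under $P(x,h,a)$ satisfies $|\mathbb E Y|\le M_1$ and $\mathbb E Y^2\le M_2$. For each $n$ we observe $(X_{i,t},W_{i,t},Y_{i,t})$ for $i=1,\dots,n$ and $t=1,\dots,T(n)$. The units are independent. Unit $i$ has a random transition law $P_i\sim\mathcal D$; given $P_i$, the state $(X_{i,1},H_{i,1})$ has the stationary distribution of $P_i^e$; given $P_i$, all $(X_{i,s},H_{i,s},W_{i,s},Y_{i,s})$ with $s<t$, and $(X_{i,t},H_{i,t})$, the action $W_{i,t}$ has distribution $e(X_{i,t})$; and given in addition $W_{i,t}$, the triple $(Y_{i,t},X_{i,t+1},H_{i,t+1})$ has law $P_i(X_{i,t},H_{i,t},W_{i,t})$. The outcomes are bounded: $|Y_{i,t}|\le C$ almost surely for all $n,i,t$. Fix $k\ge 0$ with $k+1\le T(n)$ for all $n$, and put $$G_{i,t}=\Big(\prod_{s=0}^{k}\frac{\pi_{W_{i,t-s}}(X_{i,t-s})}{e_{W_{i,t-s}}(X_{i,t-s})}\Big)Y_{i,t},\qquad \tilde Y_{i,t}=G_{i,t}-\mathbb E[G_{i,t}\mid P_i],$$ $$\hat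 V_i=\frac1{T(n)-k}\sum_{t=k+1}^{T(n)}G_{i,t},\qquad \hat V(\pi;k)=\frac1n\sum_{i=1}^n\hat V_i .$$ For a bandwidth $B_{T(n)}$ let $$\hat\sigma^2(\pi;k)=\frac1n\sum_{i=1}^n\frac1{T(n)-k}\sum_{k+1\le l,j\le T(n)}\Psi\Big(\frac{l-j}{B_{T(n)}}\Big)\tilde Y_{i,l}\tilde Y_{i,j},$$ where $\Psi$ is the Parzen kernel: $\Psi(x)=1-6x^2+6|x|^3$ for $|x|\le\frac12$, $\Psi(x)=2(1-|x|)^3$ for $\frac12\le|x|\le1$, and $\Psi(x)=0$ otherwise. Then there is $\sigma^2(\pi;k)\in[0,\infty)$, depending only on $(\mathcal D,e,\pi,k)$, such that for all such samples with $T(n)\to\infty$, as $n\to\infty$, $$\sqrt{nT(n)}\,\Big(\hat V(\pi;k)-\frac1n\sum_{i=1}^n\mathbb E[\hat V_i\mid P_i]\Big)\overset{d}{\to}N(0,\sigma^2(\pi;k)),$$ and for every bandwidth sequence with $B_{T(n)}\to\infty$ and $B_{T(n)}/\sqrt{T(n)}\to0$, the estimator $\hat\sigma^2(\pi;k)$ converges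 in probability to this same $\sigma^2(\pi;k)$. -/

import Mathlib

open MeasureTheory ProbabilityTheory Filter Topology
open scoped NNReal ENNReal

noncomputable section

/-- The transition law of one unit: `P x h a` is the joint law of
`(Y_t, X_{t+1}, H_{t+1})` given `X_t = x`, `H_t = h`, `W_t = a`.
Actions are labelled by `Fin A`. -/
abbrev Transition (𝒳 ℋ : Type*) (A : ℕ) [MeasurableSpace 𝒳] [MeasurableSpace ℋ] :=
  𝒳 → ℋ → Fin A → ProbabilityMeasure (ℝ × 𝒳 × ℋ)

/-- A (randomized) policy: `ρ x a` is the probability of action `a` in observed state `x`. -/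
def IsPolicy {𝒳 : Type*} {A : ℕ} (ρ : 𝒳 → Fin A → ℝ) : Prop :=
  ∀ x, ρ x ∈ stdSimplex ℝ (Fin A)

section Population

variable {𝒳 ℋ : Type*} {A : ℕ} [Fintype 𝒳] [Fintype ℋ] [MeasurableSpace 𝒳] [MeasurableSpace ℋ]

/-- The state transition operator of the policy `ρ`, acting on the right of a row vector `f`
indexed by the states `(x, h)`. -/
def stateStep (P : Transition 𝒳 ℋ A) (ρ : 𝒳 → Fin A → ℝ) (f : 𝒳 × ℋ → ℝ) : 𝒳 × ℋ → ℝ :=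
  fun s' => ∑ s : 𝒳 × ℋ, ∑ a : Fin A,
    f s * ρ s.1 a * (P s.1 s.2 a : Measure (ℝ × 𝒳 × ℋ)).real {z | z.2 = s'}

/-- Total variation norm on signed measures on a finite set. -/
def tvNorm {S : Type*} [Fintype S] (f : S → ℝ) : ℝ := (1 / 2) * ∑ s, |f s|

/-- `τ > 0` is a mixing time of the state chain under the policy `ρ`. -/
def IsMixingTime (P : Transition 𝒳 ℋ A) (ρ : 𝒳 → Fin A → ℝ) (τ : ℝ) : Prop :=
  0 < τ ∧ ∀ f ∈ stdSimplex ℝ (𝒳 × ℋ), ∀ f' ∈ stdSimplex ℝ (𝒳 × ℋ),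
    tvNorm (stateStep P ρ f' - stateStep P ρ f) ≤ Real.exp (-1 / τ) * tvNorm (f' - f)

/-- `f` is a stationary distribution of the state chain under the policy `ρ`. -/
def IsStationaryDist (P : Transition 𝒳 ℋ A) (ρ : 𝒳 → Fin A → ℝ) (f : 𝒳 × ℋ → ℝ) : Prop :=
  f ∈ stdSimplex ℝ (𝒳 × ℋ) ∧ stateStep P ρ f = f

/-- Conditions on the behavior policy `e`, the target policy `π` and the population `D` of
transition laws: overlap with constant `ζ`; and, for almost every transition law in the
population, mixing times at most `t₀` under both policies and the bounds `M₁`, `M₂` on the first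
two conditional moments of the outcome given state and action. -/
structure PopulationConditions (e π : 𝒳 → Fin A → ℝ) (D : Measure (Transition 𝒳 ℋ A))
    (ζ t₀ M₁ M₂ : ℝ) : Prop where
  behavior : IsPolicy e
  target : IsPolicy π
  overlap : ∀ x a, π x a ≤ Real.exp ζ * e x a
  mixing_target : ∀ᵐ P ∂D, ∃ τ ≤ t₀, IsMixingTime P π τ
  mixing_behavior : ∀ᵐ P ∂D, ∃ τ ≤ t₀, IsMixingTime P e τ
  moments : ∀ᵐ P ∂D, ∀ x h a,
    Integrable (fun z => z.1 ^ 2) (P x h a : Measure (ℝ × 𝒳 × ℋ)) ∧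
    |∫ z, z.1 ∂(P x h a : Measure (ℝ × 𝒳 × ℋ))| ≤ M₁ ∧
    ∫ z, z.1 ^ 2 ∂(P x h a : Measure (ℝ × 𝒳 × ℋ)) ≤ M₂

end Population

/-- The random variables attached to units `i : Fin n` and epochs `t = 1, 2, …`: the transition
law `P i` of the unit, observed states `X i t`, hidden states `H i t`, actions `W i t` and
outcomes `Y i t`. -/
structure Panel (𝒳 ℋ : Type*) (A n : ℕ) [MeasurableSpace 𝒳] [MeasurableSpace ℋ]
    (Ω : Type*) where
  P : Fin n → Ω → Transition 𝒳 ℋ A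
  X : Fin n → ℕ → Ω → 𝒳
  H : Fin n → ℕ → Ω → ℋ
  W : Fin n → ℕ → Ω → Fin A
  Y : Fin n → ℕ → Ω → ℝ

namespace Panel

variable {𝒳 ℋ : Type*} {A n : ℕ} [Fintype 𝒳] [Fintype ℋ] [MeasurableSpace 𝒳] [MeasurableSpace ℋ]
  {Ω : Type*}

/-- The σ-algebra generated by the transition law of unit `i`. -/
abbrev unitField (d : Panel 𝒳 ℋ A n Ω) (i : Fin n) : MeasurableSpace Ω :=
  MeasurableSpace.comap (d.P i) inferInstance

/-- The σ-algebra of the history of unit `i` just before the action at epoch `t` is taken: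
generated by `P_i`, by `(X_s, H_s, W_s, Y_s)` for `1 ≤ s < t`, and by `(X_t, H_t)`. -/
abbrev history (d : Panel 𝒳 ℋ A n Ω) (i : Fin n) (t : ℕ) : MeasurableSpace Ω :=
  d.unitField i ⊔
  (⨆ s ∈ Finset.Ico 1 t, MeasurableSpace.comap
    (fun ω => (d.X i s ω, d.H i s ω, d.W i s ω, d.Y i s ω)) inferInstance) ⊔
  MeasurableSpace.comap (fun ω => (d.X i t ω, d.H i t ω)) inferInstance

/-- The panel is a sample of `n` independent units, observed at epochs `1, …, T`, whose transition
laws are drawn from `D`; each unit follows its partially observed Markov decision process under the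
behavior policy `e`, started from its stationary distribution. -/
structure IsSample [MeasurableSpace Ω] (d : Panel 𝒳 ℋ A n Ω) (μ : Measure Ω) (T : ℕ)
    (e : 𝒳 → Fin A → ℝ) (D : Measure (Transition 𝒳 ℋ A)) : Prop where
  measurable_P : ∀ i, Measurable (d.P i)
  measurable_X : ∀ i t, Measurable (d.X i t)
  measurable_H : ∀ i t, Measurable (d.H i t)
  measurable_W : ∀ i t, Measurable (d.W i t)
  measurable_Y : ∀ i t, Measurable (d.Y i t)
  /-- the transition laws are drawn from the population `D` -/
  law_P : ∀ i, μ.map (d.P i) = D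
  /-- the units (transition law and whole trajectory) are independent -/
  indep : iIndep (fun i => d.history i (T + 1)) μ
  /-- given `P_i`, the initial state has a stationary distribution of the state chain under `e` -/
  initial : ∀ i, ∀ᵐ ω ∂μ, IsStationaryDist (d.P i ω) e
    (fun s => (μ⟦(fun ω' => (d.X i 1 ω', d.H i 1 ω')) ⁻¹' {s} | d.unitField i⟧) ω)
  /-- given the history, the action is drawn from `e(X_t)` -/
  action : ∀ i, ∀ t ∈ Finset.Icc 1 T, ∀ a,
    μ⟦d.W i t ⁻¹' {a} | d.history i t⟧ =ᵐ[μ] fun ω => e (d.X i t ω) a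
  /-- given the history and the action, `(Y_t, X_{t+1}, H_{t+1})` is drawn from
  `P_i(X_t, H_t, W_t)` -/
  transition : ∀ i, ∀ t ∈ Finset.Icc 1 T, ∀ S : Set (ℝ × 𝒳 × ℋ), MeasurableSet S →
    μ⟦(fun ω => (d.Y i t ω, d.X i (t + 1) ω, d.H i (t + 1) ω)) ⁻¹' S |
        d.history i t ⊔ MeasurableSpace.comap (d.W i t) inferInstance⟧
      =ᵐ[μ] fun ω =>
        (d.P i ω (d.X i t ω) (d.H i t ω) (d.W i t ω) : Measure (ℝ × 𝒳 × ℋ)).real S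

/-- The importance-weighted outcome
`(∏_{s=0}^k π_{W_{i,t-s}}(X_{i,t-s}) / e_{W_{i,t-s}}(X_{i,t-s})) Y_{i,t}`. -/
def weighted (d : Panel 𝒳 ℋ A n Ω) (e π : 𝒳 → Fin A → ℝ) (k : ℕ) (i : Fin n) (t : ℕ) (ω : Ω) : ℝ :=
  (∏ s ∈ Finset.range (k + 1),
    π (d.X i (t - s) ω) (d.W i (t - s) ω) / e (d.X i (t - s) ω) (d.W i (t - s) ω)) * d.Y i t ω

/-- The contribution of unit `i` to the partial-history importance-weighted estimator. -/
def unitEstimator (d : Panel 𝒳 ℋ A n Ω) (e π : 𝒳 → Fin A → ℝ) (k T : ℕ) (i : Fin n) (ω : Ω) : ℝ :=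
  1 / ((T : ℝ) - k) * ∑ t ∈ Finset.Icc (k + 1) T, d.weighted e π k i t ω

/-- The partial-history importance-weighted estimator. -/
def estimator (d : Panel 𝒳 ℋ A n Ω) (e π : 𝒳 → Fin A → ℝ) (k T : ℕ) (ω : Ω) : ℝ :=
  1 / (n : ℝ) * ∑ i, d.unitEstimator e π k T i ω

/-- The mean of the estimator for the given units: for each unit the expectation is taken given
its transition law `P_i`. -/
def estimatorMean [MeasurableSpace Ω] (d : Panel 𝒳 ℋ A n Ω) (μ : Measure Ω)
    (e π : 𝒳 → Fin A → ℝ) (k T : ℕ) (ω : Ω) : ℝ :=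
  1 / (n : ℝ) * ∑ i, (μ[d.unitEstimator e π k T i | d.unitField i]) ω

/-- The importance-weighted outcome centered at its mean for unit `i` (given `P_i`). -/
def centered [MeasurableSpace Ω] (d : Panel 𝒳 ℋ A n Ω) (μ : Measure Ω)
    (e π : 𝒳 → Fin A → ℝ) (k : ℕ) (i : Fin n) (t : ℕ) (ω : Ω) : ℝ :=
  d.weighted e π k i t ω - (μ[d.weighted e π k i t | d.unitField i]) ω

end Panel

/-- The Parzen kernel. -/
def parzen (x : ℝ) : ℝ :=
  if |x| ≤ 1 / 2 then 1 - 6 * x ^ 2 + 6 * |x| ^ 3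
  else if |x| ≤ 1 then 2 * (1 - |x|) ^ 3
  else 0

/-- The kernel variance estimator with the Parzen kernel and bandwidth `B`. -/
def Panel.varianceEstimator {𝒳 ℋ : Type*} {A n : ℕ} [MeasurableSpace 𝒳]
    [MeasurableSpace ℋ] {Ω : Type*} [MeasurableSpace Ω] (d : Panel 𝒳 ℋ A n Ω) (μ : Measure Ω)
    (e π : 𝒳 → Fin A → ℝ) (k T : ℕ) (B : ℝ) (ω : Ω) : ℝ :=
  1 / (n : ℝ) * ∑ i, 1 / ((T : ℝ) - k) *
    ∑ l ∈ Finset.Icc (k + 1) T, ∑ j ∈ Finset.Icc (k + 1) T,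
      parzen (((l : ℝ) - j) / B) * d.centered μ e π k i l ω * d.centered μ e π k i j ω

end

set_option linter.unusedSectionVars false

/-! Given its transition law `P_i`, a unit runs a stationary chain that forgets its state at the
geometric rate r = exp(-1/t₀), the same for almost every law in the population. Its centered
weighted outcomes are therefore bounded, with conditional expectations given the past that decay
geometrically in the lag (`isGeometricMixingale`). Summing these conditional expectations solves a
Poisson equation and splits the sequence into martingale differences and a bounded coboundary. Two
moment bounds follow, uniform over units and rows: the fourth moment of the sum over T epochs is
O(T²) (`integral_sum_pow_four_le`), and the second moment of the kernel quadratic form is O(T² + T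
B²) (`integral_quadratic_sq_le`).

The covariances of a unit, averaged over `P_i`, depend on the population only: stationary means are
limits of the chain run from any fixed state, and `P_i` has law `D`
(`integral_centered_mul_centered_eq_autocov`). They decay geometrically, so a Toeplitz average of
them tends to the long-run variance for all weights bounded by 1 and tending to 1 at each lag
(`tendsto_average_toeplitz`). Weights 1 give the variance of the unit sums, Parzen weights the mean
of the variance estimator; this is why the two limits agree.

Independence across units does the rest. The unit sums in a row have equal variances and bounded
normalized fourth moments, so Lyapunov's theorem applies. The normalized quadratic forms have
bounded second moments because B² = O(T), so Chebyshev's inequality applies; the estimator of a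
single unit need not concentrate.

Outcomes are bounded only almost surely, by a C that σ² must not depend on. The operators therefore
act on outcomes truncated at C, and σ² is the limit over integer truncation levels, which is
attained as soon as the level exceeds C. -/

/-! ### Characteristic functions and Lyapunov's theorem for row-independent arrays -/

/-- Taylor's bound for |x| ≤ 1; beyond that each term separately is dominated by |x|³. -/
theorem norm_cexp_I_sub_taylor_two_le (x : ℝ) :
    ‖Complex.exp (x * Complex.I) - (1 + x * Complex.I - x ^ 2 / 2)‖ ≤ 4 * |x| ^ 3 := by
  rcases le_or_gt |x| 1 with h | h
  · have h1 : ‖(x : ℂ) * Complex.I‖ ≤ 1 := by simpa using h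
    have := Complex.exp_bound h1 (n := 3) (by norm_num)
    have e : ∑ m ∈ Finset.range 3, ((x : ℂ) * Complex.I) ^ m / (m.factorial : ℂ)
        = 1 + x * Complex.I - x ^ 2 / 2 := by
      simp [Finset.sum_range_succ, Nat.factorial, mul_pow, Complex.I_sq]
      ring
    rw [e] at this
    refine this.trans ?_
    have h3 : 0 ≤ |x| ^ 3 := by positivity
    simp [Nat.factorial]
    nlinarith
  · have h1 : ‖Complex.exp (x * Complex.I)‖ = 1 := Complex.norm_exp_ofReal_mul_I x
    have h2 : ‖(1 + x * Complex.I - x ^ 2 / 2 : ℂ)‖ ≤ 1 + |x| + |x| ^ 2 / 2 := by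
      refine (norm_sub_le _ _).trans ?_
      gcongr
      · refine (norm_add_le _ _).trans ?_
        simp
      · simp
    refine (norm_sub_le _ _).trans ?_
    rw [h1]
    have h4 : 0 ≤ |x| := abs_nonneg x
    nlinarith [sq_nonneg (|x| - 1), mul_nonneg h4 (sq_nonneg (|x| - 1)), mul_pos (sub_pos.2 h) (sub_pos.2 h)]

theorem abs_cube_le_one_add_pow_four (x : ℝ) : |x| ^ 3 ≤ 1 + x ^ 4 := by
  have : x ^ 4 = |x| ^ 4 := by rw [← abs_pow, abs_of_nonneg (by positivity)]
  rw [this]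
  have h : 0 ≤ |x| := abs_nonneg x
  rcases le_or_gt |x| 1 with h1 | h1
  · have := pow_le_one₀ (n := 3) h h1
    have : 0 ≤ |x| ^ 4 := by positivity
    linarith
  · have := pow_le_pow_right₀ h1.le (show 3 ≤ 4 by norm_num)
    linarith

/-- Replace the factors by b one at a time: each replacement costs at most δ, since the other
factors lie in the unit disc. -/
theorem norm_prod_sub_pow_card_le {ι : Type*} (s : Finset ι) (a : ι → ℂ) (b : ℂ)
    (ha : ∀ i, ‖a i‖ ≤ 1) (hb : ‖b‖ ≤ 1) (δ : ℝ) (h : ∀ i, ‖a i - b‖ ≤ δ) :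
    ‖∏ i ∈ s, a i - b ^ s.card‖ ≤ s.card * δ := by
  classical
  induction s using Finset.induction_on with
  | empty => simp
  | insert i s hi ih =>
    rw [Finset.prod_insert hi, Finset.card_insert_of_notMem hi]
    have e : a i * ∏ j ∈ s, a j - b ^ (s.card + 1)
        = a i * (∏ j ∈ s, a j - b ^ s.card) + (a i - b) * b ^ s.card := by ring
    rw [e]
    refine (norm_add_le _ _).trans ?_
    rw [norm_mul, norm_mul, norm_pow]
    have h1 : ‖a i‖ * ‖∏ j ∈ s, a j - b ^ s.card‖ ≤ 1 * (s.card * δ) := by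
      gcongr; exact ha i
    have h2 : ‖a i - b‖ * ‖b‖ ^ s.card ≤ δ * 1 := by
      gcongr
      · exact (norm_nonneg _).trans (h i)
      · exact h i
      · exact pow_le_one₀ (norm_nonneg _) hb
    push_cast
    linarith

theorem integrable_of_pow_four {Ω : Type*} [MeasurableSpace Ω] {μ : Measure Ω}
    [IsFiniteMeasure μ] {Z : Ω → ℝ} (hZ : Measurable Z) (h4 : Integrable (fun ω => Z ω ^ 4) μ)
    {p : ℕ} (hp : p ≤ 4) : Integrable (fun ω => Z ω ^ p) μ := by
  refine Integrable.mono' (g := fun ω => 1 + Z ω ^ 4) ((integrable_const 1).add h4)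
    (hZ.pow_const p).aestronglyMeasurable (ae_of_all _ fun ω => ?_)
  have e : Z ω ^ 4 = |Z ω| ^ 4 := by rw [← abs_pow, abs_of_nonneg (by positivity)]
  rw [Real.norm_eq_abs, abs_pow, e]
  rcases le_or_gt |Z ω| 1 with h1 | h1
  · have := pow_le_one₀ (n := p) (abs_nonneg _) h1
    have : 0 ≤ |Z ω| ^ 4 := by positivity
    linarith
  · have := pow_le_pow_right₀ h1.le hp
    linarith

/-- Integrate the second-order Taylor estimate: the linear term has mean zero, and |Z|³ ≤ 1 + Z⁴
bounds the remainder. -/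
theorem norm_charFun_sub_le {Ω : Type*} [MeasurableSpace Ω] (μ : Measure Ω)
    [IsProbabilityMeasure μ] (Z : Ω → ℝ) (hZ : Measurable Z) (v K : ℝ)
    (h4 : Integrable (fun ω => Z ω ^ 4) μ)
    (h0 : ∫ ω, Z ω ∂μ = 0) (h2 : ∫ ω, Z ω ^ 2 ∂μ = v) (hK : ∫ ω, Z ω ^ 4 ∂μ ≤ K) (s : ℝ) :
    ‖charFun (μ.map Z) s - (1 - s ^ 2 * v / 2 : ℝ)‖ ≤ 4 * |s| ^ 3 * (1 + K) := by
  have i1 : Integrable Z μ := by simpa using integrable_of_pow_four hZ h4 (p := 1) (by norm_num)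
  have i2 := integrable_of_pow_four hZ h4 (p := 2) (by norm_num)
  rw [charFun_apply_real, integral_map hZ.aemeasurable (by fun_prop)]
  have hm : Measurable fun ω => Complex.exp (s * Z ω * Complex.I) := by fun_prop
  have iexp : Integrable (fun ω => Complex.exp (s * Z ω * Complex.I)) μ := by
    refine Integrable.mono' (integrable_const 1) hm.aestronglyMeasurable (ae_of_all _ fun ω => ?_)
    rw [← Complex.ofReal_mul, Complex.norm_exp_ofReal_mul_I]
  have j1 : Integrable (fun ω => ((s * Z ω : ℝ) : ℂ) * Complex.I) μ :=
    ((i1.const_mul s).ofReal).mul_const _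
  have j2 : Integrable (fun ω => ((s ^ 2 * Z ω ^ 2 / 2 : ℝ) : ℂ)) μ :=
    (((i2.const_mul (s ^ 2)).div_const 2)).ofReal
  have j3 : Integrable (fun ω => 1 + ((s * Z ω : ℝ) : ℂ) * Complex.I
      - ((s ^ 2 * Z ω ^ 2 / 2 : ℝ) : ℂ)) μ :=
    ((integrable_const 1).add j1).sub j2
  have e : ((1 - s ^ 2 * v / 2 : ℝ) : ℂ) = ∫ ω, (1 + ((s * Z ω : ℝ) : ℂ) * Complex.I
      - ((s ^ 2 * Z ω ^ 2 / 2 : ℝ) : ℂ)) ∂μ := by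
    have j4 : Integrable (fun ω => 1 + ((s * Z ω : ℝ) : ℂ) * Complex.I) μ :=
      (integrable_const 1).add j1
    rw [integral_sub j4 j2, integral_add (integrable_const 1) j1,
      integral_mul_const, integral_complex_ofReal, integral_complex_ofReal, integral_const_mul,
      integral_div, integral_const_mul, h0, h2]
    simp
  rw [e, ← integral_sub iexp j3]
  calc _ ≤ ∫ ω, 4 * |s| ^ 3 * (1 + Z ω ^ 4) ∂μ := by
        refine norm_integral_le_of_norm_le (((integrable_const 1).add h4).const_mul _)
          (ae_of_all _ fun ω => ?_)
        have := norm_cexp_I_sub_taylor_two_le (s * Z ω)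
        have h3 := abs_cube_le_one_add_pow_four (Z ω)
        have e2 : |s * Z ω| ^ 3 = |s| ^ 3 * |Z ω| ^ 3 := by rw [abs_mul, mul_pow]
        have e3 : ((s ^ 2 * Z ω ^ 2 / 2 : ℝ) : ℂ) = ((s * Z ω : ℝ) : ℂ) ^ 2 / 2 := by
          push_cast; ring
        rw [e3]
        rw [e2] at this
        push_cast at this ⊢
        refine this.trans ?_
        rw [mul_assoc]
        gcongr
    _ = 4 * |s| ^ 3 * (1 + ∫ ω, Z ω ^ 4 ∂μ) := by
        rw [integral_const_mul, integral_add (integrable_const 1) h4]; simp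
    _ ≤ _ := by gcongr

/-- Lyapunov's central limit theorem for a triangular array whose rows are independent, centered,
of constant variance, with bounded fourth moments. -/
theorem tendstoInDistribution_inv_sqrt_mul_sum_row {Ω : ℕ → Type*} [∀ n, MeasurableSpace (Ω n)]
    (μ : (n : ℕ) → Measure (Ω n)) [∀ n, IsProbabilityMeasure (μ n)]
    (Z : (n : ℕ) → Fin n → Ω n → ℝ) (hZ : ∀ n i, Measurable (Z n i))
    (hind : ∀ n, iIndepFun (Z n) (μ n)) (v : ℕ → ℝ) (σ2 : ℝ≥0)
    (hv : Tendsto v atTop (𝓝 (σ2 : ℝ))) (K : ℝ)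
    (h4 : ∀ n i, Integrable (fun ω => Z n i ω ^ 4) (μ n))
    (h0 : ∀ n i, ∫ ω, Z n i ω ∂(μ n) = 0) (h2 : ∀ n i, ∫ ω, Z n i ω ^ 2 ∂(μ n) = v n)
    (hK : ∀ n i, ∫ ω, Z n i ω ^ 4 ∂(μ n) ≤ K) :
    TendstoInDistribution (fun (n : ℕ) ω => (√(n : ℝ))⁻¹ * ∑ i, Z n i ω) atTop (fun x : ℝ => x) μ
      (gaussianReal 0 σ2) where
  forall_aemeasurable n :=
    (Measurable.const_mul (Finset.measurable_fun_sum _ fun i _ => hZ n i) _).aemeasurable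
  aemeasurable_limit := by fun_prop
  tendsto := by
    refine ProbabilityMeasure.tendsto_iff_tendsto_charFun.2 fun t ↦ ?_
    have e1 : ∀ n, charFun ((μ n).map (fun ω => (√(n : ℝ))⁻¹ * ∑ i, Z n i ω)) t
        = ∏ i, charFun ((μ n).map (Z n i)) ((√(n : ℝ))⁻¹ * t) := fun n => by
      rw [charFun_map_mul_comp, (hind n).charFun_map_fun_sum_eq_prod (fun i => (hZ n i).aemeasurable)]
      · simp
      · exact Finset.aemeasurable_fun_sum _ fun i _ => (hZ n i).aemeasurable
    simp only [ProbabilityMeasure.coe_mk, Measure.map_id', charFun_gaussianReal, e1]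
    set s : ℕ → ℝ := fun n => (√(n : ℝ))⁻¹ * t with hs
    -- Each factor is close to 1 + g n, and n g n tends to -t²σ²/2, so (1 + g n)ⁿ tends to the
    -- Gaussian characteristic function.
    set g : ℕ → ℝ := fun n => - (s n ^ 2 * v n / 2) with hg
    have hs2 : ∀ᶠ n : ℕ in atTop, s n ^ 2 * n = t ^ 2 := by
      filter_upwards [eventually_gt_atTop 0] with n hn
      have : (0 : ℝ) < n := by exact_mod_cast hn
      simp only [hs, mul_pow, inv_pow, Real.sq_sqrt this.le]
      field_simp
    have hs0 : Tendsto s atTop (𝓝 0) := by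
      rw [← zero_mul t]
      exact .mul_const t (tendsto_inv_atTop_zero.comp <| Real.tendsto_sqrt_atTop.comp <|
        tendsto_natCast_atTop_atTop)
    have hg0 : Tendsto g atTop (𝓝 0) := by
      have := (((hs0.pow 2).mul hv).div_const 2).neg
      simpa [hg] using this
    have hng : Tendsto (fun n : ℕ => n * g n) atTop (𝓝 (-(t ^ 2 * σ2 / 2))) := by
      refine Tendsto.congr' ?_ (((hv.const_mul (t ^ 2)).div_const 2).neg)
      filter_upwards [hs2] with n hn
      simp only [hg]; rw [← hn]; ring
    have hlim := Real.tendsto_one_add_pow_exp_of_tendsto hng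
    have hlimC : Tendsto (fun n : ℕ => (((1 + g n) ^ n : ℝ) : ℂ)) atTop
        (𝓝 ((Real.exp (-(t ^ 2 * σ2 / 2)) : ℝ) : ℂ)) :=
      (Complex.continuous_ofReal.tendsto _).comp hlim
    have e2 : Complex.exp (t * (0 : ℝ) * Complex.I - σ2 * t ^ 2 / 2)
        = ((Real.exp (-(t ^ 2 * σ2 / 2)) : ℝ) : ℂ) := by
      push_cast; congr 1; ring
    rw [e2]
    have hdiff : Tendsto (fun n => ∏ i, charFun ((μ n).map (Z n i)) (s n)
        - (((1 + g n) ^ n : ℝ) : ℂ)) atTop (𝓝 0) := by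
      -- This is n times the error 4|s n|³(1 + K) of one factor, rewritten with n (s n)² = t².
      have hbd : Tendsto (fun n => t ^ 2 * (4 * |s n| * (1 + K))) atTop (𝓝 0) := by
        have := (((hs0.abs).const_mul 4).mul_const (1 + K)).const_mul (t ^ 2)
        simpa using this
      refine squeeze_zero_norm' ?_ hbd
      have hgb : ∀ᶠ n in atTop, |g n| < 1 := by
        have := hg0.abs
        rw [abs_zero] at this
        exact this.eventually (gt_mem_nhds one_pos)
      filter_upwards [hs2, hgb, eventually_gt_atTop 0] with n hn hgn hnpos
      have hvn : 0 ≤ v n := by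
        rw [← h2 n ⟨0, hnpos⟩]
        exact integral_nonneg fun ω => sq_nonneg _
      -- With |g n| < 1 this puts 1 + g n in the unit disc, as the product comparison requires.
      have hgn0 : g n ≤ 0 := by
        have := mul_nonneg (sq_nonneg (s n)) hvn
        simp only [hg]; linarith
      have := norm_prod_sub_pow_card_le (Finset.univ : Finset (Fin n))
        (fun i => charFun ((μ n).map (Z n i)) (s n)) ((1 + g n : ℝ) : ℂ) (fun i => by
          have := Measure.isProbabilityMeasure_map (μ := μ n) (hZ n i).aemeasurable
          exact norm_charFun_le_one (s n)) (by
            rw [Complex.norm_real, Real.norm_eq_abs, abs_le]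
            constructor <;> linarith [(abs_lt.1 hgn).1])
        (4 * |s n| ^ 3 * (1 + K)) (fun i => by
          have := norm_charFun_sub_le (μ n) (Z n i) (hZ n i) (v n) K (h4 n i) (h0 n i) (h2 n i)
            (hK n i) (s n)
          simpa [hg, sub_eq_add_neg] using this)
      rw [Finset.card_univ, Fintype.card_fin] at this
      push_cast at this ⊢
      refine this.trans (le_of_eq ?_)
      rw [← hn, ← sq_abs (s n)]; ring
    have := hdiff.add hlimC
    simpa using this

/-! ### Symmetric double sums and summation by parts -/

theorem sum_range_sum_range_of_symm (f : ℕ → ℕ → ℝ) (hf : ∀ l j, f l j = f j l) (m : ℕ) :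
    ∑ l ∈ Finset.range m, ∑ j ∈ Finset.range m, f l j =
      ∑ l ∈ Finset.range m, f l l + 2 * ∑ l ∈ Finset.range m, ∑ j ∈ Finset.range l, f l j := by
  induction m with
  | zero => simp
  | succ m ih =>
    simp only [Finset.sum_range_succ, Finset.sum_add_distrib] at ih ⊢
    rw [ih]
    have : ∑ x ∈ Finset.range m, f x m = ∑ x ∈ Finset.range m, f m x :=
      Finset.sum_congr rfl fun _ _ => hf _ _
    rw [this]; ring

/-- Abel summation moves the difference from the Poisson corrector g to the kernel-weighted past D,
whose increments stay bounded although D itself grows with the bandwidth. -/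
theorem sum_range_sub_mul_eq (g D : ℕ → ℝ) (m : ℕ) :
    ∑ l ∈ Finset.range m, (g l - g (l + 1)) * D l =
      g 0 * D 0 - g m * D m + ∑ l ∈ Finset.range m, g (l + 1) * (D (l + 1) - D l) := by
  induction m with
  | zero => simp
  | succ m ih => rw [Finset.sum_range_succ, Finset.sum_range_succ, ih]; ring

/-! ### Moments of sums of bounded martingale differences -/

section Martingale

variable {Ω : Type*} {m0 : MeasurableSpace Ω} {μ : Measure Ω}

theorem integrable_pow_mul_pow_of_bdd [IsProbabilityMeasure μ] {f g : Ω → ℝ} (hf : AEStronglyMeasurable f μ)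
    (hg : AEStronglyMeasurable g μ) {a b : ℝ} (ha : ∀ᵐ ω ∂μ, |f ω| ≤ a)
    (hb : ∀ᵐ ω ∂μ, |g ω| ≤ b) (p q : ℕ) : Integrable (fun ω => f ω ^ p * g ω ^ q) μ := by
  refine Integrable.of_bound (C := a ^ p * b ^ q) ((hf.pow p).mul (hg.pow q)) ?_
  filter_upwards [ha, hb] with ω h1 h2
  rw [norm_mul, norm_pow, norm_pow, Real.norm_eq_abs, Real.norm_eq_abs]
  have := (abs_nonneg _).trans h1
  gcongr

theorem integral_mul_eq_zero_of_condExp_eq_zero [IsProbabilityMeasure μ] {m : MeasurableSpace Ω} (hm : m ≤ m0)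
    {f g : Ω → ℝ} (hf : StronglyMeasurable[m] f) (hfg : Integrable (fun ω => f ω * g ω) μ)
    (hg : Integrable g μ) (h : μ[g | m] =ᵐ[μ] 0) : ∫ ω, f ω * g ω ∂μ = 0 := by
  rw [← integral_condExp hm]
  have h1 := condExp_mul_of_stronglyMeasurable_left hf hfg hg
  have : μ[fun ω => f ω * g ω | m] =ᵐ[μ] 0 := by
    filter_upwards [h1, h] with ω h1 h2
    have h1' : μ[fun ω => f ω * g ω | m] ω = f ω * μ[g | m] ω := h1
    rw [h1', h2]; simp
  rw [integral_congr_ae this]; simp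

/-- The first `m` terms of `ξ` are martingale differences for the filtration `F`, bounded by `b`. -/
structure IsBoundedMartingaleDiff (F : Filtration ℕ m0) (μ : Measure Ω) (m : ℕ) (b : ℝ)
    (ξ : ℕ → Ω → ℝ) : Prop where
  stronglyMeasurable : ∀ l < m, StronglyMeasurable[F (l + 1)] (ξ l)
  bound : ∀ l < m, ∀ᵐ ω ∂μ, |ξ l ω| ≤ b
  condExp_eq_zero : ∀ l < m, μ[ξ l | F l] =ᵐ[μ] 0

namespace IsBoundedMartingaleDiff

variable {F : Filtration ℕ m0} {m : ℕ} {b : ℝ} {ξ : ℕ → Ω → ℝ}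

theorem mono (h : IsBoundedMartingaleDiff F μ m b ξ) {n : ℕ} (hn : n ≤ m) :
    IsBoundedMartingaleDiff F μ n b ξ :=
  ⟨fun l hl => h.1 l (by omega), fun l hl => h.2 l (by omega), fun l hl => h.3 l (by omega)⟩

theorem stronglyMeasurable_sum (h : IsBoundedMartingaleDiff F μ m b ξ) :
    StronglyMeasurable[F m] (fun ω => ∑ l ∈ Finset.range m, ξ l ω) :=
  Finset.stronglyMeasurable_fun_sum _ fun l hl =>
    (h.1 l (Finset.mem_range.1 hl)).mono (F.mono (Finset.mem_range.1 hl))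

theorem ae_abs_sum_le (h : IsBoundedMartingaleDiff F μ m b ξ) :
    ∀ᵐ ω ∂μ, |∑ l ∈ Finset.range m, ξ l ω| ≤ m * b := by
  have : ∀ᵐ ω ∂μ, ∀ l ∈ Finset.range m, |ξ l ω| ≤ b :=
    (ae_ball_iff (Finset.countable_toSet _)).2 fun l hl => h.2 l (Finset.mem_range.1 hl)
  filter_upwards [this] with ω hω
  refine (Finset.abs_sum_le_sum_abs _ _).trans ((Finset.sum_le_sum hω).trans ?_)
  simp

theorem integral_sum_pow_mul_eq_zero [IsProbabilityMeasure μ] (h : IsBoundedMartingaleDiff F μ (m + 1) b ξ) (p : ℕ) :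
    ∫ ω, (∑ l ∈ Finset.range m, ξ l ω) ^ p * ξ m ω ∂μ = 0 := by
  have hM := (h.mono m.le_succ)
  have hξ := ((h.1 m m.lt_succ_self).mono (F.le _)).aestronglyMeasurable (μ := μ)
  refine integral_mul_eq_zero_of_condExp_eq_zero (F.le m) (hM.stronglyMeasurable_sum.pow p) ?_ ?_
    (h.3 m m.lt_succ_self)
  · simpa using integrable_pow_mul_pow_of_bdd
      (hM.stronglyMeasurable_sum.mono (F.le _)).aestronglyMeasurable hξ
      hM.ae_abs_sum_le (h.2 m m.lt_succ_self) p 1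
  · exact Integrable.of_bound (C := b) hξ (h.2 m m.lt_succ_self)

/-- Increments are orthogonal to the past, so each one adds at most b². -/
theorem integral_sum_sq_le [IsProbabilityMeasure μ] (h : IsBoundedMartingaleDiff F μ m b ξ) :
    ∫ ω, (∑ l ∈ Finset.range m, ξ l ω) ^ 2 ∂μ ≤ m * b ^ 2 := by
  induction m with
  | zero => simp
  | succ m ih =>
    have hM := (h.mono m.le_succ)
    have hM1 := (hM.stronglyMeasurable_sum.mono (F.le _)).aestronglyMeasurable (μ := μ)
    have hξ := ((h.1 m m.lt_succ_self).mono (F.le _)).aestronglyMeasurable (μ := μ)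
    have hb := h.2 m m.lt_succ_self
    have I := integrable_pow_mul_pow_of_bdd hM1 hξ hM.ae_abs_sum_le hb
    have i1 : Integrable (fun ω => (∑ l ∈ Finset.range m, ξ l ω) ^ 2) μ := by simpa using I 2 0
    have i2 : Integrable (fun ω => 2 * ((∑ l ∈ Finset.range m, ξ l ω) ^ 1 * ξ m ω)) μ := by
      simpa using (I 1 1).const_mul 2
    have i12 : Integrable (fun ω => (∑ l ∈ Finset.range m, ξ l ω) ^ 2
        + 2 * ((∑ l ∈ Finset.range m, ξ l ω) ^ 1 * ξ m ω)) μ := i1.add i2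
    calc _ ≤ ∫ ω, ((∑ l ∈ Finset.range m, ξ l ω) ^ 2
          + 2 * ((∑ l ∈ Finset.range m, ξ l ω) ^ 1 * ξ m ω) + b ^ 2) ∂μ := by
          refine integral_mono_ae ?_ (i12.add (integrable_const _)) ?_
          · simpa using integrable_pow_mul_pow_of_bdd
              (h.stronglyMeasurable_sum.mono (F.le _)).aestronglyMeasurable hξ h.ae_abs_sum_le hb 2 0
          · filter_upwards [hb] with ω hω
            rw [Finset.sum_range_succ]
            nlinarith [abs_nonneg (ξ m ω), sq_abs (ξ m ω)]
      _ = ∫ ω, (∑ l ∈ Finset.range m, ξ l ω) ^ 2 ∂μ + b ^ 2 := by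
          rw [integral_add i12 (integrable_const _), integral_add i1 i2, integral_const_mul, h.integral_sum_pow_mul_eq_zero]
          simp
      _ ≤ _ := by have := ih hM; push_cast; linarith

/-- In (M + ξ)⁴ the term 4M³ξ has mean zero and the later ones are at most 8b²M² + 3b⁴. As E M² ≤ m
b², step m adds at most (8m + 3)b⁴, which is below 4((m+1)² - m²)b⁴. -/
theorem integral_sum_pow_four_le [IsProbabilityMeasure μ] (h : IsBoundedMartingaleDiff F μ m b ξ) :
    ∫ ω, (∑ l ∈ Finset.range m, ξ l ω) ^ 4 ∂μ ≤ 4 * m ^ 2 * b ^ 4 := by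
  induction m with
  | zero => simp
  | succ m ih =>
    have hM := (h.mono m.le_succ)
    have hM1 := (hM.stronglyMeasurable_sum.mono (F.le _)).aestronglyMeasurable (μ := μ)
    have hξ := ((h.1 m m.lt_succ_self).mono (F.le _)).aestronglyMeasurable (μ := μ)
    have hb := h.2 m m.lt_succ_self
    have I := integrable_pow_mul_pow_of_bdd hM1 hξ hM.ae_abs_sum_le hb
    have i1 : Integrable (fun ω => (∑ l ∈ Finset.range m, ξ l ω) ^ 4) μ := by simpa using I 4 0
    have i2 : Integrable (fun ω => 4 * ((∑ l ∈ Finset.range m, ξ l ω) ^ 3 * ξ m ω)) μ := by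
      simpa using (I 3 1).const_mul 4
    have i3 : Integrable (fun ω => 8 * b ^ 2 * ((∑ l ∈ Finset.range m, ξ l ω) ^ 2)) μ := by
      simpa using (I 2 0).const_mul (8 * b ^ 2)
    have i12 : Integrable (fun ω => (∑ l ∈ Finset.range m, ξ l ω) ^ 4
        + 4 * ((∑ l ∈ Finset.range m, ξ l ω) ^ 3 * ξ m ω)) μ := i1.add i2
    have i123 : Integrable (fun ω => (∑ l ∈ Finset.range m, ξ l ω) ^ 4
        + 4 * ((∑ l ∈ Finset.range m, ξ l ω) ^ 3 * ξ m ω)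
        + 8 * b ^ 2 * (∑ l ∈ Finset.range m, ξ l ω) ^ 2) μ := i12.add i3
    calc _ ≤ ∫ ω, ((∑ l ∈ Finset.range m, ξ l ω) ^ 4
          + 4 * ((∑ l ∈ Finset.range m, ξ l ω) ^ 3 * ξ m ω)
          + 8 * b ^ 2 * (∑ l ∈ Finset.range m, ξ l ω) ^ 2 + 3 * b ^ 4) ∂μ := by
          refine integral_mono_ae ?_ (i123.add (integrable_const _)) ?_
          · simpa using integrable_pow_mul_pow_of_bdd
              (h.stronglyMeasurable_sum.mono (F.le _)).aestronglyMeasurable hξ h.ae_abs_sum_le hb 4 0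
          · filter_upwards [hb] with ω hω
            rw [Finset.sum_range_succ]
            generalize ∑ l ∈ Finset.range m, ξ l ω = M
            have h0 := abs_nonneg (ξ m ω)
            have h2 : ξ m ω ^ 2 ≤ b ^ 2 := by rw [← sq_abs]; gcongr
            -- Splitting the cubic term this way raises the coefficients 6 and 1 of M²ξ² and ξ⁴ to 8
            -- and 3.
            have e1 : 4 * (M * ξ m ω ^ 3) ≤ 2 * ξ m ω ^ 2 * (M ^ 2 + ξ m ω ^ 2) := by
              nlinarith [mul_nonneg (sq_nonneg (ξ m ω)) (sq_nonneg (M - ξ m ω))]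
            have e2 : M ^ 2 * ξ m ω ^ 2 ≤ M ^ 2 * b ^ 2 := by gcongr
            have e3 : ξ m ω ^ 2 * ξ m ω ^ 2 ≤ b ^ 2 * b ^ 2 := by gcongr
            nlinarith
      _ = ∫ ω, (∑ l ∈ Finset.range m, ξ l ω) ^ 4 ∂μ
          + 8 * b ^ 2 * ∫ ω, (∑ l ∈ Finset.range m, ξ l ω) ^ 2 ∂μ + 3 * b ^ 4 := by
          rw [integral_add i123 (integrable_const _), integral_add i12 i3, integral_add i1 i2,
            integral_const_mul, integral_const_mul, h.integral_sum_pow_mul_eq_zero]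
          simp
      _ ≤ _ := by
          have h1 := ih hM
          have h2 := mul_le_mul_of_nonneg_left hM.integral_sum_sq_le
            (show 0 ≤ 8 * b ^ 2 by positivity)
          have : 0 ≤ b ^ 4 := by positivity
          push_cast; nlinarith

theorem mul_predictable [IsProbabilityMeasure μ] (h : IsBoundedMartingaleDiff F μ m b ξ) {D : ℕ → Ω → ℝ} {d : ℝ}
    (hD : ∀ l < m, StronglyMeasurable[F l] (D l)) (hd : ∀ l < m, ∀ᵐ ω ∂μ, |D l ω| ≤ d) :
    IsBoundedMartingaleDiff F μ m (d * b) (fun l ω => D l ω * ξ l ω) where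
  stronglyMeasurable l hl := ((hD l hl).mono (F.mono l.le_succ)).mul (h.1 l hl)
  bound l hl := by
    filter_upwards [hd l hl, h.2 l hl] with ω h1 h2
    rw [abs_mul]
    have := (abs_nonneg _).trans h1
    gcongr
  condExp_eq_zero l hl := by
    have hξ := ((h.1 l hl).mono (F.le _)).aestronglyMeasurable (μ := μ)
    have hi : Integrable (fun ω => D l ω * ξ l ω) μ := by
      simpa using integrable_pow_mul_pow_of_bdd
        ((hD l hl).mono (F.le _)).aestronglyMeasurable hξ (hd l hl) (h.2 l hl) 1 1
    have h1 := condExp_mul_of_stronglyMeasurable_left (μ := μ) (g := ξ l) (hD l hl) hi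
      (Integrable.of_bound (C := b) hξ (h.2 l hl))
    filter_upwards [h1, h.3 l hl] with ω h1 h2
    have h1' : μ[fun ω => D l ω * ξ l ω | F l] ω = D l ω * μ[ξ l | F l] ω := h1
    rw [h1', h2]; simp

end IsBoundedMartingaleDiff

/-! ### Geometric mixingales and their Poisson decomposition -/

/-- The first `m` terms of `y` are bounded by `c`, adapted to the shifted filtration, and their
conditional expectations given the past decay geometrically at rate `r`. -/
structure IsGeometricMixingale (F : Filtration ℕ m0) (μ : Measure Ω) (m : ℕ) (c r : ℝ)
    (y : ℕ → Ω → ℝ) : Prop where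
  stronglyMeasurable : ∀ l < m, StronglyMeasurable[F (l + 1)] (y l)
  bound : ∀ l < m, ∀ᵐ ω ∂μ, |y l ω| ≤ c
  decay : ∀ j < m, ∀ l ≤ j, ∀ᵐ ω ∂μ, |(μ[y j | F l]) ω| ≤ c * r ^ (j - l)

/-- The solution of the Poisson equation of a mixingale: the expected sum of the future terms. -/
noncomputable def poissonCorrector (F : Filtration ℕ m0) (μ : Measure Ω) (m : ℕ) (y : ℕ → Ω → ℝ)
    (l : ℕ) (ω : Ω) : ℝ :=
  ∑ j ∈ Finset.Ico l m, (μ[y j | F l]) ω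

/-- The martingale differences in the martingale-coboundary decomposition of a mixingale. -/
noncomputable def poissonDiff (F : Filtration ℕ m0) (μ : Measure Ω) (m : ℕ) (y : ℕ → Ω → ℝ)
    (l : ℕ) (ω : Ω) : ℝ :=
  y l ω + poissonCorrector F μ m y (l + 1) ω - poissonCorrector F μ m y l ω

namespace IsGeometricMixingale

variable {F : Filtration ℕ m0} {m : ℕ} {c r : ℝ} {y : ℕ → Ω → ℝ}

theorem integrable [IsProbabilityMeasure μ] (h : IsGeometricMixingale F μ m c r y) {l : ℕ} (hl : l < m) :
    Integrable (y l) μ :=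
  Integrable.of_bound (C := c) ((h.1 l hl).mono (F.le _)).aestronglyMeasurable (h.2 l hl)

theorem stronglyMeasurable_poissonCorrector (l : ℕ) :
    StronglyMeasurable[F l] (poissonCorrector F μ m y l) :=
  Finset.stronglyMeasurable_fun_sum _ fun _ _ => stronglyMeasurable_condExp

/-- The geometric series gives a bound free of `m` and `l`, so the coboundary contributes only O(1)
to sums. -/
theorem ae_abs_poissonCorrector_le (h : IsGeometricMixingale F μ m c r y) (hc : 0 ≤ c)
    (hr0 : 0 ≤ r) (hr : r < 1) (l : ℕ) :
    ∀ᵐ ω ∂μ, |poissonCorrector F μ m y l ω| ≤ c / (1 - r) := by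
  have : ∀ᵐ ω ∂μ, ∀ j ∈ Finset.Ico l m, |(μ[y j | F l]) ω| ≤ c * r ^ (j - l) :=
    (ae_ball_iff (Finset.countable_toSet _)).2 fun j hj =>
      h.3 j (Finset.mem_Ico.1 hj).2 l (Finset.mem_Ico.1 hj).1
  filter_upwards [this] with ω hω
  refine (Finset.abs_sum_le_sum_abs _ _).trans ((Finset.sum_le_sum hω).trans ?_)
  rw [← Finset.mul_sum, div_eq_mul_inv]
  gcongr
  rw [Finset.sum_Ico_eq_sum_range]
  simp only [Nat.add_sub_cancel_left]
  rw [← tsum_geometric_of_lt_one hr0 hr]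
  exact (summable_geometric_of_lt_one hr0 hr).sum_le_tsum _ fun i _ => by positivity

/-- By the tower property, y_l plus the corrector at l + 1 has conditional expectation given F l
equal to the corrector at l. -/
theorem isBoundedMartingaleDiff [IsProbabilityMeasure μ] (h : IsGeometricMixingale F μ m c r y) (hc : 0 ≤ c)
    (hr0 : 0 ≤ r) (hr : r < 1) :
    IsBoundedMartingaleDiff F μ m (c + 2 * (c / (1 - r))) (poissonDiff F μ m y) where
  stronglyMeasurable l hl := ((h.1 l hl).add (stronglyMeasurable_poissonCorrector (l + 1))).sub
    ((stronglyMeasurable_poissonCorrector l).mono (F.mono l.le_succ))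
  bound l hl := by
    filter_upwards [h.2 l hl, h.ae_abs_poissonCorrector_le hc hr0 hr l,
      h.ae_abs_poissonCorrector_le hc hr0 hr (l + 1)] with ω h1 h2 h3
    simp only [poissonDiff]
    rw [abs_le] at *
    constructor <;> linarith [h1.1, h1.2, h2.1, h2.2, h3.1, h3.2]
  condExp_eq_zero l hl := by
    have e : poissonDiff F μ m y l = (y l + ∑ j ∈ Finset.Ico (l + 1) m, μ[y j | F (l + 1)])
        - poissonCorrector F μ m y l := by
      ext ω
      simp [poissonDiff, poissonCorrector, Finset.sum_apply]
    have i2 : Integrable (∑ j ∈ Finset.Ico (l + 1) m, μ[y j | F (l + 1)]) μ :=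
      integrable_finsetSum' _ fun _ _ => integrable_condExp
    have i3 : Integrable (poissonCorrector F μ m y l) μ :=
      integrable_finsetSum _ fun _ _ => integrable_condExp
    have h1 := condExp_sub ((h.integrable hl).add i2) i3 (F l)
    have h2 := condExp_add (h.integrable hl) i2 (F l)
    have h3 := condExp_finsetSum (s := Finset.Ico (l + 1) m) (f := fun j => μ[y j | F (l + 1)])
      (fun _ _ => integrable_condExp (μ := μ)) (F l)
    have h4 : ∀ᵐ ω ∂μ, ∀ j ∈ Finset.Ico (l + 1) m,
        (μ[μ[y j | F (l + 1)] | F l]) ω = (μ[y j | F l]) ω :=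
      (ae_ball_iff (Finset.countable_toSet _)).2 fun j hj =>
        condExp_condExp_of_le (F.mono l.le_succ) (F.le _)
    have h5 : μ[poissonCorrector F μ m y l | F l] = poissonCorrector F μ m y l :=
      condExp_of_stronglyMeasurable (F.le l) (stronglyMeasurable_poissonCorrector l) i3
    rw [e]
    filter_upwards [h1, h2, h3, h4] with ω h1 h2 h3 h4
    rw [h1, Pi.sub_apply, h2, Pi.add_apply, h3, h5, Finset.sum_apply, Finset.sum_congr rfl h4,
      poissonCorrector, Finset.sum_eq_sum_Ico_succ_bot hl]
    simp

/-- The coboundary telescopes, and the corrector at m is an empty sum. -/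
theorem sum_eq (ω : Ω) : ∑ l ∈ Finset.range m, y l ω =
    ∑ l ∈ Finset.range m, poissonDiff F μ m y l ω + poissonCorrector F μ m y 0 ω := by
  have h0 : poissonCorrector F μ m y m ω = 0 := by simp [poissonCorrector]
  have : ∑ l ∈ Finset.range m, poissonDiff F μ m y l ω = ∑ l ∈ Finset.range m, y l ω
      + (poissonCorrector F μ m y m ω - poissonCorrector F μ m y 0 ω) := by
    rw [← Finset.sum_range_sub (fun l => poissonCorrector F μ m y l ω), ← Finset.sum_add_distrib]
    exact Finset.sum_congr rfl fun l _ => by simp only [poissonDiff]; ring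
  rw [this, h0]; ring

theorem ae_abs_le (h : IsGeometricMixingale F μ m c r y) :
    ∀ᵐ ω ∂μ, ∀ l ∈ Finset.range m, |y l ω| ≤ c :=
  (ae_ball_iff (Finset.countable_toSet _)).2 fun l hl => h.2 l (Finset.mem_range.1 hl)

theorem integrable_sum_pow [IsProbabilityMeasure μ] (h : IsGeometricMixingale F μ m c r y) (p : ℕ) :
    Integrable (fun ω => (∑ l ∈ Finset.range m, y l ω) ^ p) μ := by
  have h1 : StronglyMeasurable[F m] (fun ω => ∑ l ∈ Finset.range m, y l ω) :=
    Finset.stronglyMeasurable_fun_sum _ fun l hl =>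
      (h.1 l (Finset.mem_range.1 hl)).mono (F.mono (Finset.mem_range.1 hl))
  have h2 : ∀ᵐ ω ∂μ, |∑ l ∈ Finset.range m, y l ω| ≤ m * c := by
    filter_upwards [h.ae_abs_le] with ω hω
    refine (Finset.abs_sum_le_sum_abs _ _).trans ((Finset.sum_le_sum hω).trans ?_)
    simp
  have h3 := (h1.mono (F.le _)).aestronglyMeasurable (μ := μ)
  simpa using integrable_pow_mul_pow_of_bdd h3 h3 h2 h2 p 0

theorem integral_sum_pow_four_le [IsProbabilityMeasure μ] (h : IsGeometricMixingale F μ m c r y) (hc : 0 ≤ c)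
    (hr0 : 0 ≤ r) (hr : r < 1) :
    ∫ ω, (∑ l ∈ Finset.range m, y l ω) ^ 4 ∂μ ≤
      8 * (4 * m ^ 2 * (c + 2 * (c / (1 - r))) ^ 4) + 8 * (c / (1 - r)) ^ 4 := by
  have hB := h.isBoundedMartingaleDiff hc hr0 hr
  have hM := (hB.stronglyMeasurable_sum.mono (F.le _)).aestronglyMeasurable (μ := μ)
  have i1 : Integrable (fun ω => (∑ l ∈ Finset.range m, poissonDiff F μ m y l ω) ^ 4) μ := by
    simpa using integrable_pow_mul_pow_of_bdd hM hM hB.ae_abs_sum_le hB.ae_abs_sum_le 4 0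
  calc _ ≤ ∫ ω, (8 * (∑ l ∈ Finset.range m, poissonDiff F μ m y l ω) ^ 4
          + 8 * (c / (1 - r)) ^ 4) ∂μ := by
        refine integral_mono_ae (h.integrable_sum_pow 4)
          ((i1.const_mul 8).add (integrable_const _)) ?_
        filter_upwards [h.ae_abs_poissonCorrector_le hc hr0 hr 0] with ω hω
        rw [sum_eq (F := F) (μ := μ)]
        generalize ∑ l ∈ Finset.range m, poissonDiff F μ m y l ω = M
        generalize poissonCorrector F μ m y 0 ω = g at hω ⊢
        have h1 : g ^ 4 ≤ (c / (1 - r)) ^ 4 := by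
          have : g ^ 4 = |g| ^ 4 := by rw [← abs_pow, abs_of_nonneg (by positivity)]
          rw [this]; gcongr
        have h2 : (M + g) ^ 2 ≤ 2 * (M ^ 2 + g ^ 2) := by nlinarith [sq_nonneg (M - g)]
        have h3 : (M + g) ^ 2 * (M + g) ^ 2 ≤ 2 * (M ^ 2 + g ^ 2) * (2 * (M ^ 2 + g ^ 2)) := by
          gcongr
        nlinarith [sq_nonneg (M ^ 2 - g ^ 2)]
    _ = 8 * ∫ ω, (∑ l ∈ Finset.range m, poissonDiff F μ m y l ω) ^ 4 ∂μ
          + 8 * (c / (1 - r)) ^ 4 := by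
        rw [integral_add (i1.const_mul 8) (integrable_const _), integral_const_mul 8 (fun ω => _ ^ 4)]
        simp only [integral_const, probReal_univ, one_smul]
    _ ≤ _ := by gcongr; exact hB.integral_sum_pow_four_le

/-- Condition on F (l + 1), the first σ-algebra at which y_l is known; this costs one unit in the
exponent. -/
theorem abs_integral_mul_le [IsProbabilityMeasure μ] (h : IsGeometricMixingale F μ m c r y) (hc : 0 ≤ c)
    {l j : ℕ} (hlj : l < j) (hj : j < m) :
    |∫ ω, y l ω * y j ω ∂μ| ≤ c ^ 2 * r ^ (j - (l + 1)) := by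
  have hl := h.1 l (by omega)
  have hj1 := ((h.1 j hj).mono (F.le _)).aestronglyMeasurable (μ := μ)
  have hl1 := (hl.mono (F.le _)).aestronglyMeasurable (μ := μ)
  have hi : Integrable (fun ω => y l ω * y j ω) μ := by
    simpa using integrable_pow_mul_pow_of_bdd hl1 hj1 (h.2 l (by omega)) (h.2 j hj) 1 1
  rw [← integral_condExp (F.le (l + 1))]
  have hbd : ∀ᵐ ω ∂μ, ‖(μ[fun ω => y l ω * y j ω | F (l + 1)]) ω‖ ≤ c ^ 2 * r ^ (j - (l + 1)) := by
    filter_upwards [condExp_mul_of_stronglyMeasurable_left hl hi (h.integrable hj),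
      h.3 j hj (l + 1) hlj, h.2 l (by omega)] with ω h1 h2 h3
    have h1' : (μ[fun ω => y l ω * y j ω | F (l + 1)]) ω = y l ω * (μ[y j | F (l + 1)]) ω := h1
    rw [h1', norm_mul, sq, mul_assoc, Real.norm_eq_abs, Real.norm_eq_abs]
    gcongr
  simpa using norm_integral_le_of_norm_le_const hbd

/-- The form is its diagonal plus twice Σ y_l D_l, where D_l is the weighted past, of size at most
cβ. Splitting y_l into a martingale difference and a coboundary gives a martingale transform N with
E N² = O(mβ²). The coboundary part, summed by parts, involves only increments of D, and these are
O(1) because the weights are monotone; so it is O(m) like the diagonal. -/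
theorem integral_quadratic_sq_le [IsProbabilityMeasure μ] (h : IsGeometricMixingale F μ m c r y) (hc : 0 ≤ c)
    (hr0 : 0 ≤ r) (hr : r < 1) {a : ℕ → ℝ} (ha : Antitone a) (ha0 : ∀ l, 0 ≤ a l)
    (ha1 : a 0 ≤ 1) {β : ℝ} (hβ : ∀ l, ∑ i ∈ Finset.range l, a (i + 1) ≤ β) :
    ∫ ω, (∑ l ∈ Finset.range m, ∑ j ∈ Finset.range m,
        a (l - j + (j - l)) * y l ω * y j ω) ^ 2 ∂μ ≤
      2 * (m * (c ^ 2 + 4 * (c / (1 - r)) * c)) ^ 2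
        + 8 * (m * (c * β * (c + 2 * (c / (1 - r)))) ^ 2) := by
  set g := poissonCorrector F μ m y with hg
  set D : ℕ → Ω → ℝ := fun l ω => ∑ j ∈ Finset.range l, a (l - j) * y j ω with hD
  have hB := h.isBoundedMartingaleDiff hc hr0 hr
  have hreflect : ∀ l : ℕ, ∀ f : ℕ → ℝ,
      ∑ j ∈ Finset.range l, f (l - j) = ∑ i ∈ Finset.range l, f (i + 1) := fun l f => by
    rw [← Finset.sum_range_reflect (fun i => f (i + 1))]
    refine Finset.sum_congr rfl fun j hj => ?_
    rw [Finset.mem_range] at hj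
    congr 1; omega
  have hDm : ∀ l < m, StronglyMeasurable[F l] (D l) := fun l hl =>
    Finset.stronglyMeasurable_fun_sum _ fun j hj => by
      have hj := Finset.mem_range.1 hj
      exact ((h.1 j (by omega)).mono (F.mono hj)).const_mul _
  have hDb : ∀ l < m, ∀ᵐ ω ∂μ, |D l ω| ≤ c * β := fun l hl => by
    filter_upwards [h.ae_abs_le] with ω hω
    calc |D l ω| ≤ ∑ j ∈ Finset.range l, a (l - j) * c := by
          refine (Finset.abs_sum_le_sum_abs _ _).trans (Finset.sum_le_sum fun j hj => ?_)
          have hj := Finset.mem_range.1 hj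
          rw [abs_mul, abs_of_nonneg (ha0 _)]
          exact mul_le_mul_of_nonneg_left (hω j (Finset.mem_range.2 (by omega))) (ha0 _)
      _ = c * ∑ i ∈ Finset.range l, a (i + 1) := by
          rw [← Finset.sum_mul, hreflect l a, mul_comm]
      _ ≤ _ := by gcongr; exact hβ l
  have hN := hB.mul_predictable hDm hDb
  set N : Ω → ℝ := fun ω => ∑ l ∈ Finset.range m, D l ω * poissonDiff F μ m y l ω with hNdef
  have hNm := (hN.stronglyMeasurable_sum.mono (F.le _)).aestronglyMeasurable (μ := μ)
  have hNi : Integrable (fun ω => N ω ^ 2) μ := by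
    simpa using integrable_pow_mul_pow_of_bdd hNm hNm hN.ae_abs_sum_le hN.ae_abs_sum_le 2 0
  -- The weights of the old terms all decrease, by a total of a 1 - a (l + 1), and the new term has
  -- weight a 1.
  have hDdiff : ∀ᵐ ω ∂μ, ∀ l ∈ Finset.range m, |D (l + 1) ω - D l ω| ≤ 2 * c := by
    filter_upwards [h.ae_abs_le] with ω hω l hl
    have hl := Finset.mem_range.1 hl
    have e : D (l + 1) ω - D l ω
        = ∑ j ∈ Finset.range l, (a (l + 1 - j) - a (l - j)) * y j ω + a 1 * y l ω := by
      simp only [hD, Finset.sum_range_succ, sub_mul, Finset.sum_sub_distrib]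
      rw [Nat.add_sub_cancel_left]; ring
    rw [e]
    have h1 : |a 1 * y l ω| ≤ a 1 * c := by
      rw [abs_mul, abs_of_nonneg (ha0 _)]
      exact mul_le_mul_of_nonneg_left (hω l (Finset.mem_range.2 hl)) (ha0 _)
    have h2 : |∑ j ∈ Finset.range l, (a (l + 1 - j) - a (l - j)) * y j ω|
        ≤ ∑ j ∈ Finset.range l, (a (l - j) - a (l - j + 1)) * c := by
      refine (Finset.abs_sum_le_sum_abs _ _).trans (Finset.sum_le_sum fun j hj => ?_)
      have hj := Finset.mem_range.1 hj
      have hs : l + 1 - j = l - j + 1 := by omega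
      have := ha (Nat.le_succ (l - j))
      rw [abs_mul, hs, abs_sub_comm, abs_of_nonneg (sub_nonneg.2 this)]
      exact mul_le_mul_of_nonneg_left (hω j (Finset.mem_range.2 (by omega))) (sub_nonneg.2 this)
    have h3 : ∑ j ∈ Finset.range l, (a (l - j) - a (l - j + 1)) * c
        = (a 1 - a (l + 1)) * c := by
      rw [← Finset.sum_mul, hreflect l (fun i => a i - a (i + 1)),
        Finset.sum_range_sub' (fun i => a (i + 1))]
    have h4 : a 1 ≤ 1 := (ha zero_le_one).trans ha1
    have h5 := ha0 (l + 1)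
    have h6 := (abs_add_le (∑ j ∈ Finset.range l, (a (l + 1 - j) - a (l - j)) * y j ω) (a 1 * y l ω))
    nlinarith
  have hgb : ∀ᵐ ω ∂μ, ∀ l ∈ Finset.range m, |g (l + 1) ω| ≤ c / (1 - r) :=
    (ae_ball_iff (Finset.countable_toSet _)).2 fun l _ =>
      h.ae_abs_poissonCorrector_le hc hr0 hr (l + 1)
  have hc1 : 0 ≤ c / (1 - r) := div_nonneg hc (by linarith)
  set Q : Ω → ℝ := fun ω => ∑ l ∈ Finset.range m, ∑ j ∈ Finset.range m,
        a (l - j + (j - l)) * y l ω * y j ω with hQ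
  have hQN : ∀ᵐ ω ∂μ, |Q ω - 2 * N ω| ≤ m * (c ^ 2 + 4 * (c / (1 - r)) * c) := by
    filter_upwards [h.ae_abs_le, hDdiff, hgb] with ω h1 h2 h3
    have e1 : Q ω = ∑ l ∈ Finset.range m, a 0 * y l ω * y l ω
        + 2 * ∑ l ∈ Finset.range m, y l ω * D l ω := by
      simp only [hQ]
      rw [sum_range_sum_range_of_symm]
      · congr 2
        · simp
        · refine Finset.sum_congr rfl fun l _ => ?_
          rw [Finset.mul_sum]
          refine Finset.sum_congr rfl fun j hj => ?_
          have hj := Finset.mem_range.1 hj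
          rw [show l - j + (j - l) = l - j by omega]; ring
      · intro l j
        rw [add_comm (l - j)]; ring
    have e2 : ∑ l ∈ Finset.range m, y l ω * D l ω
        = N ω + ∑ l ∈ Finset.range m, g (l + 1) ω * (D (l + 1) ω - D l ω) := by
      -- Both boundary terms vanish: g m and D 0 are empty sums.
      have e3 := sum_range_sub_mul_eq (fun l => g l ω) (fun l => D l ω) m
      have h0 : g m ω = 0 := by simp [hg, poissonCorrector]
      have h00 : D 0 ω = 0 := by simp [hD]
      rw [h0, h00] at e3
      simp only [mul_zero, zero_mul, sub_zero, zero_add] at e3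
      rw [← e3, hNdef, ← Finset.sum_add_distrib]
      refine Finset.sum_congr rfl fun l _ => ?_
      simp only [poissonDiff, ← hg]; ring
    have e4 : Q ω - 2 * N ω = ∑ l ∈ Finset.range m, (a 0 * y l ω * y l ω
        + 2 * (g (l + 1) ω * (D (l + 1) ω - D l ω))) := by
      rw [e1, e2, Finset.sum_add_distrib, ← Finset.mul_sum]; ring
    rw [e4]
    refine (Finset.abs_sum_le_sum_abs _ _).trans ((Finset.sum_le_sum
      (g := fun _ => c ^ 2 + 4 * (c / (1 - r)) * c) fun l hl => ?_).trans ?_)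
    · have t1 : |a 0 * y l ω * y l ω| ≤ 1 * c * c := by
        rw [abs_mul, abs_mul, abs_of_nonneg (ha0 0)]
        have := h1 l hl
        gcongr
      have t2 : |2 * (g (l + 1) ω * (D (l + 1) ω - D l ω))| ≤ 2 * (c / (1 - r) * (2 * c)) := by
        rw [abs_mul, abs_mul, abs_two]
        have := h2 l hl
        have := h3 l hl
        gcongr
      refine (abs_add_le _ _).trans ?_
      linarith
    · simp [mul_add]
  have hQm : AEStronglyMeasurable Q μ := by
    refine (Finset.stronglyMeasurable_fun_sum _ fun l hl => Finset.stronglyMeasurable_fun_sum _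
      fun j hj => ?_ : StronglyMeasurable Q).aestronglyMeasurable
    exact (((h.1 l (Finset.mem_range.1 hl)).mono (F.le _)).const_mul _).mul
      ((h.1 j (Finset.mem_range.1 hj)).mono (F.le _))
  have key : ∀ᵐ ω ∂μ, Q ω ^ 2 ≤ 2 * (m * (c ^ 2 + 4 * (c / (1 - r)) * c)) ^ 2 + 8 * N ω ^ 2 := by
    filter_upwards [hQN] with ω hω
    -- The claim reduces to Q² ≤ 2(Q - 2N)² + 8N², whose two sides differ by (Q - 4N)².
    have := sq_le_sq' (abs_le.1 hω).1 (abs_le.1 hω).2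
    nlinarith [sq_nonneg (Q ω - 4 * N ω)]
  have hi : Integrable (fun ω => 2 * (m * (c ^ 2 + 4 * (c / (1 - r)) * c)) ^ 2 + 8 * N ω ^ 2) μ :=
    (integrable_const _).add (hNi.const_mul 8)
  calc _ ≤ ∫ ω, (2 * (m * (c ^ 2 + 4 * (c / (1 - r)) * c)) ^ 2 + 8 * N ω ^ 2) ∂μ := by
        refine integral_mono_of_nonneg (ae_of_all _ fun ω => sq_nonneg _) hi key
    _ = 2 * (m * (c ^ 2 + 4 * (c / (1 - r)) * c)) ^ 2 + 8 * ∫ ω, N ω ^ 2 ∂μ := by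
        rw [integral_add (integrable_const _) (hNi.const_mul 8), integral_const_mul 8 (fun ω => N ω ^ 2)]
        simp only [integral_const, probReal_univ, one_smul]
    _ ≤ _ := by gcongr; exact hN.integral_sum_sq_le

end IsGeometricMixingale

end Martingale

/-! ### The Parzen kernel -/

theorem parzen_neg (x : ℝ) : parzen (-x) = parzen x := by simp [parzen]

theorem parzen_of_nonneg {x : ℝ} (hx : 0 ≤ x) : parzen x =
    if x ≤ 1 / 2 then 1 - 6 * x ^ 2 + 6 * x ^ 3 else if x ≤ 1 then 2 * (1 - x) ^ 3 else 0 := by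
  simp [parzen, abs_of_nonneg hx]

theorem parzen_nonneg (x : ℝ) : 0 ≤ parzen x := by
  have h := abs_nonneg x
  rw [parzen]
  split_ifs with h1 h2
  · rw [← sq_abs]
    nlinarith [mul_nonneg h h, mul_nonneg h (sub_nonneg.2 h1), pow_nonneg h 3]
  · have := sub_nonneg.2 h2; positivity
  · exact le_rfl

theorem parzen_zero : parzen 0 = 1 := by simp [parzen]

/-- Each piece decreases, and the two formulas agree at 1/2, where both give 1/4. -/
theorem antitoneOn_parzen : AntitoneOn parzen (Set.Ici 0) := by
  have key1 : ∀ x y : ℝ, 0 ≤ x → x ≤ y → y ≤ 1 / 2 → parzen y ≤ parzen x := by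
    intro x y hx hxy hy
    rw [parzen_of_nonneg hx, parzen_of_nonneg (hx.trans hxy), if_pos hy, if_pos (hxy.trans hy)]
    have hx2 := hxy.trans hy
    nlinarith [mul_nonneg (sub_nonneg.2 hxy) (mul_nonneg hx (sub_nonneg.2 hx2)),
      mul_nonneg (sub_nonneg.2 hxy) (mul_nonneg (hx.trans hxy) (sub_nonneg.2 hy)),
      mul_nonneg (sub_nonneg.2 hxy) (mul_nonneg hx (sub_nonneg.2 hy)),
      mul_nonneg (sub_nonneg.2 hxy) (mul_nonneg (hx.trans hxy) (sub_nonneg.2 hx2)),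
      mul_nonneg (sub_nonneg.2 hxy) hx, mul_nonneg (sub_nonneg.2 hxy) (hx.trans hxy)]
  have half : parzen (1 / 2) = 2 * (1 - 1 / 2) ^ 3 := by
    rw [parzen_of_nonneg (by norm_num), if_pos le_rfl]; norm_num
  have val : ∀ x : ℝ, 1 / 2 ≤ x → x ≤ 1 → parzen x = 2 * (1 - x) ^ 3 := by
    intro x h1 h2
    rcases h1.eq_or_lt with h | h
    · rw [← h, half]
    · rw [parzen_of_nonneg (by linarith), if_neg (by linarith), if_pos h2]
  have key2 : ∀ x y : ℝ, 1 / 2 ≤ x → x ≤ y → parzen y ≤ parzen x := by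
    intro x y hx hxy
    rcases le_or_gt y 1 with h | h
    · rw [val x hx (hxy.trans h), val y (hx.trans hxy) h]
      have : 0 ≤ 1 - y := by linarith
      gcongr
    · rw [parzen_of_nonneg (by linarith : (0 : ℝ) ≤ y), if_neg (by linarith), if_neg (by linarith)]
      exact parzen_nonneg x
  intro x hx y hy hxy
  rcases le_or_gt y (1 / 2) with h | h
  · exact key1 x y hx hxy h
  · rcases le_or_gt x (1 / 2) with h' | h'
    · exact (key2 _ _ le_rfl h.le).trans (key1 x _ hx h' le_rfl)
    · exact key2 _ _ h'.le hxy

theorem parzen_le_one (x : ℝ) : parzen x ≤ 1 := by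
  have h := antitoneOn_parzen (Set.mem_Ici.2 le_rfl) (Set.mem_Ici.2 (abs_nonneg x)) (abs_nonneg x)
  rw [parzen_zero] at h
  rcases abs_choice x with h' | h' <;> rw [h'] at h
  · exact h
  · rwa [parzen_neg] at h

theorem antitone_parzen_div {B : ℝ} (hB : 0 < B) : Antitone fun l : ℕ => parzen (l / B) :=
  fun l j hlj => antitoneOn_parzen (Set.mem_Ici.2 (by positivity)) (Set.mem_Ici.2 (by positivity))
    (by gcongr)

theorem sum_parzen_div_le {B : ℝ} (hB : 0 < B) (l : ℕ) :
    ∑ i ∈ Finset.range l, parzen (((i + 1 : ℕ) : ℝ) / B) ≤ B := by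
  -- The minimum closes the induction: terms are at most 1 while i + 1 ≤ B and vanish afterwards.
  have h : ∀ l : ℕ, ∑ i ∈ Finset.range l, parzen (((i + 1 : ℕ) : ℝ) / B) ≤ min (l : ℝ) B := by
    intro l
    induction l with
    | zero => simpa using hB.le
    | succ l ih =>
      rw [Finset.sum_range_succ]
      rcases le_or_gt ((l + 1 : ℕ) : ℝ) B with h | h
      · rw [min_eq_left h]
        have := parzen_le_one (((l + 1 : ℕ) : ℝ) / B)
        push_cast at *
        linarith [min_le_left (l : ℝ) B]
      · have : parzen (((l + 1 : ℕ) : ℝ) / B) = 0 := by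
          have h1 : 1 < ((l + 1 : ℕ) : ℝ) / B := by rwa [one_lt_div hB]
          rw [parzen_of_nonneg (by linarith), if_neg (by linarith), if_neg (by linarith)]
        rw [this, min_eq_right h.le, add_zero]
        exact ih.trans (min_le_right _ _)
  exact (h l).trans (min_le_right _ _)

theorem tendsto_parzen_div {B : ℕ → ℝ} (hB : Tendsto B atTop atTop) (l : ℝ) :
    Tendsto (fun n => parzen (l / B n)) atTop (𝓝 1) := by
  have h0 : Tendsto (fun n => l / B n) atTop (𝓝 0) := hB.const_div_atTop l
  have hc : Tendsto (fun x : ℝ => 1 - 6 * x ^ 2 + 6 * |x| ^ 3) (𝓝 0) (𝓝 1) := by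
    have : Continuous fun x : ℝ => 1 - 6 * x ^ 2 + 6 * |x| ^ 3 := by fun_prop
    simpa using this.tendsto 0
  refine (hc.comp h0).congr' ?_
  have h1 : ∀ᶠ n in atTop, |l / B n| < 1 / 2 := by
    have := h0.abs
    rw [abs_zero] at this
    exact this.eventually (gt_mem_nhds (by norm_num))
  filter_upwards [h1] with n hn
  simp [parzen, (by simpa using hn.le : |l / B n| ≤ 2⁻¹)]

/-! ### Toeplitz averages and the long-run variance -/

/-- With truncated subtraction `l - j + (j - l)` is |l - j|, and the distance i + 1 occurs m - (i +
1) times on each side of the diagonal. -/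
theorem sum_range_sum_range_dist_eq (f : ℕ → ℝ) (m : ℕ) :
    ∑ l ∈ Finset.range m, ∑ j ∈ Finset.range m, f (l - j + (j - l)) =
      m * f 0 + 2 * ∑ i ∈ Finset.range m, ((m : ℝ) - (i + 1)) * f (i + 1) := by
  rw [sum_range_sum_range_of_symm (fun l j => f (l - j + (j - l))) (fun l j => by rw [add_comm])]
  congr 1
  · simp
  · congr 1
    induction m with
    | zero => simp
    | succ m ih =>
      have e : ∑ j ∈ Finset.range m, f (m - j + (j - m)) = ∑ i ∈ Finset.range m, f (i + 1) := by
        rw [← Finset.sum_range_reflect (fun i => f (i + 1))]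
        refine Finset.sum_congr rfl fun j hj => ?_
        have := Finset.mem_range.1 hj
        congr 1; omega
      rw [Finset.sum_range_succ, ih, e, Finset.sum_range_succ, ← Finset.sum_add_distrib]
      push_cast
      simp only [sub_self, zero_mul, add_zero]
      exact Finset.sum_congr rfl fun i _ => by ring

/-- The long-run variance of a stationary sequence with autocovariances `γ`. -/
noncomputable def longRunVariance (γ : ℕ → ℝ) : ℝ := γ 0 + 2 * ∑' i, γ (i + 1)

/-- Lag i + 1 enters with the factor (1 - (i + 1)/m) a(i + 1), which tends to 1 and is at most 1 in
absolute value; dominated convergence with the bound c rⁱ finishes. -/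
theorem tendsto_average_toeplitz {γ : ℕ → ℝ} {c r : ℝ} (hr0 : 0 ≤ r) (hr : r < 1)
    (hγ : ∀ i, |γ (i + 1)| ≤ c * r ^ i) (a : ℕ → ℕ → ℝ) (ha : ∀ n l, |a n l| ≤ 1)
    (ha1 : ∀ l, Tendsto (fun n => a n l) atTop (𝓝 1)) {m : ℕ → ℕ} (hm : Tendsto m atTop atTop) :
    Tendsto (fun n => 1 / (m n : ℝ) * ∑ l ∈ Finset.range (m n), ∑ j ∈ Finset.range (m n),
      a n (l - j + (j - l)) * γ (l - j + (j - l))) atTop (𝓝 (longRunVariance γ)) := by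
  have hm' : Tendsto (fun n => (m n : ℝ)) atTop atTop := tendsto_natCast_atTop_atTop.comp hm
  -- Extension by zero beyond the row makes the finite sums series over a fixed index set.
  set f : ℕ → ℕ → ℝ := fun n i =>
    if i < m n then (1 - (i + 1) / (m n : ℝ)) * (a n (i + 1) * γ (i + 1)) else 0 with hf
  have e : ∀ᶠ n in atTop, a n 0 * γ 0 + 2 * ∑' i, f n i
      = 1 / (m n : ℝ) * ∑ l ∈ Finset.range (m n), ∑ j ∈ Finset.range (m n),
        a n (l - j + (j - l)) * γ (l - j + (j - l)) := by
    filter_upwards [hm.eventually_gt_atTop 0] with n hn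
    have hn' : (m n : ℝ) ≠ 0 := by exact_mod_cast hn.ne'
    have e1 : ∑ i ∈ Finset.range (m n), f n i = 1 / (m n : ℝ) *
        ∑ i ∈ Finset.range (m n), ((m n : ℝ) - (i + 1)) * (a n (i + 1) * γ (i + 1)) := by
      rw [Finset.mul_sum]
      refine Finset.sum_congr rfl fun i hi => ?_
      rw [hf]; simp only [Finset.mem_range.1 hi, if_true]
      field_simp
    rw [sum_range_sum_range_dist_eq (fun i => a n i * γ i),
      tsum_eq_sum (f := f n) (s := Finset.range (m n)), e1]
    · field_simp
    · intro i hi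
      have : ¬ i < m n := fun h => hi (Finset.mem_range.2 h)
      simp [hf, this]
  refine Tendsto.congr' e ?_
  refine Tendsto.add (by simpa using (ha1 0).mul_const (γ 0)) (Tendsto.const_mul 2 ?_)
  refine tendsto_tsum_of_dominated_convergence (bound := fun i => c * r ^ i)
    ((summable_geometric_of_lt_one hr0 hr).mul_left c) (fun i => ?_) ?_
  · have h1 : Tendsto (fun n => (1 - ((i : ℝ) + 1) / (m n : ℝ)) * (a n (i + 1) * γ (i + 1))) atTop
        (𝓝 ((1 - 0) * (1 * γ (i + 1)))) :=
      (tendsto_const_nhds.sub (hm'.const_div_atTop _)).mul ((ha1 (i + 1)).mul_const _)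
    rw [sub_zero, one_mul, one_mul] at h1
    refine h1.congr' ?_
    filter_upwards [hm.eventually_gt_atTop i] with n hn
    simp [hf, hn]
  · refine Eventually.of_forall fun n i => ?_
    have hb : 0 ≤ c * r ^ i := (abs_nonneg _).trans (hγ i)
    simp only [hf]
    split_ifs with hi
    · have hi' : (i : ℝ) + 1 ≤ m n := by exact_mod_cast hi
      have hpos : (0 : ℝ) < m n := lt_of_lt_of_le (by positivity) hi'
      have h1 : |1 - ((i : ℝ) + 1) / (m n : ℝ)| ≤ 1 := by
        rw [abs_le]
        have : ((i : ℝ) + 1) / (m n : ℝ) ≤ 1 := by rwa [div_le_one hpos]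
        have : 0 ≤ ((i : ℝ) + 1) / (m n : ℝ) := by positivity
        constructor <;> linarith
      rw [norm_mul, norm_mul, Real.norm_eq_abs, Real.norm_eq_abs, Real.norm_eq_abs]
      calc _ ≤ 1 * (1 * (c * r ^ i)) := by
            gcongr
            · exact ha _ _
            · exact hγ i
        _ = _ := by ring
    · simpa using hb

/-! ### Bounded test functions and conditional expectations in weak form -/

/-- A bounded real function. -/
def IsBddFun {α : Type*} (f : α → ℝ) : Prop := ∃ c, ∀ x, |f x| ≤ c

namespace IsBddFun

variable {α β : Type*} {f g : α → ℝ}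

theorem mul (hf : IsBddFun f) (hg : IsBddFun g) : IsBddFun fun x => f x * g x := by
  obtain ⟨a, ha⟩ := hf
  obtain ⟨b, hb⟩ := hg
  refine ⟨a * b, fun x => ?_⟩
  rw [abs_mul]
  have := (abs_nonneg _).trans (ha x)
  exact mul_le_mul (ha x) (hb x) (abs_nonneg _) this

theorem const (c : ℝ) : IsBddFun fun _ : α => c := ⟨|c|, fun _ => le_rfl⟩

theorem sum {ι : Type*} (s : Finset ι) {f : ι → α → ℝ} (hf : ∀ i ∈ s, IsBddFun (f i)) :
    IsBddFun fun x => ∑ i ∈ s, f i x := by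
  classical
  induction s using Finset.induction_on with
  | empty => simpa using const 0
  | insert i s hi ih =>
    obtain ⟨a, ha⟩ := hf i (Finset.mem_insert_self i s)
    obtain ⟨b, hb⟩ := ih fun j hj => hf j (Finset.mem_insert_of_mem hj)
    refine ⟨a + b, fun x => ?_⟩
    simp only [Finset.sum_insert hi]
    exact (abs_add_le _ _).trans (add_le_add (ha x) (hb x))

theorem comp (hf : IsBddFun f) (g : β → α) : IsBddFun fun x => f (g x) :=
  let ⟨a, ha⟩ := hf; ⟨a, fun x => ha (g x)⟩

theorem of_finite [Finite α] (f : α → ℝ) : IsBddFun f := by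
  have := Fintype.ofFinite α
  exact ⟨∑ x, |f x|, fun x => Finset.single_le_sum (f := fun x => |f x|)
    (fun _ _ => abs_nonneg _) (Finset.mem_univ x)⟩

theorem ite (p : α → Prop) [DecidablePred p] : IsBddFun fun x => if p x then (1 : ℝ) else 0 :=
  ⟨1, fun x => by by_cases h : p x <;> simp [h]⟩

theorem integrable [MeasurableSpace α] {μ : Measure α} [IsFiniteMeasure μ] (hf : IsBddFun f)
    (hm : AEStronglyMeasurable f μ) : Integrable f μ :=
  let ⟨a, ha⟩ := hf; Integrable.of_bound (C := a) hm (ae_of_all _ ha)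

end IsBddFun

section Conditional

variable {Ω : Type*} {m m0 : MeasurableSpace Ω} {μ : Measure Ω} [IsProbabilityMeasure μ]

/-- The almost sure bound matters: stationary means built from conditional probabilities are bounded
only almost everywhere. -/
theorem integral_mul_condExp_eq_of_ae_bdd (hm : m ≤ m0) {g Z : Ω → ℝ} (hg : Integrable g μ)
    (hZ : StronglyMeasurable[m] Z) {c : ℝ} (hc : ∀ᵐ ω ∂μ, |Z ω| ≤ c) :
    ∫ ω, Z ω * (μ[g | m]) ω ∂μ = ∫ ω, Z ω * g ω ∂μ := by
  have hi : Integrable (fun ω => Z ω * g ω) μ :=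
    hg.bdd_mul (hZ.mono hm).aestronglyMeasurable hc
  rw [← integral_condExp hm (f := fun ω => Z ω * g ω)]
  exact integral_congr_ae (condExp_mul_of_stronglyMeasurable_left hZ hi hg).symm

theorem integral_mul_condExp_eq (hm : m ≤ m0) {g Z : Ω → ℝ} (hg : Integrable g μ)
    (hZ : StronglyMeasurable[m] Z) (hZb : IsBddFun Z) :
    ∫ ω, Z ω * (μ[g | m]) ω ∂μ = ∫ ω, Z ω * g ω ∂μ :=
  let ⟨_, hc⟩ := hZb
  integral_mul_condExp_eq_of_ae_bdd hm hg hZ (ae_of_all _ hc)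

/-- Indicators are admissible test functions. Conditional expectations can thus be identified from
the integral form of the Markov property. -/
theorem condExp_ae_eq_of_integral_mul (hm : m ≤ m0) {f g : Ω → ℝ} (hf : Integrable f μ)
    (hgi : Integrable g μ) (hg : StronglyMeasurable[m] g)
    (h : ∀ Z : Ω → ℝ, StronglyMeasurable[m] Z → IsBddFun Z →
      ∫ ω, Z ω * f ω ∂μ = ∫ ω, Z ω * g ω ∂μ) : μ[f | m] =ᵐ[μ] g := by
  refine (ae_eq_condExp_of_forall_setIntegral_eq hm hf (fun s _ _ => hgi.integrableOn)
    (fun s hs _ => ?_) hg.aestronglyMeasurable).symm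
  have := h (s.indicator fun _ => 1) (stronglyMeasurable_one.indicator hs)
    ⟨1, fun ω => by by_cases hω : ω ∈ s <;> simp [hω]⟩
  have e : ∀ f : Ω → ℝ, (fun ω => s.indicator (fun _ => (1 : ℝ)) ω * f ω) = s.indicator f :=
    fun f => by ext ω; by_cases hω : ω ∈ s <;> simp [hω]
  rw [e, e, integral_indicator (hm s hs), integral_indicator (hm s hs)] at this
  exact this.symm

/-- Passes from conditional probabilities of sets to integrals of bounded functions: over each
`m`-measurable set, the law of f is the second marginal of the composition of μ with κ. -/
theorem integral_mul_comp_eq_of_condExp {β : Type*} [MeasurableSpace β] (hm : m ≤ m0)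
    {κ : Ω → Measure β} [hκp : ∀ ω, IsProbabilityMeasure (κ ω)] (hκ : Measurable[m] κ)
    {f : Ω → β} (hf : Measurable f)
    (h : ∀ S, MeasurableSet S → μ⟦f ⁻¹' S | m⟧ =ᵐ[μ] fun ω => (κ ω).real S)
    {η : β → ℝ} (hη : Measurable η) (hηb : IsBddFun η)
    {Z : Ω → ℝ} (hZ : StronglyMeasurable[m] Z) (hZb : IsBddFun Z) :
    ∫ ω, Z ω * η (f ω) ∂μ = ∫ ω, Z ω * ∫ x, η x ∂(κ ω) ∂μ := by
  have hκ0 : Measurable[m0] κ := hκ.mono hm le_rfl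
  have hsm : StronglyMeasurable[m] fun ω => ∫ x, η x ∂(κ ω) := by
    -- Here κ is a kernel for the small σ-algebra, which gives `m`-measurability of the integral;
    -- the product measure below uses the ambient one.
    let K : @Kernel Ω β m _ := @Kernel.mk Ω β m _ κ hκ
    have : @IsMarkovKernel Ω β m _ K := @IsMarkovKernel.mk Ω β m _ K hκp
    exact @StronglyMeasurable.integral_kernel Ω β m _ K ℝ _ _ _ hη.stronglyMeasurable
  obtain ⟨b, hb⟩ := id hηb
  have hint : Integrable (fun ω => ∫ x, η x ∂(κ ω)) μ := by
    refine Integrable.of_bound (C := b) (hsm.mono hm).aestronglyMeasurable (ae_of_all _ fun ω => ?_)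
    simpa using norm_integral_le_of_norm_le_const (μ := κ ω) (f := η) (ae_of_all _ hb)
  have hfi : Integrable (fun ω => η (f ω)) μ :=
    (hηb.comp f).integrable (hη.comp hf).aestronglyMeasurable
  have key : μ[fun ω => η (f ω) | m] =ᵐ[μ] fun ω => ∫ x, η x ∂(κ ω) := by
    refine (ae_eq_condExp_of_forall_setIntegral_eq hm hfi (fun s _ _ => hint.integrableOn)
      (fun s hs _ => ?_) hsm.aestronglyMeasurable).symm
    let K : Kernel Ω β := ⟨κ, hκ0⟩
    have : IsMarkovKernel K := ⟨hκp⟩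
    have e : (μ.restrict s ⊗ₘ K).snd = (μ.restrict s).map f := by
      ext S hS
      rw [Measure.snd_compProd, Measure.bind_apply hS K.measurable.aemeasurable,
        Measure.map_apply hf hS, Measure.restrict_apply (hf hS)]
      have h1 : ∫ ω in s, (κ ω).real S ∂μ = μ.real (f ⁻¹' S ∩ s) := by
        rw [← setIntegral_congr_ae (hm s hs) ((h S hS).mono fun ω hω _ => hω),
          setIntegral_condExp hm ((integrable_const 1).indicator (hf hS)) hs,
          integral_indicator (hf hS)]
        simp [measureReal_def, Measure.restrict_apply (hf hS)]
      have h2 : ∫ ω in s, (κ ω).real S ∂μ = (∫⁻ ω in s, κ ω S ∂μ).toReal := by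
        simp only [measureReal_def]
        rw [integral_toReal]
        · exact ((Measure.measurable_coe hS).comp hκ0).aemeasurable
        · exact ae_of_all _ fun ω => measure_lt_top _ _
      have h3 : ∫⁻ ω in s, κ ω S ∂μ ≠ ∞ := by
        refine ((lintegral_mono (g := fun _ => 1) fun ω => prob_le_one).trans_lt ?_).ne
        simp
      rw [h2, measureReal_def] at h1
      exact (ENNReal.toReal_eq_toReal_iff' h3 (measure_ne_top _ _)).1 h1
    have e1 : ∫ x, η x ∂(μ.restrict s ⊗ₘ K).snd = ∫ ω in s, η (f ω) ∂μ := by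
      rw [e, integral_map hf.aemeasurable hη.aestronglyMeasurable]
    rw [← e1, Measure.snd, integral_map measurable_snd.aemeasurable hη.aestronglyMeasurable,
      Measure.integral_compProd]
    · rfl
    · exact (hηb.comp _).integrable (hη.comp measurable_snd).aestronglyMeasurable
  rw [← integral_mul_condExp_eq hm hfi hZ hZb]
  refine integral_congr_ae ?_
  filter_upwards [key] with ω hω
  rw [hω]

end Conditional

/-! ### Weighted transition operators and mixing -/

section Operators

variable {𝒳 ℋ : Type*} {A : ℕ} [Fintype 𝒳] [Fintype ℋ] [MeasurableSpace 𝒳] [MeasurableSpace ℋ]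

/-- One step of the chain under `e`, weighted by the function `φ` of observed state, action and
outcome, acting on functions `u` of the transition law and the state. -/
noncomputable def stepOp (e : 𝒳 → Fin A → ℝ) (φ : 𝒳 → Fin A → ℝ → ℝ)
    (u : Transition 𝒳 ℋ A → 𝒳 × ℋ → ℝ) : Transition 𝒳 ℋ A → 𝒳 × ℋ → ℝ :=
  fun P s => ∑ a, ∑ s', e s.1 a *
    ((∫ z in {z | z.2 = s'}, φ s.1 a z.1 ∂(P s.1 s.2 a : Measure (ℝ × 𝒳 × ℋ))) * u P s')

/-- `m` successive weighted steps, the `j`-th one with weight `φ j`. -/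
noncomputable def windowOp (e : 𝒳 → Fin A → ℝ) :
    ℕ → (ℕ → 𝒳 → Fin A → ℝ → ℝ) → (Transition 𝒳 ℋ A → 𝒳 × ℋ → ℝ) →
      Transition 𝒳 ℋ A → 𝒳 × ℋ → ℝ
  | 0, _, u => u
  | m + 1, φ, u => stepOp e (φ 0) (windowOp e m (fun j => φ (j + 1)) u)

/-- `m` unweighted steps of the chain under `e`. -/
noncomputable def evolve (e : 𝒳 → Fin A → ℝ) (m : ℕ) (u : Transition 𝒳 ℋ A → 𝒳 × ℋ → ℝ) :
    Transition 𝒳 ℋ A → 𝒳 × ℋ → ℝ :=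
  windowOp e m (fun _ _ _ _ => 1) u

/-- Bounded functions of the transition law and the state that are measurable in the former. -/
structure IsStateFun (u : Transition 𝒳 ℋ A → 𝒳 × ℋ → ℝ) : Prop where
  measurable : ∀ s, Measurable fun P => u P s
  bdd : IsBddFun fun p : Transition 𝒳 ℋ A × (𝒳 × ℋ) => u p.1 p.2

/-- Bounded functions of observed state, action and outcome that are measurable in the outcome. -/
structure IsWeightFun (φ : 𝒳 → Fin A → ℝ → ℝ) : Prop where
  measurable : ∀ x a, Measurable (φ x a)
  bdd : IsBddFun fun p : 𝒳 × Fin A × ℝ => φ p.1 p.2.1 p.2.2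

theorem IsWeightFun.mul {φ ψ : 𝒳 → Fin A → ℝ → ℝ} (hφ : IsWeightFun φ) (hψ : IsWeightFun ψ) :
    IsWeightFun fun x a y => φ x a y * ψ x a y :=
  ⟨fun x a => (hφ.1 x a).mul (hψ.1 x a), hφ.2.mul hψ.2⟩

theorem IsWeightFun.one : IsWeightFun (fun (_ : 𝒳) (_ : Fin A) (_ : ℝ) => 1) :=
  ⟨fun _ _ => measurable_const, IsBddFun.const 1⟩

variable [MeasurableSingletonClass 𝒳] [MeasurableSingletonClass ℋ]

theorem measurableSet_snd_eq (s' : 𝒳 × ℋ) : MeasurableSet {z : ℝ × 𝒳 × ℋ | z.2 = s'} :=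
  measurable_snd (measurableSet_singleton s')

theorem measurable_transition (x : 𝒳) (h : ℋ) (a : Fin A) :
    Measurable fun P : Transition 𝒳 ℋ A => (P x h a : Measure (ℝ × 𝒳 × ℋ)) :=
  measurable_subtype_coe.comp (by fun_prop)

theorem IsWeightFun.measurable_coeff {φ : 𝒳 → Fin A → ℝ → ℝ} (hφ : IsWeightFun φ)
    (s s' : 𝒳 × ℋ) (a : Fin A) : Measurable fun P : Transition 𝒳 ℋ A =>
      ∫ z in {z | z.2 = s'}, φ s.1 a z.1 ∂(P s.1 s.2 a : Measure (ℝ × 𝒳 × ℋ)) := by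
  let K : Kernel (Transition 𝒳 ℋ A) (ℝ × 𝒳 × ℋ) :=
    ⟨fun P => (P s.1 s.2 a : Measure (ℝ × 𝒳 × ℋ)), measurable_transition _ _ _⟩
  have : IsMarkovKernel K := ⟨fun P => inferInstanceAs (IsProbabilityMeasure (P s.1 s.2 a).toMeasure)⟩
  simp_rw [← integral_indicator (measurableSet_snd_eq s')]
  exact (StronglyMeasurable.integral_kernel (κ := K) (Measurable.indicator
    ((hφ.1 s.1 a).comp measurable_fst) (measurableSet_snd_eq s')).stronglyMeasurable).measurable

theorem IsWeightFun.bdd_coeff {φ : 𝒳 → Fin A → ℝ → ℝ} (hφ : IsWeightFun φ)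
    (s s' : 𝒳 × ℋ) (a : Fin A) : IsBddFun fun P : Transition 𝒳 ℋ A =>
      ∫ z in {z | z.2 = s'}, φ s.1 a z.1 ∂(P s.1 s.2 a : Measure (ℝ × 𝒳 × ℋ)) := by
  obtain ⟨b, hb⟩ := hφ.2
  refine ⟨b, fun P => ?_⟩
  have h0 : 0 ≤ b := (abs_nonneg _).trans (hb (s.1, a, 0))
  have := norm_setIntegral_le_of_norm_le_const (μ := (P s.1 s.2 a : Measure (ℝ × 𝒳 × ℋ)))
    (s := {z | z.2 = s'}) (f := fun z => φ s.1 a z.1) (C := b) (measure_lt_top _ _)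
    (fun z _ => hb (s.1, a, z.1))
  exact this.trans (mul_le_of_le_one_right h0 measureReal_le_one)

theorem IsStateFun.stepOp {e : 𝒳 → Fin A → ℝ} {φ : 𝒳 → Fin A → ℝ → ℝ} (hφ : IsWeightFun φ)
    {u : Transition 𝒳 ℋ A → 𝒳 × ℋ → ℝ} (hu : IsStateFun u) : IsStateFun (stepOp e φ u) where
  measurable s := Finset.measurable_fun_sum _ fun a _ => Finset.measurable_fun_sum _ fun s' _ =>
    ((hφ.measurable_coeff s s' a).mul (hu.1 s')).const_mul _
  bdd := by
    have h : ∀ s, IsBddFun fun P => _root_.stepOp e φ u P s := fun s =>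
      IsBddFun.sum _ fun a _ => IsBddFun.sum _ fun s' _ => (IsBddFun.const _).mul
        ((hφ.bdd_coeff s s' a).mul (hu.2.comp fun P => (P, s')))
    choose b hb using h
    exact ⟨∑ s, |b s|, fun p => (hb p.2 p.1).trans ((le_abs_self _).trans
      (Finset.single_le_sum (f := fun s => |b s|) (fun _ _ => abs_nonneg _) (Finset.mem_univ p.2)))⟩

theorem IsStateFun.windowOp {e : 𝒳 → Fin A → ℝ} {u : Transition 𝒳 ℋ A → 𝒳 × ℋ → ℝ}
    (hu : IsStateFun u) (m : ℕ) {φ : ℕ → 𝒳 → Fin A → ℝ → ℝ} (hφ : ∀ j, IsWeightFun (φ j)) :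
    IsStateFun (windowOp e m φ u) := by
  induction m generalizing φ with
  | zero => exact hu
  | succ m ih => exact IsStateFun.stepOp (hφ 0) (ih fun j => hφ (j + 1))

theorem IsStateFun.evolve {e : 𝒳 → Fin A → ℝ} {u : Transition 𝒳 ℋ A → 𝒳 × ℋ → ℝ}
    (hu : IsStateFun u) (m : ℕ) : IsStateFun (evolve e m u) :=
  hu.windowOp m fun _ => IsWeightFun.one

/-- Duality: the unweighted step on functions is the adjoint of `stateStep` on distributions, which
carries the mixing assumption over to functions. -/
theorem sum_mul_stepOp_one (e : 𝒳 → Fin A → ℝ) (u : Transition 𝒳 ℋ A → 𝒳 × ℋ → ℝ)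
    (P : Transition 𝒳 ℋ A) (f : 𝒳 × ℋ → ℝ) :
    ∑ s, f s * stepOp e (fun _ _ _ => 1) u P s = ∑ s, stateStep P e f s * u P s := by
  simp only [stepOp, stateStep, Finset.mul_sum, Finset.sum_mul]
  have : ∀ s : 𝒳 × ℋ, ∑ a, ∑ s', f s * (e s.1 a * ((∫ z in {z | z.2 = s'}, (1 : ℝ)
      ∂(P s.1 s.2 a : Measure (ℝ × 𝒳 × ℋ))) * u P s')) = ∑ s', ∑ a, f s * (e s.1 a *
      ((∫ z in {z | z.2 = s'}, (1 : ℝ) ∂(P s.1 s.2 a : Measure (ℝ × 𝒳 × ℋ))) * u P s')) :=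
    fun s => Finset.sum_comm
  simp_rw [this]
  rw [Finset.sum_comm]
  refine Finset.sum_congr rfl fun s' _ => Finset.sum_congr rfl fun s _ =>
    Finset.sum_congr rfl fun a _ => ?_
  simp only [integral_const, MeasurableSet.univ, measureReal_restrict_apply, Set.univ_inter,
    smul_eq_mul, mul_one]
  ring

theorem sum_mul_evolve (e : 𝒳 → Fin A → ℝ) (u : Transition 𝒳 ℋ A → 𝒳 × ℋ → ℝ)
    (P : Transition 𝒳 ℋ A) (m : ℕ) (f : 𝒳 × ℋ → ℝ) :
    ∑ s, f s * evolve e m u P s = ∑ s, (stateStep P e)^[m] f s * u P s := by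
  induction m generalizing f with
  | zero => rfl
  | succ m ih =>
    rw [Function.iterate_succ_apply, ← ih]
    exact sum_mul_stepOp_one e _ P f

theorem stateStep_mem_stdSimplex {e : 𝒳 → Fin A → ℝ} (he : IsPolicy e) (P : Transition 𝒳 ℋ A)
    {f : 𝒳 × ℋ → ℝ} (hf : f ∈ stdSimplex ℝ (𝒳 × ℋ)) : stateStep P e f ∈ stdSimplex ℝ (𝒳 × ℋ) := by
  refine ⟨fun s' => Finset.sum_nonneg fun s _ => Finset.sum_nonneg fun a _ =>
    mul_nonneg (mul_nonneg (hf.1 s) ((he s.1).1 a)) measureReal_nonneg, ?_⟩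
  simp only [stateStep]
  rw [Finset.sum_comm, ← hf.2]
  refine Finset.sum_congr rfl fun s _ => ?_
  rw [Finset.sum_comm]
  simp_rw [← Finset.mul_sum]
  have : ∀ a, ∑ s', (P s.1 s.2 a : Measure (ℝ × 𝒳 × ℋ)).real {z | z.2 = s'} = 1 := fun a => by
    have h := measureReal_biUnion_finset (μ := (P s.1 s.2 a : Measure (ℝ × 𝒳 × ℋ)))
      (s := Finset.univ) (f := fun s' : 𝒳 × ℋ => {z : ℝ × 𝒳 × ℋ | z.2 = s'})
      (fun s₁ _ s₂ _ h12 => Set.disjoint_left.2 fun z h1 h2 => h12 (h1.symm.trans h2))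
      (fun s' _ => measurableSet_snd_eq s')
    rw [← h]
    have : (⋃ s' ∈ (Finset.univ : Finset (𝒳 × ℋ)), {z : ℝ × 𝒳 × ℋ | z.2 = s'}) = Set.univ := by
      ext z; simp
    rw [this, probReal_univ]
  simp_rw [this, mul_one, ← Finset.mul_sum, (he s.1).2, mul_one]

theorem iterate_stateStep_mem_stdSimplex {e : 𝒳 → Fin A → ℝ} (he : IsPolicy e)
    (P : Transition 𝒳 ℋ A) (m : ℕ) {f : 𝒳 × ℋ → ℝ} (hf : f ∈ stdSimplex ℝ (𝒳 × ℋ)) :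
    (stateStep P e)^[m] f ∈ stdSimplex ℝ (𝒳 × ℋ) := by
  induction m generalizing f with
  | zero => exact hf
  | succ m ih => exact ih (stateStep_mem_stdSimplex he P hf)

theorem tvNorm_iterate_stateStep_sub_le {e : 𝒳 → Fin A → ℝ} (he : IsPolicy e)
    {P : Transition 𝒳 ℋ A} {τ : ℝ} (hτ : IsMixingTime P e τ) (m : ℕ) {f f' : 𝒳 × ℋ → ℝ}
    (hf : f ∈ stdSimplex ℝ (𝒳 × ℋ)) (hf' : f' ∈ stdSimplex ℝ (𝒳 × ℋ)) :
    tvNorm ((stateStep P e)^[m] f' - (stateStep P e)^[m] f) ≤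
      Real.exp (-1 / τ) ^ m * tvNorm (f' - f) := by
  induction m with
  | zero => simp
  | succ m ih =>
    rw [Function.iterate_succ_apply', Function.iterate_succ_apply', pow_succ', mul_assoc]
    refine (hτ.2 _ (iterate_stateStep_mem_stdSimplex he P m hf) _
      (iterate_stateStep_mem_stdSimplex he P m hf')).trans ?_
    gcongr

theorem tvNorm_sub_le_one {f f' : 𝒳 × ℋ → ℝ}
    (hf : f ∈ stdSimplex ℝ (𝒳 × ℋ)) (hf' : f' ∈ stdSimplex ℝ (𝒳 × ℋ)) : tvNorm (f' - f) ≤ 1 := by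
  have : ∑ s, |(f' - f) s| ≤ ∑ s, (f' s + f s) := Finset.sum_le_sum fun s _ => by
    rw [Pi.sub_apply, abs_le]
    constructor <;> linarith [hf.1 s, hf'.1 s]
  rw [Finset.sum_add_distrib, hf.2, hf'.2] at this
  rw [tvNorm]; linarith

/-- Contraction of distributions, dualized. The factor 2 undoes the 1/2 in `tvNorm`, and t₀ replaces
τ so that the rate is uniform over the population. -/
theorem abs_sum_mul_evolve_sub_le {e : 𝒳 → Fin A → ℝ} (he : IsPolicy e)
    {P : Transition 𝒳 ℋ A} {τ t₀ : ℝ} (hτ : IsMixingTime P e τ) (hτ0 : τ ≤ t₀) (m : ℕ)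
    {f f' : 𝒳 × ℋ → ℝ} (hf : f ∈ stdSimplex ℝ (𝒳 × ℋ)) (hf' : f' ∈ stdSimplex ℝ (𝒳 × ℋ))
    {u : Transition 𝒳 ℋ A → 𝒳 × ℋ → ℝ} {b : ℝ} (hb0 : 0 ≤ b) (hb : ∀ s, |u P s| ≤ b) :
    |∑ s, f' s * evolve e m u P s - ∑ s, f s * evolve e m u P s| ≤
      2 * b * Real.exp (-1 / t₀) ^ m := by
  rw [sum_mul_evolve, sum_mul_evolve, ← Finset.sum_sub_distrib]
  have h1 := tvNorm_iterate_stateStep_sub_le he hτ m hf hf'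
  have h2 : Real.exp (-1 / τ) ≤ Real.exp (-1 / t₀) := by
    have := one_div_le_one_div_of_le hτ.1 hτ0
    rw [Real.exp_le_exp, neg_div, neg_div]; linarith
  calc _ ≤ ∑ s, |((stateStep P e)^[m] f' - (stateStep P e)^[m] f) s| * b := by
        refine (Finset.abs_sum_le_sum_abs _ _).trans (Finset.sum_le_sum fun s _ => ?_)
        rw [← sub_mul, abs_mul]
        exact mul_le_mul_of_nonneg_left (hb s) (abs_nonneg _)
    _ = 2 * b * tvNorm ((stateStep P e)^[m] f' - (stateStep P e)^[m] f) := by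
        rw [← Finset.sum_mul, tvNorm]; ring
    _ ≤ 2 * b * (Real.exp (-1 / t₀) ^ m * 1) := by
        gcongr
        refine h1.trans (mul_le_mul (by gcongr) (tvNorm_sub_le_one hf hf') ?_ (by positivity))
        exact mul_nonneg (by norm_num) (Finset.sum_nonneg fun _ _ => abs_nonneg _)
    _ = _ := by ring

end Operators

/-! ### Joint measurability, from finiteness of states and actions -/

section Joint

variable {𝒳 ℋ : Type*} {A : ℕ} [Fintype 𝒳] [Fintype ℋ] [MeasurableSpace 𝒳] [MeasurableSpace ℋ]
  [MeasurableSingletonClass 𝒳] [MeasurableSingletonClass ℋ]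

theorem IsStateFun.measurable_uncurry {u : Transition 𝒳 ℋ A → 𝒳 × ℋ → ℝ} (hu : IsStateFun u) :
    Measurable fun p : Transition 𝒳 ℋ A × (𝒳 × ℋ) => u p.1 p.2 :=
  measurable_from_prod_countable_left fun s => hu.1 s

theorem IsWeightFun.measurable_uncurry {φ : 𝒳 → Fin A → ℝ → ℝ} (hφ : IsWeightFun φ) :
    Measurable fun p : (𝒳 × Fin A) × ℝ => φ p.1.1 p.1.2 p.2 :=
  measurable_from_prod_countable_right fun s => hφ.1 s.1 s.2

theorem measurable_transition_uncurry :
    Measurable fun p : Transition 𝒳 ℋ A × (𝒳 × ℋ × Fin A) =>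
      (p.1 p.2.1 p.2.2.1 p.2.2.2 : Measure (ℝ × 𝒳 × ℋ)) :=
  measurable_from_prod_countable_left fun q => measurable_transition q.1 q.2.1 q.2.2

end Joint

/-! ### The Markov property of a sampled unit -/

namespace Panel

variable {𝒳 ℋ : Type*} {A n : ℕ} [Fintype 𝒳] [Fintype ℋ] [MeasurableSpace 𝒳] [MeasurableSpace ℋ]
  {Ω : Type*}

/-- The state `(X, H)` of unit `i` at epoch `t`. -/
def state (d : Panel 𝒳 ℋ A n Ω) (i : Fin n) (t : ℕ) (ω : Ω) : 𝒳 × ℋ := (d.X i t ω, d.H i t ω)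

/-- The σ-algebra of the history of unit `i` just after the action at epoch `t` is taken. -/
abbrev historyAction (d : Panel 𝒳 ℋ A n Ω) (i : Fin n) (t : ℕ) : MeasurableSpace Ω :=
  d.history i t ⊔ MeasurableSpace.comap (d.W i t) inferInstance

theorem measurable_history_P (d : Panel 𝒳 ℋ A n Ω) (i : Fin n) (t : ℕ) :
    Measurable[d.history i t] (d.P i) :=
  measurable_iff_comap_le.2 (le_sup_left.trans le_sup_left)

theorem unitField_le_history (d : Panel 𝒳 ℋ A n Ω) (i : Fin n) (t : ℕ) :
    d.unitField i ≤ d.history i t := le_sup_left.trans le_sup_left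

theorem measurable_history_state (d : Panel 𝒳 ℋ A n Ω) (i : Fin n) (t : ℕ) :
    Measurable[d.history i t] (d.state i t) :=
  measurable_iff_comap_le.2 le_sup_right

theorem measurable_history_obs (d : Panel 𝒳 ℋ A n Ω) (i : Fin n) {s t : ℕ} (hs : 1 ≤ s)
    (hst : s < t) :
    Measurable[d.history i t] (fun ω => (d.X i s ω, d.H i s ω, d.W i s ω, d.Y i s ω)) :=
  measurable_iff_comap_le.2 ((le_iSup₂ (f := fun s (_ : s ∈ Finset.Ico 1 t) =>
    MeasurableSpace.comap (fun ω => (d.X i s ω, d.H i s ω, d.W i s ω, d.Y i s ω)) inferInstance)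
    s (Finset.mem_Ico.2 ⟨hs, hst⟩)).trans (le_sup_right.trans le_sup_left))

/-- The state at s lies in later histories as part of the observation at s, and these start at epoch
1; hence 1 ≤ s. -/
theorem history_mono (d : Panel 𝒳 ℋ A n Ω) (i : Fin n) {s t : ℕ} (hs : 1 ≤ s) (hst : s ≤ t) :
    d.history i s ≤ d.history i t := by
  rcases hst.eq_or_lt with rfl | hlt
  · exact le_rfl
  · refine sup_le (sup_le (d.unitField_le_history i t) (iSup₂_le fun r hr => ?_)) ?_
    · have hr := Finset.mem_Ico.1 hr
      exact (d.measurable_history_obs i hr.1 (hr.2.trans hlt)).comap_le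
    · have h := d.measurable_history_obs i hs hlt
      exact ((measurable_fst.comp h).prodMk (measurable_fst.comp (measurable_snd.comp h))).comap_le

namespace IsSample

variable [MeasurableSingletonClass 𝒳] [MeasurableSingletonClass ℋ]
  {m0 : MeasurableSpace Ω} {μ : Measure Ω} [IsProbabilityMeasure μ] {d : Panel 𝒳 ℋ A n Ω} {T : ℕ}
  {e : 𝒳 → Fin A → ℝ} {D : Measure (Transition 𝒳 ℋ A)}

theorem history_le (h : d.IsSample μ T e D) (i : Fin n) (t : ℕ) : d.history i t ≤ m0 :=
  sup_le (sup_le (h.measurable_P i).comap_le (iSup₂_le fun s _ =>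
    ((h.measurable_X i s).prodMk ((h.measurable_H i s).prodMk
      ((h.measurable_W i s).prodMk (h.measurable_Y i s)))).comap_le))
    ((h.measurable_X i t).prodMk (h.measurable_H i t)).comap_le

theorem unitField_le (h : d.IsSample μ T e D) (i : Fin n) : d.unitField i ≤ m0 :=
  (h.measurable_P i).comap_le

theorem measurable_state (h : d.IsSample μ T e D) (i : Fin n) (t : ℕ) : Measurable (d.state i t) :=
  (h.measurable_X i t).prodMk (h.measurable_H i t)

theorem integral_mul_action (h : d.IsSample μ T e D) (i : Fin n) {t : ℕ} (ht : t ∈ Finset.Icc 1 T)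
    (a : Fin A) {Z : Ω → ℝ} (hZ : StronglyMeasurable[d.history i t] Z) (hZb : IsBddFun Z) :
    ∫ ω, Z ω * (if d.W i t ω = a then 1 else 0) ∂μ = ∫ ω, Z ω * e (d.X i t ω) a ∂μ := by
  have hm : MeasurableSet (d.W i t ⁻¹' {a}) := h.measurable_W i t (measurableSet_singleton a)
  have h1 := integral_mul_condExp_eq (μ := μ) (h.history_le i t)
    (g := (d.W i t ⁻¹' {a}).indicator fun _ => (1 : ℝ)) ((integrable_const 1).indicator hm) hZ hZb
  have h2 : ∫ ω, Z ω * (μ⟦d.W i t ⁻¹' {a} | d.history i t⟧) ω ∂μ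
      = ∫ ω, Z ω * e (d.X i t ω) a ∂μ := by
    refine integral_congr_ae ?_
    filter_upwards [h.action i t ht a] with ω hω
    rw [hω]
  rw [← h2, h1]
  refine integral_congr_ae (ae_of_all _ fun ω => ?_)
  by_cases hω : d.W i t ω = a <;> simp [hω]

/-- The Markov property of the sample, in weak form. -/
theorem integral_mul_step (h : d.IsSample μ T e D) (i : Fin n) {t : ℕ} (ht : t ∈ Finset.Icc 1 T)
    {φ : 𝒳 → Fin A → ℝ → ℝ} (hφ : IsWeightFun φ)
    {u : Transition 𝒳 ℋ A → 𝒳 × ℋ → ℝ} (hu : IsStateFun u)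
    {Z : Ω → ℝ} (hZ : StronglyMeasurable[d.history i t] Z) (hZb : IsBddFun Z) :
    ∫ ω, Z ω * (φ (d.X i t ω) (d.W i t ω) (d.Y i t ω) * u (d.P i ω) (d.state i (t + 1) ω)) ∂μ =
      ∫ ω, Z ω * stepOp e φ u (d.P i ω) (d.state i t ω) ∂μ := by
  classical
  have hmW0 : d.historyAction i t ≤ m0 := sup_le (h.history_le i t) (h.measurable_W i t).comap_le
  have hWm : Measurable[d.historyAction i t] (d.W i t) := measurable_iff_comap_le.2 le_sup_right
  have hPm : Measurable[d.historyAction i t] (d.P i) := (d.measurable_history_P i t).mono le_sup_left le_rfl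
  have hSm : Measurable[d.historyAction i t] (d.state i t) :=
    (d.measurable_history_state i t).mono le_sup_left le_rfl
  let κ : Ω → Measure (ℝ × 𝒳 × ℋ) := fun ω => (d.P i ω (d.X i t ω) (d.H i t ω) (d.W i t ω))
  have hκ : Measurable[d.historyAction i t] κ := measurable_transition_uncurry.comp
    (hPm.prodMk ((measurable_fst.comp hSm).prodMk ((measurable_snd.comp hSm).prodMk hWm)))
  have hκp : ∀ ω, IsProbabilityMeasure (κ ω) := fun ω => inferInstanceAs
    (IsProbabilityMeasure (d.P i ω (d.X i t ω) (d.H i t ω) (d.W i t ω)).toMeasure)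
  let f : Ω → ℝ × 𝒳 × ℋ := fun ω => (d.Y i t ω, d.X i (t + 1) ω, d.H i (t + 1) ω)
  have hf : Measurable f := (h.measurable_Y i t).prodMk (h.measurable_state i (t + 1))
  let η : 𝒳 × ℋ → Fin A → 𝒳 × ℋ → ℝ × 𝒳 × ℋ → ℝ := fun s a s' =>
    {z | z.2 = s'}.indicator fun z => φ s.1 a z.1
  have hη : ∀ s a s', Measurable (η s a s') := fun s a s' =>
    ((hφ.1 s.1 a).comp measurable_fst).indicator (measurableSet_snd_eq s')
  have hηb : ∀ s a s', IsBddFun (η s a s') := fun s a s' => by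
    obtain ⟨b, hb⟩ := hφ.2
    refine ⟨b, fun z => ?_⟩
    by_cases hz : z.2 = s'
    · simpa [η, hz] using hb (s.1, a, z.1)
    · simpa [η, hz] using (abs_nonneg _).trans (hb (s.1, a, z.1))
  -- Both sides are expanded over state s, action a and next state s'; with these frozen, the
  -- transition coefficient depends on `P_i` only and is known before the action.
  let S : 𝒳 × ℋ → Ω → ℝ := fun s ω => if d.state i t ω = s then 1 else 0
  have hS : ∀ s, StronglyMeasurable[d.history i t] (S s) := fun s =>
    (Measurable.ite (d.measurable_history_state i t (measurableSet_singleton s))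
      measurable_const measurable_const).stronglyMeasurable
  let V : Fin A → Ω → ℝ := fun a ω => if d.W i t ω = a then 1 else 0
  have hV : ∀ a, StronglyMeasurable[d.historyAction i t] (V a) := fun a =>
    (Measurable.ite (hWm (measurableSet_singleton a))
      measurable_const measurable_const).stronglyMeasurable
  let U : 𝒳 × ℋ → Ω → ℝ := fun s' ω => u (d.P i ω) s'
  have hU : ∀ s', StronglyMeasurable[d.history i t] (U s') := fun s' =>
    ((hu.1 s').comp (d.measurable_history_P i t)).stronglyMeasurable
  have hUb : ∀ s', IsBddFun (U s') := fun s' => hu.2.comp fun ω => (d.P i ω, s')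
  let c : 𝒳 × ℋ → Fin A → 𝒳 × ℋ → Ω → ℝ := fun s a s' ω =>
    ∫ z in {z | z.2 = s'}, φ s.1 a z.1 ∂(d.P i ω s.1 s.2 a : Measure (ℝ × 𝒳 × ℋ))
  have hc : ∀ s a s', StronglyMeasurable[d.history i t] (c s a s') := fun s a s' =>
    ((hφ.measurable_coeff s s' a).comp (d.measurable_history_P i t)).stronglyMeasurable
  have hcb : ∀ s a s', IsBddFun (c s a s') := fun s a s' => (hφ.bdd_coeff s s' a).comp _
  have hle : d.history i t ≤ d.historyAction i t := le_sup_left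
  -- Integrate out the outcome and next state given history and action, then the action given the
  -- history.
  have term : ∀ s a s', ∫ ω, (Z ω * S s ω * V a ω * U s' ω) * η s a s' (f ω) ∂μ
      = ∫ ω, (Z ω * S s ω * (c s a s' ω * U s' ω)) * e (d.X i t ω) a ∂μ := by
    intro s a s'
    rw [integral_mul_comp_eq_of_condExp hmW0 hκ hf (h.transition i t ht) (hη s a s') (hηb s a s')
      (Z := fun ω => Z ω * S s ω * V a ω * U s' ω) ((((hZ.mono hle).mul ((hS s).mono hle)).mul (hV a)).mul ((hU s').mono hle))
      (((hZb.mul (IsBddFun.ite _)).mul (IsBddFun.ite _)).mul (hUb s')),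
      ← h.integral_mul_action i ht a (Z := fun ω => Z ω * S s ω * (c s a s' ω * U s' ω)) ((hZ.mul (hS s)).mul ((hc s a s').mul (hU s')))
      ((hZb.mul (IsBddFun.ite _)).mul ((hcb s a s').mul (hUb s')))]
    refine integral_congr_ae (ae_of_all _ fun ω => ?_)
    simp only [S, V]
    by_cases h1 : d.state i t ω = s
    · by_cases h2 : d.W i t ω = a
      · have : ∫ x, η s a s' x ∂(κ ω) = c s a s' ω := by
          simp only [η, c, κ]
          rw [integral_indicator (measurableSet_snd_eq s'), ← h1, ← h2]
          rfl
        simp only [h1, h2, if_true, this]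
        ring
      · simp [h2]
    · simp [h1]
  have lhs : ∀ ω, Z ω * (φ (d.X i t ω) (d.W i t ω) (d.Y i t ω) *
      u (d.P i ω) (d.state i (t + 1) ω)) =
      ∑ s, ∑ a, ∑ s', (Z ω * S s ω * V a ω * U s' ω) * η s a s' (f ω) := fun ω => by
    rw [Finset.sum_eq_single (d.state i t ω), Finset.sum_eq_single (d.W i t ω),
      Finset.sum_eq_single (d.state i (t + 1) ω)]
    · simp [S, V, U, η, f, state]; ring
    · intro b _ hb
      have : ¬ (d.X i (t + 1) ω, d.H i (t + 1) ω) = b := fun h => hb h.symm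
      simp [η, f, this]
    · simp
    · intro b _ hb
      simp [V, hb.symm]
    · simp
    · intro b _ hb
      simp [S, hb.symm]
    · simp
  have rhs : ∀ ω, Z ω * stepOp e φ u (d.P i ω) (d.state i t ω) =
      ∑ s, ∑ a, ∑ s', (Z ω * S s ω * (c s a s' ω * U s' ω)) * e (d.X i t ω) a := fun ω => by
    rw [Finset.sum_eq_single (d.state i t ω)]
    · simp only [stepOp, Finset.mul_sum, S, if_true, c, U]
      refine Finset.sum_congr rfl fun a _ => Finset.sum_congr rfl fun s' _ => ?_
      simp only [state]; ring
    · intro b _ hb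
      simp [S, hb.symm]
    · simp
  have hem : ∀ a, Measurable fun ω => e (d.X i t ω) a := fun a =>
    (measurable_of_countable (fun x => e x a)).comp (h.measurable_X i t)
  have i1 : ∀ s a s', Integrable (fun ω => (Z ω * S s ω * V a ω * U s' ω) * η s a s' (f ω)) μ :=
    fun s a s' => ((((hZb.mul (IsBddFun.ite _)).mul (IsBddFun.ite _)).mul (hUb s')).mul
      ((hηb s a s').comp f)).integrable
      (((((hZ.mono hle).mul ((hS s).mono hle)).mul (hV a)).mul
        ((hU s').mono hle)).mono hmW0 |>.aestronglyMeasurable.mul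
        ((hη s a s').comp hf).aestronglyMeasurable)
  have i2 : ∀ s a s', Integrable
      (fun ω => (Z ω * S s ω * (c s a s' ω * U s' ω)) * e (d.X i t ω) a) μ :=
    fun s a s' => (((hZb.mul (IsBddFun.ite _)).mul ((hcb s a s').mul (hUb s'))).mul
      ((IsBddFun.of_finite fun x => e x a).comp (d.X i t))).integrable
      (((hZ.mul (hS s)).mul ((hc s a s').mul (hU s'))).mono (h.history_le i t)
        |>.aestronglyMeasurable.mul (hem a).aestronglyMeasurable)
  simp_rw [lhs, rhs]
  rw [integral_finsetSum _ fun s _ => integrable_finsetSum _ fun a _ =>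
      integrable_finsetSum _ fun s' _ => i1 s a s',
    integral_finsetSum _ fun s _ => integrable_finsetSum _ fun a _ =>
      integrable_finsetSum _ fun s' _ => i2 s a s']
  refine Finset.sum_congr rfl fun s _ => ?_
  rw [integral_finsetSum _ fun a _ => integrable_finsetSum _ fun s' _ => i1 s a s',
    integral_finsetSum _ fun a _ => integrable_finsetSum _ fun s' _ => i2 s a s']
  refine Finset.sum_congr rfl fun a _ => ?_
  rw [integral_finsetSum _ fun s' _ => i1 s a s', integral_finsetSum _ fun s' _ => i2 s a s']
  exact Finset.sum_congr rfl fun s' _ => term s a s'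

/-- Induction on the window length: the first factor is known at epoch t + 1, so it joins the test
function Z for the remaining window; one Markov step then removes it. The bound T + 1 is right
because the transition at T produces the state at T + 1. -/
theorem integral_mul_window (h : d.IsSample μ T e D) (i : Fin n)
    {u : Transition 𝒳 ℋ A → 𝒳 × ℋ → ℝ} (hu : IsStateFun u) (m : ℕ) {t : ℕ} (ht : 1 ≤ t)
    (hT : t + m ≤ T + 1) {φ : ℕ → 𝒳 → Fin A → ℝ → ℝ} (hφ : ∀ j, IsWeightFun (φ j))
    {Z : Ω → ℝ} (hZ : StronglyMeasurable[d.history i t] Z) (hZb : IsBddFun Z) :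
    ∫ ω, Z ω * ((∏ j ∈ Finset.range m, φ j (d.X i (t + j) ω) (d.W i (t + j) ω) (d.Y i (t + j) ω))
      * u (d.P i ω) (d.state i (t + m) ω)) ∂μ =
      ∫ ω, Z ω * windowOp e m φ u (d.P i ω) (d.state i t ω) ∂μ := by
  induction m generalizing φ t Z with
  | zero => simp [windowOp]
  | succ m ih =>
    have hobs := d.measurable_history_obs i ht (Nat.lt_succ_self t)
    have hφm : StronglyMeasurable[d.history i (t + 1)]
        fun ω => φ 0 (d.X i t ω) (d.W i t ω) (d.Y i t ω) :=
      ((hφ 0).measurable_uncurry.comp (((measurable_fst.comp hobs).prodMk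
        (measurable_fst.comp (measurable_snd.comp (measurable_snd.comp hobs)))).prodMk
        (measurable_snd.comp (measurable_snd.comp (measurable_snd.comp hobs))))).stronglyMeasurable
    have h1 := ih (t := t + 1) (by omega) (by omega) (φ := fun j => φ (j + 1))
      (fun j => hφ (j + 1))
      ((hZ.mono (d.history_mono i ht t.le_succ)).mul hφm)
      (hZb.mul ((hφ 0).2.comp fun ω => (d.X i t ω, d.W i t ω, d.Y i t ω)))
    have h2 := h.integral_mul_step i (Finset.mem_Icc.2 ⟨ht, by omega⟩) (hφ 0)
      (hu.windowOp (e := e) m fun j => hφ (j + 1)) hZ hZb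
    rw [windowOp, ← h2]
    simp only [Pi.mul_apply, mul_assoc] at h1
    rw [← h1]
    refine integral_congr_ae (ae_of_all _ fun ω => ?_)
    simp only [Finset.prod_range_succ', show ∀ j, t + 1 + j = t + (j + 1) from fun j => by omega,
      add_zero]
    ring

theorem integral_mul_evolve (h : d.IsSample μ T e D) (i : Fin n)
    {u : Transition 𝒳 ℋ A → 𝒳 × ℋ → ℝ} (hu : IsStateFun u) (m : ℕ) {t : ℕ} (ht : 1 ≤ t)
    (hT : t + m ≤ T + 1)
    {Z : Ω → ℝ} (hZ : StronglyMeasurable[d.history i t] Z) (hZb : IsBddFun Z) :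
    ∫ ω, Z ω * u (d.P i ω) (d.state i (t + m) ω) ∂μ =
      ∫ ω, Z ω * evolve e m u (d.P i ω) (d.state i t ω) ∂μ := by
  rw [evolve, ← h.integral_mul_window i hu m ht hT (fun _ => IsWeightFun.one) hZ hZb]
  simp

end IsSample

end Panel

/-! ### Importance weights as windows of factors, and autocovariances -/

/-- Truncation of a real number to `[-C, C]`. -/
noncomputable def truncate (C y : ℝ) : ℝ := max (-C) (min y C)

theorem truncate_of_abs_le {C y : ℝ} (h : |y| ≤ C) : truncate C y = y := by
  rw [truncate, min_eq_left (abs_le.1 h).2, max_eq_right (abs_le.1 h).1]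

theorem abs_truncate_le (C y : ℝ) : |truncate C y| ≤ |C| := by
  rw [truncate, abs_le]
  refine ⟨(neg_le_neg (le_abs_self C)).trans (le_max_left _ _),
    max_le (neg_le_abs C) ((min_le_right _ _).trans (le_abs_self C))⟩

theorem measurable_truncate (C : ℝ) : Measurable (truncate C) :=
  measurable_const.max (measurable_id.min measurable_const)

section Weights

variable {𝒳 ℋ : Type*} {A : ℕ} [Fintype 𝒳] [Fintype ℋ] [MeasurableSpace 𝒳] [MeasurableSpace ℋ]
  [MeasurableSingletonClass 𝒳] [MeasurableSingletonClass ℋ]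

/-- The factor that epoch `j` contributes to the (truncated) importance-weighted outcome of
epoch `p`. -/
noncomputable def windowFactor (e π : 𝒳 → Fin A → ℝ) (C : ℝ) (k p j : ℕ) :
    𝒳 → Fin A → ℝ → ℝ :=
  fun x a y => (if j ≤ p ∧ p ≤ j + k then π x a / e x a else 1) *
    (if j = p then truncate C y else 1)

theorem isWeightFun_windowFactor (e π : 𝒳 → Fin A → ℝ) (C : ℝ) (k p j : ℕ) :
    IsWeightFun (windowFactor e π C k p j) where
  measurable x a := by
    unfold windowFactor
    by_cases h : j = p
    · simpa [h] using (measurable_truncate C).const_mul _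
    · simp [h]
  bdd := by
    refine IsBddFun.mul (f := fun p' : 𝒳 × Fin A × ℝ =>
      if j ≤ p ∧ p ≤ j + k then π p'.1 p'.2.1 / e p'.1 p'.2.1 else 1) ?_ ?_
    · exact (IsBddFun.of_finite fun q : 𝒳 × Fin A =>
        if j ≤ p ∧ p ≤ j + k then π q.1 q.2 / e q.1 q.2 else 1).comp
        fun p' : 𝒳 × Fin A × ℝ => (p'.1, p'.2.1)
    · by_cases h : j = p
      · simp only [h, if_true]
        exact ⟨|C|, fun p' => abs_truncate_le C p'.2.2⟩
      · simp only [h, if_false]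
        exact IsBddFun.const 1

theorem isStateFun_one : IsStateFun (fun (_ : Transition 𝒳 ℋ A) (_ : 𝒳 × ℋ) => 1) :=
  ⟨fun _ => measurable_const, IsBddFun.const 1⟩

/-- The expected importance-weighted outcome given the state at the start of its window. -/
noncomputable def windowMean (e π : 𝒳 → Fin A → ℝ) (C : ℝ) (k : ℕ) :
    Transition 𝒳 ℋ A → 𝒳 × ℋ → ℝ :=
  windowOp e (k + 1) (windowFactor e π C k k) fun _ _ => 1

/-- The expected product of two importance-weighted outcomes at distance `l`, given the state at
the start of the window of the first one. -/
noncomputable def windowProd (e π : 𝒳 → Fin A → ℝ) (C : ℝ) (k l : ℕ) :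
    Transition 𝒳 ℋ A → 𝒳 × ℋ → ℝ :=
  windowOp e (k + l + 1)
    (fun j x a y => windowFactor e π C k k j x a y * windowFactor e π C k (k + l) j x a y)
    fun _ _ => 1

theorem isStateFun_windowMean (e π : 𝒳 → Fin A → ℝ) (C : ℝ) (k : ℕ) :
    IsStateFun (windowMean (ℋ := ℋ) e π C k) :=
  isStateFun_one.windowOp _ fun j => isWeightFun_windowFactor e π C k k j

theorem isStateFun_windowProd (e π : 𝒳 → Fin A → ℝ) (C : ℝ) (k l : ℕ) :
    IsStateFun (windowProd (ℋ := ℋ) e π C k l) :=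
  isStateFun_one.windowOp _ fun j => (isWeightFun_windowFactor e π C k k j).mul
    (isWeightFun_windowFactor e π C k (k + l) j)

/-- The autocovariance at lag `l` of the importance-weighted outcomes (with outcomes truncated at
`C`) in the population `D`. The stationary law is approached from the state `s₀`. -/
noncomputable def autocov (e π : 𝒳 → Fin A → ℝ) (D : Measure (Transition 𝒳 ℋ A)) (k : ℕ)
    (s₀ : 𝒳 × ℋ) (C : ℝ) (l : ℕ) : ℝ :=
  limUnder atTop fun N : ℕ => ∫ P, (evolve e N (windowProd e π C k l) P s₀
    - evolve e N (windowMean e π C k) P s₀ ^ 2) ∂D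

end Weights

/-! ### Conditional and stationary means of the weighted outcomes -/

namespace Panel

variable {𝒳 ℋ : Type*} {A n : ℕ} [Fintype 𝒳] [Fintype ℋ] [MeasurableSpace 𝒳] [MeasurableSpace ℋ]
  {Ω : Type*}

/-- The importance-weighted outcome with the outcome truncated to `[-C, C]`. -/
noncomputable def truncatedWeighted (d : Panel 𝒳 ℋ A n Ω) (e π : 𝒳 → Fin A → ℝ) (C : ℝ) (k : ℕ)
    (i : Fin n) (t : ℕ) (ω : Ω) : ℝ :=
  (∏ s ∈ Finset.range (k + 1),
    π (d.X i (t - s) ω) (d.W i (t - s) ω) / e (d.X i (t - s) ω) (d.W i (t - s) ω)) *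
    truncate C (d.Y i t ω)

theorem abs_truncatedWeighted_le (d : Panel 𝒳 ℋ A n Ω) {e π : 𝒳 → Fin A → ℝ} {C w : ℝ} (k : ℕ)
    (hw : ∀ x a, |π x a / e x a| ≤ w) (i : Fin n) (t : ℕ) (ω : Ω) :
    |d.truncatedWeighted e π C k i t ω| ≤ w ^ (k + 1) * |C| := by
  rw [truncatedWeighted, abs_mul, Finset.abs_prod]
  refine mul_le_mul ?_ (abs_truncate_le C _) (abs_nonneg _)
    (pow_nonneg ((abs_nonneg _).trans (hw (d.X i t ω) (d.W i t ω))) _)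
  refine (Finset.prod_le_prod (fun _ _ => abs_nonneg _) fun _ _ => hw _ _).trans ?_
  simp

/-- Factors outside p - k, …, p equal 1, so outcomes with different windows become products over one
common range and can be multiplied factor by factor. -/
theorem prod_windowFactor (d : Panel 𝒳 ℋ A n Ω) (e π : 𝒳 → Fin A → ℝ) (C : ℝ) {k p M : ℕ}
    (hk : k ≤ p) (hp : p < M) (i : Fin n) (t : ℕ) (ω : Ω) :
    ∏ j ∈ Finset.range M,
      windowFactor e π C k p j (d.X i (t + j) ω) (d.W i (t + j) ω) (d.Y i (t + j) ω) =
      d.truncatedWeighted e π C k i (t + p) ω := by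
  simp only [windowFactor, truncatedWeighted]
  rw [Finset.prod_mul_distrib, Finset.prod_ite_eq', if_pos (Finset.mem_range.2 hp)]
  congr 1
  rw [← Finset.prod_filter]
  refine Finset.prod_bij' (fun j _ => p - j) (fun s _ => p - s) ?_ ?_ ?_ ?_ ?_
  · intro j hj
    simp only [Finset.mem_filter, Finset.mem_range] at hj ⊢
    omega
  · intro j hj
    simp only [Finset.mem_filter, Finset.mem_range] at hj ⊢
    omega
  · intro j hj
    simp only [Finset.mem_filter, Finset.mem_range] at hj ⊢
    omega
  · intro j hj
    simp only [Finset.mem_range] at hj ⊢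
    omega
  · intro j hj
    simp only [Finset.mem_filter, Finset.mem_range] at hj
    rw [show t + p - (p - j) = t + j by omega]

/-- The distribution of the first state given the transition law. -/
noncomputable def initDist [MeasurableSpace Ω] (d : Panel 𝒳 ℋ A n Ω) (μ : Measure Ω) (i : Fin n)
    (s : 𝒳 × ℋ) (ω : Ω) : ℝ :=
  (μ⟦d.state i 1 ⁻¹' {s} | d.unitField i⟧) ω

/-- The expectation of `u` at the first state given the transition law. -/
noncomputable def initMean [MeasurableSpace Ω] (d : Panel 𝒳 ℋ A n Ω) (μ : Measure Ω) (i : Fin n)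
    (u : Transition 𝒳 ℋ A → 𝒳 × ℋ → ℝ) (ω : Ω) : ℝ :=
  ∑ s, d.initDist μ i s ω * u (d.P i ω) s

theorem measurable_history_weighted [MeasurableSingletonClass 𝒳] (d : Panel 𝒳 ℋ A n Ω)
    (e π : 𝒳 → Fin A → ℝ) (k : ℕ) (i : Fin n) {t : ℕ} (ht : k + 1 ≤ t) :
    Measurable[d.history i (t + 1)] (d.weighted e π k i t) := by
  have hX : ∀ s, 1 ≤ s → s < t + 1 → Measurable[d.history i (t + 1)] (d.X i s) := fun s h1 h2 =>
    measurable_fst.comp (d.measurable_history_obs i h1 h2)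
  have hW : ∀ s, 1 ≤ s → s < t + 1 → Measurable[d.history i (t + 1)] (d.W i s) := fun s h1 h2 =>
    measurable_fst.comp (measurable_snd.comp (measurable_snd.comp (d.measurable_history_obs i h1 h2)))
  have hY : Measurable[d.history i (t + 1)] (d.Y i t) :=
    measurable_snd.comp (measurable_snd.comp (measurable_snd.comp
      (d.measurable_history_obs i (by omega) t.lt_succ_self)))
  refine (Finset.measurable_fun_prod _ fun s hs => ?_).mul hY
  have hs := Finset.mem_range.1 hs
  exact (measurable_of_countable fun q : 𝒳 × Fin A => π q.1 q.2 / e q.1 q.2).comp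
    ((hX (t - s) (by omega) (by omega)).prodMk (hW (t - s) (by omega) (by omega)))

theorem measurable_history_centered [MeasurableSingletonClass 𝒳] [MeasurableSpace Ω]
    (d : Panel 𝒳 ℋ A n Ω) (μ : Measure Ω)
    (e π : 𝒳 → Fin A → ℝ) (k : ℕ) (i : Fin n) {t : ℕ} (ht : k + 1 ≤ t) :
    Measurable[d.history i (t + 1)] (d.centered μ e π k i t) :=
  (d.measurable_history_weighted e π k i ht).sub
    ((stronglyMeasurable_condExp.mono (d.unitField_le_history i _)).measurable)

namespace IsSample

variable [MeasurableSingletonClass 𝒳] [MeasurableSingletonClass ℋ]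
  {m0 : MeasurableSpace Ω} {μ : Measure Ω} [IsProbabilityMeasure μ] {d : Panel 𝒳 ℋ A n Ω} {T : ℕ}
  {e π : 𝒳 → Fin A → ℝ} {D : Measure (Transition 𝒳 ℋ A)} {C t₀ : ℝ} {k : ℕ}
  {u : Transition 𝒳 ℋ A → 𝒳 × ℋ → ℝ}

theorem measurable_truncatedWeighted (h : d.IsSample μ T e D) (i : Fin n) (t : ℕ) :
    Measurable (d.truncatedWeighted e π C k i t) := by
  refine (Finset.measurable_fun_prod _ fun s _ => ?_).mul
    ((measurable_truncate C).comp (h.measurable_Y i t))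
  exact (measurable_of_countable fun q : 𝒳 × Fin A => π q.1 q.2 / e q.1 q.2).comp
    ((h.measurable_X i (t - s)).prodMk (h.measurable_W i (t - s)))

theorem isBddFun_truncatedWeighted (d : Panel 𝒳 ℋ A n Ω) (i : Fin n) (t : ℕ) :
    IsBddFun (d.truncatedWeighted e π C k i t) := by
  obtain ⟨w, hw⟩ := IsBddFun.of_finite fun q : 𝒳 × Fin A => π q.1 q.2 / e q.1 q.2
  exact ⟨_, d.abs_truncatedWeighted_le k (fun x a => hw (x, a)) i t⟩

theorem integrable_truncatedWeighted (h : d.IsSample μ T e D) (i : Fin n) (t : ℕ) :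
    Integrable (d.truncatedWeighted e π C k i t) μ :=
  (isBddFun_truncatedWeighted d i t).integrable
    (h.measurable_truncatedWeighted i t).aestronglyMeasurable

theorem integral_mul_truncatedWeighted (h : d.IsSample μ T e D) (i : Fin n) {t : ℕ} (ht : 1 ≤ t)
    (hT : t + k ≤ T) {Z : Ω → ℝ} (hZ : StronglyMeasurable[d.history i t] Z) (hZb : IsBddFun Z) :
    ∫ ω, Z ω * d.truncatedWeighted e π C k i (t + k) ω ∂μ =
      ∫ ω, Z ω * windowMean e π C k (d.P i ω) (d.state i t ω) ∂μ := by
  rw [windowMean, ← h.integral_mul_window i isStateFun_one (k + 1) ht (by omega)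
    (fun j => isWeightFun_windowFactor e π C k k j) hZ hZb]
  simp_rw [d.prod_windowFactor e π C le_rfl (Nat.lt_succ_self k), mul_one]

theorem integral_truncatedWeighted_mul (h : d.IsSample μ T e D) (i : Fin n) {t l : ℕ} (ht : 1 ≤ t)
    (hT : t + k + l ≤ T) :
    ∫ ω, d.truncatedWeighted e π C k i (t + k) ω * d.truncatedWeighted e π C k i (t + k + l) ω ∂μ =
      ∫ ω, windowProd e π C k l (d.P i ω) (d.state i t ω) ∂μ := by
  have := h.integral_mul_window i isStateFun_one (k + l + 1) ht (by omega)
    (fun j => (isWeightFun_windowFactor e π C k k j).mul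
      (isWeightFun_windowFactor e π C k (k + l) j)) stronglyMeasurable_one (IsBddFun.const 1)
  simp only [Pi.one_apply, one_mul, mul_one, Finset.prod_mul_distrib] at this
  rw [windowProd, ← this]
  simp_rw [d.prod_windowFactor e π C le_rfl (show k < k + l + 1 by omega),
    d.prod_windowFactor e π C (show k ≤ k + l by omega) (Nat.lt_succ_self _), add_assoc]

/-- Split over the finitely many values of the first state; for a frozen state, u is a function of
`P_i`. -/
theorem integral_mul_initial (h : d.IsSample μ T e D) (i : Fin n) (hu : IsStateFun u)
    {Z : Ω → ℝ} (hZ : StronglyMeasurable[d.unitField i] Z) (hZb : IsBddFun Z) :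
    ∫ ω, Z ω * u (d.P i ω) (d.state i 1 ω) ∂μ = ∫ ω, Z ω * d.initMean μ i u ω ∂μ := by
  classical
  have hS : ∀ s, MeasurableSet (d.state i 1 ⁻¹' {s}) := fun s =>
    h.measurable_state i 1 (measurableSet_singleton s)
  have hUm : ∀ s, StronglyMeasurable[d.unitField i] fun ω => Z ω * u (d.P i ω) s := fun s =>
    hZ.mul ((hu.1 s).comp (comap_measurable (d.P i))).stronglyMeasurable
  have hUb : ∀ s, IsBddFun fun ω => Z ω * u (d.P i ω) s := fun s =>
    hZb.mul (hu.2.comp fun ω => (d.P i ω, s))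
  have hi : ∀ s, Integrable ((d.state i 1 ⁻¹' {s}).indicator fun _ => (1 : ℝ)) μ := fun s =>
    (integrable_const 1).indicator (hS s)
  have hm := h.unitField_le i
  have e1 : ∀ ω, Z ω * u (d.P i ω) (d.state i 1 ω) = ∑ s, (Z ω * u (d.P i ω) s) *
      (d.state i 1 ⁻¹' {s}).indicator (fun _ => (1 : ℝ)) ω := fun ω => by
    rw [Finset.sum_eq_single (d.state i 1 ω)]
    · simp
    · intro b _ hb
      simp [hb.symm]
    · simp
  have e2 : ∀ ω, Z ω * d.initMean μ i u ω = ∑ s, (Z ω * u (d.P i ω) s) *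
      (μ[(d.state i 1 ⁻¹' {s}).indicator (fun _ => (1 : ℝ)) | d.unitField i]) ω := fun ω => by
    rw [initMean, Finset.mul_sum]
    exact Finset.sum_congr rfl fun s _ => by rw [initDist]; ring
  simp_rw [e1, e2]
  have hb : ∀ s {g : Ω → ℝ}, Integrable g μ → Integrable (fun ω => (Z ω * u (d.P i ω) s) * g ω) μ :=
    fun s g hg => by
      obtain ⟨c, hc⟩ := hUb s
      exact hg.bdd_mul ((hUm s).mono hm).aestronglyMeasurable (ae_of_all _ hc)
  rw [integral_finsetSum _ fun s _ => hb s (hi s),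
    integral_finsetSum _ fun s _ => hb s integrable_condExp]
  exact Finset.sum_congr rfl fun s _ => (integral_mul_condExp_eq hm (hi s) (hUm s) (hUb s)).symm

theorem stronglyMeasurable_initMean (hu : IsStateFun u) (i : Fin n) :
    StronglyMeasurable[d.unitField i] (d.initMean μ i u) :=
  Finset.stronglyMeasurable_fun_sum _ fun s _ => stronglyMeasurable_condExp.mul
    ((hu.1 s).comp (comap_measurable (d.P i))).stronglyMeasurable

theorem ae_isStationaryDist_initDist (h : d.IsSample μ T e D) (i : Fin n) :
    ∀ᵐ ω ∂μ, IsStationaryDist (d.P i ω) e fun s => d.initDist μ i s ω :=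
  h.initial i

theorem ae_abs_initMean_le (h : d.IsSample μ T e D) (i : Fin n) {b : ℝ}
    (hb : ∀ P s, |u P s| ≤ b) : ∀ᵐ ω ∂μ, |d.initMean μ i u ω| ≤ b := by
  filter_upwards [h.ae_isStationaryDist_initDist i] with ω hω
  refine (Finset.abs_sum_le_sum_abs _ _).trans ?_
  calc _ ≤ ∑ s, d.initDist μ i s ω * b := Finset.sum_le_sum fun s _ => by
        rw [abs_mul, abs_of_nonneg (hω.1.1 s)]
        exact mul_le_mul_of_nonneg_left (hb _ _) (hω.1.1 s)
    _ = b := by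
        rw [← Finset.sum_mul, hω.1.2, one_mul]

/-- Move the evolution to the initial distribution, which is a fixed point of `stateStep`. -/
theorem ae_initMean_evolve (h : d.IsSample μ T e D) (i : Fin n) :
    ∀ᵐ ω ∂μ, ∀ m, d.initMean μ i (evolve e m u) ω = d.initMean μ i u ω := by
  filter_upwards [h.ae_isStationaryDist_initDist i] with ω hω m
  rw [initMean, sum_mul_evolve]
  have : (stateStep (d.P i ω) e)^[m] (fun s => d.initDist μ i s ω)
      = fun s => d.initDist μ i s ω := Function.iterate_fixed hω.2 m
  rw [this, initMean]

/-- Compare the chain started from the point mass at s with the stationary one, whose mean of u does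
not change. -/
theorem ae_abs_evolve_sub_initMean_le (h : d.IsSample μ T e D) (he : IsPolicy e)
    (hmix : ∀ᵐ P ∂D, ∃ τ ≤ t₀, IsMixingTime P e τ) (i : Fin n) {b : ℝ}
    (hb : ∀ P s, |u P s| ≤ b) : ∀ᵐ ω ∂μ, ∀ m s,
      |evolve e m u (d.P i ω) s - d.initMean μ i u ω| ≤ 2 * b * Real.exp (-1 / t₀) ^ m := by
  classical
  have hmix' : ∀ᵐ ω ∂μ, ∃ τ ≤ t₀, IsMixingTime (d.P i ω) e τ :=
    ae_of_ae_map (h.measurable_P i).aemeasurable (by rw [h.law_P i]; exact hmix)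
  filter_upwards [h.ae_isStationaryDist_initDist i, hmix', h.ae_initMean_evolve i (u := u)] with ω hω hτ hev m s
  obtain ⟨τ, hτ0, hτ⟩ := hτ
  have h1 := abs_sum_mul_evolve_sub_le he hτ hτ0 m (f := fun s => d.initDist μ i s ω) hω.1
    (single_mem_stdSimplex ℝ s) (u := u) ((abs_nonneg _).trans (hb (d.P i ω) s)) (hb _)
  have h2 : ∑ s', (Pi.single s 1 : 𝒳 × ℋ → ℝ) s' * evolve e m u (d.P i ω) s'
      = evolve e m u (d.P i ω) s := by
    rw [Finset.sum_eq_single s]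
    · simp
    · intro b _ hb
      simp [hb]
    · simp
  rw [h2] at h1
  rwa [← hev m]

theorem integral_mul_stateFun_eq_initMean (h : d.IsSample μ T e D) (i : Fin n) (hu : IsStateFun u)
    {t : ℕ} (ht : 1 ≤ t) (hT : t ≤ T + 1)
    {Z : Ω → ℝ} (hZ : StronglyMeasurable[d.unitField i] Z) (hZb : IsBddFun Z) :
    ∫ ω, Z ω * u (d.P i ω) (d.state i t ω) ∂μ = ∫ ω, Z ω * d.initMean μ i u ω ∂μ := by
  have h1 := h.integral_mul_evolve i hu (t - 1) le_rfl (by omega)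
    (hZ.mono (d.unitField_le_history i 1)) hZb
  rw [show 1 + (t - 1) = t by omega] at h1
  rw [h1, h.integral_mul_initial i (hu.evolve (t - 1)) hZ hZb]
  refine integral_congr_ae ?_
  filter_upwards [h.ae_initMean_evolve i (u := u)] with ω hω
  rw [hω]

theorem integrable_initMean (h : d.IsSample μ T e D) (i : Fin n) (hu : IsStateFun u) :
    Integrable (d.initMean μ i u) μ := by
  obtain ⟨b, hb⟩ := hu.2
  exact Integrable.of_bound (C := b)
    ((stronglyMeasurable_initMean hu i).mono (h.unitField_le i)).aestronglyMeasurable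
    (h.ae_abs_initMean_le i fun P s => hb (P, s))

/-- By stationarity the answer does not depend on t, so one random variable centers all epochs. -/
theorem condExp_truncatedWeighted_unitField (h : d.IsSample μ T e D) (i : Fin n) {t : ℕ}
    (ht : k + 1 ≤ t) (hT : t ≤ T) :
    μ[d.truncatedWeighted e π C k i t | d.unitField i]
      =ᵐ[μ] d.initMean μ i (windowMean e π C k) := by
  have hu := isStateFun_windowMean (ℋ := ℋ) e π C k
  obtain ⟨t, rfl⟩ : ∃ t', t = t' + k := ⟨t - k, by omega⟩
  refine condExp_ae_eq_of_integral_mul (h.unitField_le i) (h.integrable_truncatedWeighted i _)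
    (h.integrable_initMean i hu) (stronglyMeasurable_initMean hu i) fun Z hZ hZb => ?_
  rw [h.integral_mul_truncatedWeighted i (by omega) hT (hZ.mono (d.unitField_le_history i _)) hZb,
    h.integral_mul_stateFun_eq_initMean i hu (by omega) (by omega) hZ hZb]

theorem condExp_truncatedWeighted_history (h : d.IsSample μ T e D) (i : Fin n) {t : ℕ}
    (ht : 1 ≤ t) (m : ℕ) (hT : t + m + k ≤ T) :
    μ[d.truncatedWeighted e π C k i (t + m + k) | d.history i t]
      =ᵐ[μ] fun ω => evolve e m (windowMean e π C k) (d.P i ω) (d.state i t ω) := by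
  have hu := isStateFun_windowMean (ℋ := ℋ) e π C k
  have hm : StronglyMeasurable[d.history i t]
      fun ω => evolve e m (windowMean e π C k) (d.P i ω) (d.state i t ω) :=
    ((hu.evolve m).measurable_uncurry.comp
      ((d.measurable_history_P i t).prodMk (d.measurable_history_state i t))).stronglyMeasurable
  refine condExp_ae_eq_of_integral_mul (h.history_le i t) (h.integrable_truncatedWeighted i _)
    (((hu.evolve m).2.comp fun ω => (d.P i ω, d.state i t ω)).integrable
      (hm.mono (h.history_le i t)).aestronglyMeasurable) hm fun Z hZ hZb => ?_
  rw [h.integral_mul_truncatedWeighted i (by omega) hT (hZ.mono (d.history_mono i ht (by omega))) hZb,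
    h.integral_mul_evolve i hu m ht (by omega) hZ hZb]

theorem weighted_ae_eq {i : Fin n}
    (hY : ∀ t ∈ Finset.Icc 1 T, ∀ᵐ ω ∂μ, |d.Y i t ω| ≤ C) {t : ℕ}
    (ht : k + 1 ≤ t) (hT : t ≤ T) :
    d.weighted e π k i t =ᵐ[μ] d.truncatedWeighted e π C k i t := by
  filter_upwards [hY t (Finset.mem_Icc.2 ⟨by omega, hT⟩)] with ω hω
  rw [weighted, truncatedWeighted, truncate_of_abs_le hω]

theorem centered_ae_eq (h : d.IsSample μ T e D) {i : Fin n}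
    (hY : ∀ t ∈ Finset.Icc 1 T, ∀ᵐ ω ∂μ, |d.Y i t ω| ≤ C) {t : ℕ}
    (ht : k + 1 ≤ t) (hT : t ≤ T) :
    d.centered μ e π k i t =ᵐ[μ] fun ω =>
      d.truncatedWeighted e π C k i t ω - d.initMean μ i (windowMean e π C k) ω := by
  have h1 := weighted_ae_eq (e := e) (π := π) hY ht hT
  filter_upwards [h1, condExp_congr_ae (m := d.unitField i) h1,
    h.condExp_truncatedWeighted_unitField (π := π) (C := C) i ht hT] with ω h1 h2 h3
  rw [centered, h1, h2, h3]

end IsSample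

end Panel

/-! ### Covariances and the mixingale property of the centered outcomes -/

namespace Panel

variable {𝒳 ℋ : Type*} {A n : ℕ} [Fintype 𝒳] [Fintype ℋ] [MeasurableSpace 𝒳] [MeasurableSpace ℋ]
  {Ω : Type*}

namespace IsSample

variable [MeasurableSingletonClass 𝒳] [MeasurableSingletonClass ℋ]
  {m0 : MeasurableSpace Ω} {μ : Measure Ω} [IsProbabilityMeasure μ] {d : Panel 𝒳 ℋ A n Ω} {T : ℕ}
  {e π : 𝒳 → Fin A → ℝ} {D : Measure (Transition 𝒳 ℋ A)} {C t₀ : ℝ} {k : ℕ}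
  {u : Transition 𝒳 ℋ A → 𝒳 × ℋ → ℝ}

theorem integral_truncatedWeighted_mul_eq_initMean (h : d.IsSample μ T e D) (i : Fin n)
    {t l : ℕ} (ht : k + 1 ≤ t) (hT : t + l ≤ T) :
    ∫ ω, d.truncatedWeighted e π C k i t ω * d.truncatedWeighted e π C k i (t + l) ω ∂μ =
      ∫ ω, d.initMean μ i (windowProd e π C k l) ω ∂μ := by
  obtain ⟨t, rfl⟩ : ∃ t', t = t' + k := ⟨t - k, by omega⟩
  rw [h.integral_truncatedWeighted_mul i (by omega) hT]
  have := h.integral_mul_stateFun_eq_initMean i (isStateFun_windowProd e π C k l) (t := t)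
    (by omega) (by omega) (stronglyMeasurable_one) (IsBddFun.const 1)
  simpa using this

/-- The cross terms reduce to the squared stationary mean v² after conditioning on `P_i`. -/
theorem integral_centered_mul_centered (h : d.IsSample μ T e D) {i : Fin n}
    (hY : ∀ t ∈ Finset.Icc 1 T, ∀ᵐ ω ∂μ, |d.Y i t ω| ≤ C) {t l : ℕ}
    (ht : k + 1 ≤ t) (hT : t + l ≤ T) :
    ∫ ω, d.centered μ e π k i t ω * d.centered μ e π k i (t + l) ω ∂μ =
      ∫ ω, (d.initMean μ i (windowProd e π C k l) ω
        - d.initMean μ i (windowMean e π C k) ω ^ 2) ∂μ := by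
  set g := d.truncatedWeighted e π C k i with hg
  set v := d.initMean μ i (windowMean e π C k) with hv
  have hu := isStateFun_windowMean (ℋ := ℋ) e π C k
  obtain ⟨b, hb⟩ := id hu.2
  have hvb : ∀ᵐ ω ∂μ, |v ω| ≤ b := h.ae_abs_initMean_le i fun P s => hb (P, s)
  have hvm := stronglyMeasurable_initMean (d := d) (μ := μ) hu i
  have hvm0 : AEStronglyMeasurable v μ := (hvm.mono (h.unitField_le i)).aestronglyMeasurable
  have hgm : ∀ t, AEStronglyMeasurable (g t) μ := fun t =>
    (h.measurable_truncatedWeighted i t).aestronglyMeasurable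
  have hgi : ∀ t, Integrable (g t) μ := fun t => h.integrable_truncatedWeighted i t
  have hvg : ∀ t, k + 1 ≤ t → t ≤ T → ∫ ω, v ω * g t ω ∂μ = ∫ ω, v ω ^ 2 ∂μ := by
    intro t ht hT
    rw [← integral_mul_condExp_eq_of_ae_bdd (h.unitField_le i) (hgi t) hvm hvb]
    refine integral_congr_ae ?_
    filter_upwards [h.condExp_truncatedWeighted_unitField (π := π) (C := C) i ht hT] with ω hω
    rw [hω, sq]
  have ivg : ∀ t, Integrable (fun ω => v ω * g t ω) μ := fun t => (hgi t).bdd_mul hvm0 hvb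
  have ivv : Integrable (fun ω => v ω ^ 2) μ := by
    simpa using integrable_pow_mul_pow_of_bdd hvm0 hvm0 hvb hvb 2 0
  have igg : Integrable (fun ω => g t ω * g (t + l) ω) μ :=
    ((isBddFun_truncatedWeighted d i t).mul (isBddFun_truncatedWeighted d i (t + l))).integrable
      ((hgm t).mul (hgm (t + l)))
  have e1 : ∫ ω, d.centered μ e π k i t ω * d.centered μ e π k i (t + l) ω ∂μ =
      ∫ ω, (g t ω * g (t + l) ω - v ω * g (t + l) ω - (v ω * g t ω - v ω ^ 2)) ∂μ := by
    refine integral_congr_ae ?_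
    filter_upwards [h.centered_ae_eq hY ht (by omega : t ≤ T),
      h.centered_ae_eq hY (by omega : k + 1 ≤ t + l) hT] with ω h1 h2
    rw [h1, h2]; ring
  have i1 : Integrable (fun ω => g t ω * g (t + l) ω - v ω * g (t + l) ω) μ := igg.sub (ivg _)
  have i2 : Integrable (fun ω => v ω * g t ω - v ω ^ 2) μ := (ivg _).sub ivv
  rw [e1, integral_sub i1 i2, integral_sub igg (ivg _), integral_sub (ivg _) ivv,
    hvg _ (by omega) hT, hvg _ ht (by omega), h.integral_truncatedWeighted_mul_eq_initMean i ht hT,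
    integral_sub (h.integrable_initMean i (isStateFun_windowProd e π C k l)) ivv]
  ring

/-- Stationary means are random variables on the sample space, but they are limits of the evolution
from s₀, a function of `P_i` alone. Before the limit the law of `P_i` can be replaced by `D`, so no
trace of the sample remains. -/
theorem integral_centered_mul_centered_eq_autocov (h : d.IsSample μ T e D) (he : IsPolicy e)
    (hmix : ∀ᵐ P ∂D, ∃ τ ≤ t₀, IsMixingTime P e τ) (ht₀ : 0 < t₀) {i : Fin n}
    (hY : ∀ t ∈ Finset.Icc 1 T, ∀ᵐ ω ∂μ, |d.Y i t ω| ≤ C) (s₀ : 𝒳 × ℋ) {t l : ℕ}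
    (ht : k + 1 ≤ t) (hT : t + l ≤ T) :
    ∫ ω, d.centered μ e π k i t ω * d.centered μ e π k i (t + l) ω ∂μ =
      autocov e π D k s₀ C l := by
  rw [h.integral_centered_mul_centered hY ht hT, autocov]
  refine (Tendsto.limUnder_eq ?_).symm
  have hu := isStateFun_windowMean (ℋ := ℋ) e π C k
  have hw := isStateFun_windowProd (ℋ := ℋ) e π C k l
  have hm : ∀ N : ℕ, Measurable fun P => evolve e N (windowProd e π C k l) P s₀
      - evolve e N (windowMean e π C k) P s₀ ^ 2 := fun N =>
    ((hw.evolve N).1 s₀).sub (((hu.evolve N).1 s₀).pow_const 2)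
  have e1 : ∀ N : ℕ, ∫ P, (evolve e N (windowProd e π C k l) P s₀
      - evolve e N (windowMean e π C k) P s₀ ^ 2) ∂D =
      ∫ ω, (evolve e N (windowProd e π C k l) (d.P i ω) s₀
      - evolve e N (windowMean e π C k) (d.P i ω) s₀ ^ 2) ∂μ := fun N => by
    rw [← h.law_P i, integral_map (h.measurable_P i).aemeasurable (hm N).aestronglyMeasurable]
  simp_rw [e1]
  obtain ⟨b, hb⟩ := id hu.2
  obtain ⟨b', hb'⟩ := id hw.2
  set r := Real.exp (-1 / t₀) with hr
  have hr0 : 0 ≤ r := (Real.exp_pos _).le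
  have hr1 : r < 1 := Real.exp_lt_one_iff.2 (div_neg_of_neg_of_pos (by norm_num) ht₀)
  have h1 := h.ae_abs_evolve_sub_initMean_le he hmix i (u := windowMean e π C k)
    fun P s => hb (P, s)
  have h2 := h.ae_abs_evolve_sub_initMean_le he hmix i (u := windowProd e π C k l)
    fun P s => hb' (P, s)
  have lim : ∀ {v : Transition 𝒳 ℋ A → 𝒳 × ℋ → ℝ} {b : ℝ} {ω : Ω},
      (∀ m s, |evolve e m v (d.P i ω) s - d.initMean μ i v ω| ≤ 2 * b * r ^ m) →
      Tendsto (fun m => evolve e m v (d.P i ω) s₀) atTop (𝓝 (d.initMean μ i v ω)) := by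
    intro v b ω hω
    rw [tendsto_iff_dist_tendsto_zero]
    refine squeeze_zero (fun _ => dist_nonneg) (fun m => ?_)
      (by simpa using (tendsto_pow_atTop_nhds_zero_of_lt_one hr0 hr1).const_mul (2 * b))
    rw [Real.dist_eq]
    exact hω m s₀
  have bd : ∀ {v : Transition 𝒳 ℋ A → 𝒳 × ℋ → ℝ} {b : ℝ} {ω : Ω},
      (∀ m s, |evolve e m v (d.P i ω) s - d.initMean μ i v ω| ≤ 2 * b * r ^ m) →
      |d.initMean μ i v ω| ≤ b → ∀ m, |evolve e m v (d.P i ω) s₀| ≤ 3 * b := by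
    intro v b ω hω hb m
    have hb0 : 0 ≤ b := (abs_nonneg _).trans hb
    have h3 : 2 * b * r ^ m ≤ 2 * b * 1 := by
      gcongr
      exact pow_le_one₀ hr0 hr1.le
    have h4 := hω m s₀
    rw [abs_le] at *
    constructor <;> linarith
  refine tendsto_integral_of_dominated_convergence (fun _ => 3 * b' + (3 * b) ^ 2) (fun N => ?_)
    (integrable_const _) (fun N => ?_) ?_
  · exact ((hm N).comp (h.measurable_P i)).aestronglyMeasurable
  · filter_upwards [h1, h2, h.ae_abs_initMean_le i (u := windowMean e π C k) fun P s => hb (P, s),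
      h.ae_abs_initMean_le i (u := windowProd e π C k l) fun P s => hb' (P, s)] with ω h1 h2 h3 h4
    refine (abs_sub _ _).trans ?_
    rw [abs_pow]
    have := bd h1 h3 N
    have := bd h2 h4 N
    gcongr
  · filter_upwards [h1, h2] with ω h1 h2
    exact (lim h2).sub ((lim h1).pow 2)

/-- The histories of unit `i` from epoch `k + 1` on. -/
def shiftedHistory (h : d.IsSample μ T e D) (i : Fin n) (k : ℕ) : Filtration ℕ m0 where
  seq t := d.history i (k + 1 + t)
  mono' s t hst := d.history_mono i (by omega) (by omega)
  le' t := h.history_le i _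

/-- At gap at least k the window of the later outcome lies ahead of the conditioning epoch, and
mixing acts for (gap - k) steps. At smaller gaps only the trivial bound holds. Dividing the constant
by rᵏ covers both. -/
theorem isGeometricMixingale (h : d.IsSample μ T e D) (he : IsPolicy e)
    (hmix : ∀ᵐ P ∂D, ∃ τ ≤ t₀, IsMixingTime P e τ) (ht₀ : 0 < t₀) {i : Fin n}
    (hY : ∀ t ∈ Finset.Icc 1 T, ∀ᵐ ω ∂μ, |d.Y i t ω| ≤ C) {w b : ℝ}
    (hw : ∀ x a, |π x a / e x a| ≤ w) (hb : ∀ P s, |windowMean (ℋ := ℋ) e π C k P s| ≤ b)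
    (hb0 : 0 ≤ b) :
    IsGeometricMixingale (h.shiftedHistory i k) μ (T - k)
      ((w ^ (k + 1) * |C| + 2 * b) / Real.exp (-1 / t₀) ^ k) (Real.exp (-1 / t₀))
      (fun t => d.centered μ e π k i (k + 1 + t)) := by
  set r := Real.exp (-1 / t₀) with hr
  have hr0 : 0 < r := Real.exp_pos _
  have hr1 : r < 1 := Real.exp_lt_one_iff.2 (div_neg_of_neg_of_pos (by norm_num) ht₀)
  set B := w ^ (k + 1) * |C| with hB
  have hgb : ∀ t ω, |d.truncatedWeighted e π C k i t ω| ≤ B := fun t ω =>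
    d.abs_truncatedWeighted_le k hw i t ω
  have hΩ : Nonempty Ω := nonempty_of_isProbabilityMeasure μ
  have hB0 : 0 ≤ B := (abs_nonneg _).trans (hgb 0 hΩ.some)
  have hvb := h.ae_abs_initMean_le i hb
  have hrk : ∀ {m : ℕ}, m ≤ k → B + 2 * b ≤ (B + 2 * b) / r ^ k * r ^ m := by
    intro m hm
    rw [div_mul_eq_mul_div, le_div_iff₀ (by positivity)]
    have := pow_le_pow_of_le_one hr0.le hr1.le hm
    gcongr
  have hu := isStateFun_windowMean (ℋ := ℋ) e π C k
  have hcb : ∀ t, k + 1 ≤ t → t ≤ T → ∀ᵐ ω ∂μ, |d.centered μ e π k i t ω| ≤ B + 2 * b := by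
    intro t h1 h2
    filter_upwards [h.centered_ae_eq hY h1 h2, hvb] with ω h3 h4
    rw [h3]
    refine (abs_sub _ _).trans ?_
    linarith [hgb t ω]
  refine ⟨fun l hl => ?_, fun l hl => ?_, fun j hj l hlj => ?_⟩
  · exact (d.measurable_history_centered μ e π k i (by omega)).stronglyMeasurable
  · filter_upwards [hcb (k + 1 + l) (by omega) (by omega)] with ω hω
    have := hrk (Nat.zero_le k)
    rw [pow_zero, mul_one] at this
    exact hω.trans this
  · change ∀ᵐ ω ∂μ, |(μ[d.centered μ e π k i (k + 1 + j) | d.history i (k + 1 + l)]) ω| ≤ _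
    rcases le_or_gt (l + k) j with hlk | hlk
    · obtain ⟨m, rfl⟩ : ∃ m, j = l + m + k := ⟨j - l - k, by omega⟩
      have e1 := h.centered_ae_eq (π := π) hY (by omega : k + 1 ≤ k + 1 + (l + m + k)) (by omega)
      have e2 := h.condExp_truncatedWeighted_history (π := π) (C := C) i
        (by omega : 1 ≤ k + 1 + l) m (by omega : k + 1 + l + m + k ≤ T)
      have e3 := condExp_sub (μ := μ)
        (h.integrable_truncatedWeighted (π := π) (C := C) (k := k) i (k + 1 + (l + m + k)))
        (h.integrable_initMean i hu) (d.history i (k + 1 + l))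
      have e4 : μ[d.initMean μ i (windowMean e π C k) | d.history i (k + 1 + l)]
          = d.initMean μ i (windowMean e π C k) :=
        condExp_of_stronglyMeasurable (h.history_le i _)
          ((stronglyMeasurable_initMean hu i).mono (d.unitField_le_history i _))
          (h.integrable_initMean i hu)
      rw [show k + 1 + l + m + k = k + 1 + (l + m + k) by omega] at e2
      filter_upwards [condExp_congr_ae (m := d.history i (k + 1 + l)) e1, e2, e3,
        h.ae_abs_evolve_sub_initMean_le he hmix i hb] with ω h1 h2 h3 h4
      have h3' : (μ[fun ω => d.truncatedWeighted e π C k i (k + 1 + (l + m + k)) ω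
          - d.initMean μ i (windowMean e π C k) ω | d.history i (k + 1 + l)]) ω = _ := h3
      rw [h1, h3', Pi.sub_apply, h2, e4]
      refine (h4 m _).trans ?_
      rw [show l + m + k - l = m + k by omega, pow_add, div_mul_eq_mul_div, mul_comm (r ^ m),
        ← mul_assoc, mul_div_right_comm, mul_div_cancel_right₀ _ (by positivity)]
      gcongr
      linarith
    · filter_upwards [ae_bdd_abs_condExp_of_ae_bdd_abs (m := d.history i (k + 1 + l))
        (hcb (k + 1 + j) (by omega) (by omega))] with ω hω
      exact hω.trans (hrk (by omega))

end IsSample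

end Panel

/-! ### Weak law for row-independent arrays -/

/-- Weak law of large numbers for a triangular array whose rows are independent with a common
mean and bounded second moments. -/
theorem tendsto_measure_le_abs_average_sub {Ω : ℕ → Type*} [∀ n, MeasurableSpace (Ω n)]
    (μ : (n : ℕ) → Measure (Ω n)) [∀ n, IsProbabilityMeasure (μ n)]
    (R : (n : ℕ) → Fin n → Ω n → ℝ) (hind : ∀ n, iIndepFun (R n) (μ n))
    (hR : ∀ n i, MemLp (R n i) 2 (μ n)) {q : ℕ → ℝ} {V K : ℝ} (hq : Tendsto q atTop (𝓝 V))
    (h1 : ∀ n i, ∫ ω, R n i ω ∂(μ n) = q n)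
    (h2 : ∀ᶠ n in atTop, ∀ i, ∫ ω, R n i ω ^ 2 ∂(μ n) ≤ K) {ε : ℝ} (hε : 0 < ε) :
    Tendsto (fun n => μ n {ω | ε ≤ |1 / (n : ℝ) * ∑ i, R n i ω - V|}) atTop (𝓝 0) := by
  have hlim : Tendsto (fun n : ℕ => ENNReal.ofReal (K / (n : ℝ) / (ε / 2) ^ 2)) atTop (𝓝 0) := by
    have : Tendsto (fun n : ℕ => K / (n : ℝ) / (ε / 2) ^ 2) atTop (𝓝 0) := by
      simpa using (tendsto_natCast_atTop_atTop.const_div_atTop K).div_const ((ε / 2) ^ 2)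
    simpa using ENNReal.tendsto_ofReal this
  refine tendsto_of_tendsto_of_tendsto_of_le_of_le' tendsto_const_nhds hlim
    (Eventually.of_forall fun _ => zero_le) ?_
  have hqV : ∀ᶠ n in atTop, |q n - V| < ε / 2 := by
    have := (tendsto_iff_dist_tendsto_zero.1 hq).eventually (gt_mem_nhds (half_pos hε))
    simpa [Real.dist_eq] using this
  filter_upwards [h2, hqV, eventually_gt_atTop 0] with n hn hqn hpos
  have hn0 : (n : ℝ) ≠ 0 := by exact_mod_cast hpos.ne'
  set S : Ω n → ℝ := fun ω => 1 / (n : ℝ) * ∑ i, R n i ω with hS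
  have hSm : MemLp S 2 (μ n) := (memLp_finsetSum _ fun i _ => hR n i).const_mul _
  have hSi : ∫ ω, S ω ∂(μ n) = q n := by
    rw [hS, integral_const_mul, integral_finsetSum _ fun i _ => (hR n i).integrable one_le_two]
    simp only [h1, Finset.sum_const, Finset.card_univ, Fintype.card_fin, nsmul_eq_mul]
    field_simp
  have hSv : Var[S; μ n] ≤ K / n := by
    have e1 : Var[S; μ n] = (1 / (n : ℝ)) ^ 2 * Var[fun ω => ∑ i, R n i ω; μ n] :=
      variance_const_mul _ _ _
    have e2 : Var[fun ω => ∑ i, R n i ω; μ n] = ∑ i, Var[R n i; μ n] := by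
      rw [← IndepFun.variance_sum (fun i _ => hR n i) fun i _ j _ hij => (hind n).indepFun hij]
      congr 1; ext ω; simp
    have e3 : ∑ i, Var[R n i; μ n] ≤ n * K := by
      refine (Finset.sum_le_sum (g := fun _ => K) fun i _ => ?_).trans (by simp)
      exact (variance_le_expectation_sq (hR n i).1).trans (by simpa using hn i)
    rw [e1, e2]
    calc _ ≤ (1 / (n : ℝ)) ^ 2 * (n * K) := by gcongr
      _ = K / n := by field_simp
  -- The other ε/2 is spent on the difference between the row mean q n and its limit V.
  calc μ n {ω | ε ≤ |S ω - V|} ≤ μ n {ω | ε / 2 ≤ |S ω - ∫ ω, S ω ∂(μ n)|} := by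
        refine measure_mono fun ω hω => ?_
        simp only [Set.mem_ofPred_eq] at hω ⊢
        rw [hSi]
        have := abs_sub_le (S ω) (q n) V
        linarith
    _ ≤ ENNReal.ofReal (Var[S; μ n] / (ε / 2) ^ 2) :=
        meas_ge_le_variance_div_sq hSm (half_pos hε)
    _ ≤ _ := by
        apply ENNReal.ofReal_le_ofReal
        gcongr

theorem sum_Icc_succ_eq_sum_range {M : Type*} [AddCommMonoid M] (f : ℕ → M) (k T : ℕ) :
    ∑ t ∈ Finset.Icc (k + 1) T, f t = ∑ l ∈ Finset.range (T - k), f (k + 1 + l) := by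
  have : Finset.Icc (k + 1) T = Finset.Ico (k + 1) (T + 1) := by ext; simp
  rw [this, Finset.sum_Ico_eq_sum_range, Nat.add_sub_add_right]

theorem parzen_natCast_sub_div (l j : ℕ) (B : ℝ) :
    parzen (((l : ℝ) - j) / B) = parzen (((l - j + (j - l) : ℕ) : ℝ) / B) := by
  rcases le_total j l with h | h
  · rw [Nat.sub_eq_zero_of_le h, add_zero, Nat.cast_sub h]
  · rw [Nat.sub_eq_zero_of_le h, zero_add, Nat.cast_sub h, ← parzen_neg, ← neg_div, neg_sub]

/-! ### Sums and quadratic forms of one unit -/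

namespace Panel

variable {𝒳 ℋ : Type*} {A n : ℕ} [Fintype 𝒳] [Fintype ℋ] [MeasurableSpace 𝒳] [MeasurableSpace ℋ]
  {Ω : Type*}

/-- The sum of the centered importance-weighted outcomes of a unit. -/
noncomputable def centeredSum [MeasurableSpace Ω] (d : Panel 𝒳 ℋ A n Ω) (μ : Measure Ω)
    (e π : 𝒳 → Fin A → ℝ) (k T : ℕ) (i : Fin n) (ω : Ω) : ℝ :=
  ∑ l ∈ Finset.range (T - k), d.centered μ e π k i (k + 1 + l) ω

/-- The quadratic form of the centered importance-weighted outcomes of a unit with the Toeplitz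
matrix of `a`. -/
noncomputable def centeredQuadratic [MeasurableSpace Ω] (d : Panel 𝒳 ℋ A n Ω) (μ : Measure Ω)
    (e π : 𝒳 → Fin A → ℝ) (k T : ℕ) (a : ℕ → ℝ) (i : Fin n) (ω : Ω) : ℝ :=
  ∑ l ∈ Finset.range (T - k), ∑ j ∈ Finset.range (T - k), a (l - j + (j - l)) *
    d.centered μ e π k i (k + 1 + l) ω * d.centered μ e π k i (k + 1 + j) ω

/-- Lets one computation of Toeplitz expectations serve both the limit theorem and the variance
estimator. -/
theorem centeredSum_sq [MeasurableSpace Ω] (d : Panel 𝒳 ℋ A n Ω) (μ : Measure Ω)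
    (e π : 𝒳 → Fin A → ℝ) (k T : ℕ) (i : Fin n) (ω : Ω) :
    d.centeredSum μ e π k T i ω ^ 2 = d.centeredQuadratic μ e π k T (fun _ => 1) i ω := by
  rw [centeredSum, centeredQuadratic, sq, Finset.sum_mul_sum]
  simp

theorem varianceEstimator_eq [MeasurableSpace Ω] (d : Panel 𝒳 ℋ A n Ω) (μ : Measure Ω)
    (e π : 𝒳 → Fin A → ℝ) (k T : ℕ) (B : ℝ) (ω : Ω) :
    d.varianceEstimator μ e π k T B ω = 1 / (n : ℝ) * ∑ i, 1 / ((T : ℝ) - k) *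
      d.centeredQuadratic μ e π k T (fun l => parzen (l / B)) i ω := by
  rw [varianceEstimator]
  congr 1
  refine Finset.sum_congr rfl fun i _ => ?_
  congr 1
  rw [sum_Icc_succ_eq_sum_range, centeredQuadratic]
  refine Finset.sum_congr rfl fun l _ => ?_
  rw [sum_Icc_succ_eq_sum_range]
  refine Finset.sum_congr rfl fun j _ => ?_
  rw [← parzen_natCast_sub_div]
  push_cast
  rw [add_sub_add_left_eq_sub]

section Measurable

variable [MeasurableSingletonClass 𝒳] [MeasurableSpace Ω]

theorem measurable_history_centered_add (d : Panel 𝒳 ℋ A n Ω) (μ : Measure Ω)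
    (e π : 𝒳 → Fin A → ℝ) (k T : ℕ) (i : Fin n) {l : ℕ} (hl : l < T - k) :
    Measurable[d.history i (T + 1)] (d.centered μ e π k i (k + 1 + l)) :=
  (d.measurable_history_centered μ e π k i (by omega)).mono
    (d.history_mono i (by omega) (by omega)) le_rfl

theorem measurable_history_centeredSum (d : Panel 𝒳 ℋ A n Ω) (μ : Measure Ω)
    (e π : 𝒳 → Fin A → ℝ) (k T : ℕ) (i : Fin n) :
    Measurable[d.history i (T + 1)] (d.centeredSum μ e π k T i) :=
  Finset.measurable_fun_sum _ fun _ hl =>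
    d.measurable_history_centered_add μ e π k T i (Finset.mem_range.1 hl)

theorem measurable_history_centeredQuadratic (d : Panel 𝒳 ℋ A n Ω) (μ : Measure Ω)
    (e π : 𝒳 → Fin A → ℝ) (k T : ℕ) (a : ℕ → ℝ) (i : Fin n) :
    Measurable[d.history i (T + 1)] (d.centeredQuadratic μ e π k T a i) :=
  Finset.measurable_fun_sum _ fun _ hl => Finset.measurable_fun_sum _ fun _ hj =>
    ((d.measurable_history_centered_add μ e π k T i (Finset.mem_range.1 hl)).const_mul _).mul
      (d.measurable_history_centered_add μ e π k T i (Finset.mem_range.1 hj))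

end Measurable

namespace IsSample

variable [MeasurableSingletonClass 𝒳] [MeasurableSingletonClass ℋ]
  {m0 : MeasurableSpace Ω} {μ : Measure Ω} [IsProbabilityMeasure μ] {d : Panel 𝒳 ℋ A n Ω} {T : ℕ}
  {e π : 𝒳 → Fin A → ℝ} {D : Measure (Transition 𝒳 ℋ A)} {C t₀ : ℝ} {k : ℕ}

/-- The history contains `P_i`, hence also the centering given `P_i`; centered quantities of
different units remain independent. -/
theorem iIndepFun_of_measurable_history (h : d.IsSample μ T e D) {f : Fin n → Ω → ℝ}
    (hf : ∀ i, Measurable[d.history i (T + 1)] (f i)) : iIndepFun f μ :=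
  (iIndepFun_iff_iIndep _ _ _).2 (iIndep_of_iIndep_of_le h.indep fun i => (hf i).comap_le)

theorem integrable_weighted (h : d.IsSample μ T e D) {i : Fin n}
    (hY : ∀ t ∈ Finset.Icc 1 T, ∀ᵐ ω ∂μ, |d.Y i t ω| ≤ C) {t : ℕ} (ht : k + 1 ≤ t) (hT : t ≤ T) :
    Integrable (d.weighted e π k i t) μ :=
  (h.integrable_truncatedWeighted (C := C) i t).congr (weighted_ae_eq hY ht hT).symm

theorem integral_centered (h : d.IsSample μ T e D) {i : Fin n}
    (hY : ∀ t ∈ Finset.Icc 1 T, ∀ᵐ ω ∂μ, |d.Y i t ω| ≤ C) {t : ℕ} (ht : k + 1 ≤ t) (hT : t ≤ T) :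
    ∫ ω, d.centered μ e π k i t ω ∂μ = 0 := by
  unfold centered
  rw [integral_sub (h.integrable_weighted hY ht hT) integrable_condExp,
    integral_condExp (h.unitField_le i), sub_self]

theorem integrable_centered (h : d.IsSample μ T e D) {i : Fin n}
    (hY : ∀ t ∈ Finset.Icc 1 T, ∀ᵐ ω ∂μ, |d.Y i t ω| ≤ C) {t : ℕ} (ht : k + 1 ≤ t) (hT : t ≤ T) :
    Integrable (d.centered μ e π k i t) μ :=
  (h.integrable_weighted hY ht hT).sub integrable_condExp

theorem integral_centeredSum (h : d.IsSample μ T e D) {i : Fin n}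
    (hY : ∀ t ∈ Finset.Icc 1 T, ∀ᵐ ω ∂μ, |d.Y i t ω| ≤ C) :
    ∫ ω, d.centeredSum μ e π k T i ω ∂μ = 0 := by
  unfold centeredSum
  rw [integral_finsetSum]
  · refine Finset.sum_eq_zero fun l hl => ?_
    have := Finset.mem_range.1 hl
    exact h.integral_centered hY (by omega) (by omega)
  · intro l hl
    have := Finset.mem_range.1 hl
    exact h.integrable_centered hY (by omega) (by omega)

theorem unitEstimator_sub_condExp_ae_eq (h : d.IsSample μ T e D) {i : Fin n}
    (hY : ∀ t ∈ Finset.Icc 1 T, ∀ᵐ ω ∂μ, |d.Y i t ω| ≤ C) :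
    ∀ᵐ ω ∂μ, d.unitEstimator e π k T i ω - (μ[d.unitEstimator e π k T i | d.unitField i]) ω =
      1 / ((T : ℝ) - k) * d.centeredSum μ e π k T i ω := by
  have e1 : d.unitEstimator e π k T i =
      (1 / ((T : ℝ) - k)) • ∑ l ∈ Finset.range (T - k), d.weighted e π k i (k + 1 + l) := by
    ext ω
    simp [unitEstimator, sum_Icc_succ_eq_sum_range]
  have h1 := condExp_smul (μ := μ) (1 / ((T : ℝ) - k))
    (∑ l ∈ Finset.range (T - k), d.weighted e π k i (k + 1 + l)) (d.unitField i)
  have h2 := condExp_finsetSum (μ := μ) (s := Finset.range (T - k))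
    (f := fun l => d.weighted e π k i (k + 1 + l)) (fun l hl => by
      have := Finset.mem_range.1 hl
      exact h.integrable_weighted hY (by omega) (by omega)) (d.unitField i)
  filter_upwards [h1, h2] with ω h1 h2
  rw [e1, h1, Pi.smul_apply, Pi.smul_apply, h2, Finset.sum_apply, Finset.sum_apply, centeredSum]
  simp only [centered, smul_eq_mul, Finset.sum_sub_distrib]
  ring

theorem sqrt_mul_estimator_sub_ae_eq (h : d.IsSample μ T e D)
    (hY : ∀ i, ∀ t ∈ Finset.Icc 1 T, ∀ᵐ ω ∂μ, |d.Y i t ω| ≤ C) :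
    (fun ω => (√(n : ℝ))⁻¹ * ∑ i, √(T : ℝ) / ((T : ℝ) - k) * d.centeredSum μ e π k T i ω) =ᵐ[μ]
      fun ω => √((n : ℝ) * T) * (d.estimator e π k T ω - d.estimatorMean μ e π k T ω) := by
  have : ∀ᵐ ω ∂μ, ∀ i, d.unitEstimator e π k T i ω
      - (μ[d.unitEstimator e π k T i | d.unitField i]) ω =
      1 / ((T : ℝ) - k) * d.centeredSum μ e π k T i ω :=
    ae_all_iff.2 fun i => h.unitEstimator_sub_condExp_ae_eq (hY i)
  filter_upwards [this] with ω hω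
  rw [estimator, estimatorMean, ← mul_sub, ← Finset.sum_sub_distrib, Finset.sum_congr rfl
    fun i _ => hω i, ← Finset.mul_sum, ← Finset.mul_sum, Real.sqrt_mul (Nat.cast_nonneg n)]
  have : (√(n : ℝ))⁻¹ = √(n : ℝ) * (1 / (n : ℝ)) := by
    rw [← Real.sqrt_div_self, div_eq_mul_one_div]
  rw [this]
  ring

theorem integral_centeredQuadratic (h : d.IsSample μ T e D) (he : IsPolicy e)
    (hmix : ∀ᵐ P ∂D, ∃ τ ≤ t₀, IsMixingTime P e τ) (ht₀ : 0 < t₀) {i : Fin n}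
    (hY : ∀ t ∈ Finset.Icc 1 T, ∀ᵐ ω ∂μ, |d.Y i t ω| ≤ C) (s₀ : 𝒳 × ℋ) (a : ℕ → ℝ) :
    ∫ ω, d.centeredQuadratic μ e π k T a i ω ∂μ =
      ∑ l ∈ Finset.range (T - k), ∑ j ∈ Finset.range (T - k),
        a (l - j + (j - l)) * autocov e π D k s₀ C (l - j + (j - l)) := by
  obtain ⟨w, hw⟩ := IsBddFun.of_finite fun q : 𝒳 × Fin A => π q.1 q.2 / e q.1 q.2
  obtain ⟨b, hb⟩ := (isStateFun_windowMean (ℋ := ℋ) e π C k).2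
  have hΩ : Nonempty Ω := nonempty_of_isProbabilityMeasure μ
  have hM := h.isGeometricMixingale he hmix ht₀ hY (fun x a => hw (x, a)) (fun P s => hb (P, s))
    ((abs_nonneg _).trans (hb (d.P i hΩ.some, s₀)))
  have hcov : ∀ l < T - k, ∀ j < T - k, ∫ ω, d.centered μ e π k i (k + 1 + l) ω *
      d.centered μ e π k i (k + 1 + j) ω ∂μ = autocov e π D k s₀ C (l - j + (j - l)) := by
    have key : ∀ l j, l ≤ j → j < T - k → ∫ ω, d.centered μ e π k i (k + 1 + l) ω *
        d.centered μ e π k i (k + 1 + j) ω ∂μ = autocov e π D k s₀ C (j - l) := fun l j hlj hj => by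
      rw [← h.integral_centered_mul_centered_eq_autocov he hmix ht₀ hY s₀ (t := k + 1 + l)
        (l := j - l) (by omega) (by omega), show k + 1 + l + (j - l) = k + 1 + j by omega]
    intro l hl j hj
    rcases le_total l j with hlj | hlj
    · rw [key l j hlj hj, Nat.sub_eq_zero_of_le hlj, zero_add]
    · rw [Nat.sub_eq_zero_of_le hlj, add_zero, ← key j l hlj hl]
      exact integral_congr_ae (ae_of_all _ fun ω => mul_comm _ _)
  have hint : ∀ l < T - k, ∀ j < T - k, Integrable (fun ω => a (l - j + (j - l)) *
      d.centered μ e π k i (k + 1 + l) ω * d.centered μ e π k i (k + 1 + j) ω) μ := by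
    intro l hl j hj
    simp_rw [mul_assoc]
    refine Integrable.const_mul ?_ _
    simpa using integrable_pow_mul_pow_of_bdd (hM.integrable hl).1 (hM.integrable hj).1
      (hM.bound l hl) (hM.bound j hj) 1 1
  unfold centeredQuadratic
  rw [integral_finsetSum _ fun l hl => integrable_finsetSum _ fun j hj =>
    hint l (Finset.mem_range.1 hl) j (Finset.mem_range.1 hj)]
  refine Finset.sum_congr rfl fun l hl => ?_
  rw [integral_finsetSum _ fun j hj => hint l (Finset.mem_range.1 hl) j (Finset.mem_range.1 hj)]
  refine Finset.sum_congr rfl fun j hj => ?_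
  simp_rw [mul_assoc]
  rw [integral_const_mul, hcov l (Finset.mem_range.1 hl) j (Finset.mem_range.1 hj)]

end IsSample

end Panel

/-! ### Asymptotics along the rows -/

namespace Panel

variable {𝒳 ℋ : Type*} {A : ℕ} [Fintype 𝒳] [Fintype ℋ] [MeasurableSpace 𝒳] [MeasurableSpace ℋ]
  [MeasurableSingletonClass 𝒳] [MeasurableSingletonClass ℋ] {e π : 𝒳 → Fin A → ℝ}
  {D : Measure (Transition 𝒳 ℋ A)} {C C' t₀ : ℝ} {k : ℕ} {T : ℕ → ℕ}
  {Ω : ℕ → Type*} [∀ n, MeasurableSpace (Ω n)] {μ : (n : ℕ) → Measure (Ω n)}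
  [∀ n, IsProbabilityMeasure (μ n)] {d : (n : ℕ) → Panel 𝒳 ℋ A n (Ω n)}

theorem exists_isGeometricMixingale (hs : ∀ n, (d n).IsSample (μ n) (T n) e D) (he : IsPolicy e)
    (hmix : ∀ᵐ P ∂D, ∃ τ ≤ t₀, IsMixingTime P e τ) (ht₀ : 0 < t₀)
    (hY : ∀ n i, ∀ t ∈ Finset.Icc 1 (T n), ∀ᵐ ω ∂(μ n), |(d n).Y i t ω| ≤ C) :
    ∃ c r : ℝ, 0 ≤ c ∧ 0 ≤ r ∧ r < 1 ∧ ∀ n i,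
      IsGeometricMixingale ((hs n).shiftedHistory i k) (μ n) (T n - k) c r
        fun t => (d n).centered (μ n) e π k i (k + 1 + t) := by
  obtain ⟨w, hw⟩ := IsBddFun.of_finite fun q : 𝒳 × Fin A => π q.1 q.2 / e q.1 q.2
  obtain ⟨b, hb⟩ := (isStateFun_windowMean (ℋ := ℋ) e π C k).2
  -- Absolute values make the constants nonnegative without choosing a state or action; they are
  -- fixed before n and i.
  have hw' : ∀ q : 𝒳 × Fin A, |π q.1 q.2 / e q.1 q.2| ≤ |w| := fun q => (hw q).trans (le_abs_self w)
  have hb' : ∀ p : Transition 𝒳 ℋ A × (𝒳 × ℋ), |windowMean e π C k p.1 p.2| ≤ |b| :=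
    fun p => (hb p).trans (le_abs_self b)
  exact ⟨(|w| ^ (k + 1) * |C| + 2 * |b|) / Real.exp (-1 / t₀) ^ k, Real.exp (-1 / t₀),
    by positivity, (Real.exp_pos _).le,
    Real.exp_lt_one_iff.2 (div_neg_of_neg_of_pos (by norm_num) ht₀), fun n i =>
    (hs n).isGeometricMixingale he hmix ht₀ (hY n i) (fun x a => hw' (x, a))
      (fun P s => hb' (P, s)) (abs_nonneg b)⟩

/-- Facts about the population autocovariance are read off from a single unit observed long enough;
0 < n supplies that unit. -/
theorem exists_row_le (hTlim : Tendsto T atTop atTop) (N : ℕ) : ∃ n, 0 < n ∧ N ≤ T n :=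
  ((eventually_gt_atTop 0).and (hTlim.eventually_ge_atTop N)).exists

/-- Both sides equal the same covariance of one unit, whose outcomes neither truncation alters. -/
theorem autocov_eq_autocov_of_le (hs : ∀ n, (d n).IsSample (μ n) (T n) e D)
    (hTlim : Tendsto T atTop atTop) (he : IsPolicy e)
    (hmix : ∀ᵐ P ∂D, ∃ τ ≤ t₀, IsMixingTime P e τ) (ht₀ : 0 < t₀)
    (hY : ∀ n i, ∀ t ∈ Finset.Icc 1 (T n), ∀ᵐ ω ∂(μ n), |(d n).Y i t ω| ≤ C) (s₀ : 𝒳 × ℋ)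
    (hC : C ≤ C') (l : ℕ) : autocov e π D k s₀ C' l = autocov e π D k s₀ C l := by
  obtain ⟨n, hn, hl⟩ := exists_row_le hTlim (k + 1 + l)
  rw [← (hs n).integral_centered_mul_centered_eq_autocov he hmix ht₀ (hY n ⟨0, hn⟩) s₀ le_rfl hl,
    ← (hs n).integral_centered_mul_centered_eq_autocov he hmix ht₀ (i := ⟨0, hn⟩)
      (fun t ht => (hY n ⟨0, hn⟩ t ht).mono fun ω hω => hω.trans hC) s₀ le_rfl hl]

theorem exists_abs_autocov_le (hs : ∀ n, (d n).IsSample (μ n) (T n) e D)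
    (hTlim : Tendsto T atTop atTop) (he : IsPolicy e)
    (hmix : ∀ᵐ P ∂D, ∃ τ ≤ t₀, IsMixingTime P e τ) (ht₀ : 0 < t₀)
    (hY : ∀ n i, ∀ t ∈ Finset.Icc 1 (T n), ∀ᵐ ω ∂(μ n), |(d n).Y i t ω| ≤ C) (s₀ : 𝒳 × ℋ) :
    ∃ c r : ℝ, 0 ≤ r ∧ r < 1 ∧ ∀ l, |autocov e π D k s₀ C (l + 1)| ≤ c * r ^ l := by
  obtain ⟨c, r, hc, hr0, hr1, hM⟩ := exists_isGeometricMixingale (π := π) (k := k) hs he hmix ht₀ hY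
  refine ⟨c ^ 2, r, hr0, hr1, fun l => ?_⟩
  obtain ⟨n, hn, hl⟩ := exists_row_le hTlim (k + 1 + (l + 1))
  rw [← (hs n).integral_centered_mul_centered_eq_autocov he hmix ht₀ (hY n ⟨0, hn⟩) s₀ le_rfl hl]
  have := (hM n ⟨0, hn⟩).abs_integral_mul_le hc (Nat.succ_pos l) (by omega)
  simpa using this

theorem tendsto_natCast_div_sub (hT : ∀ n, k + 1 ≤ T n) (hTlim : Tendsto T atTop atTop) :
    Tendsto (fun n => (T n : ℝ) / ((T n : ℝ) - k)) atTop (𝓝 1) := by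
  have hlim : Tendsto (fun n => (T n : ℝ)) atTop atTop := tendsto_natCast_atTop_atTop.comp hTlim
  have h1 : Tendsto (fun n => (1 - (k : ℝ) / (T n : ℝ))⁻¹) atTop (𝓝 1) := by
    simpa using (tendsto_const_nhds.sub (hlim.const_div_atTop (k : ℝ))).inv₀
      (show (1 : ℝ) - 0 ≠ 0 by norm_num)
  refine h1.congr fun n => ?_
  have : (0 : ℝ) < T n := by exact_mod_cast (show 0 < T n by have := hT n; omega)
  rw [one_sub_div this.ne', inv_div]

theorem natCast_le_mul_sub {N : ℕ} (h : k + 1 ≤ N) : (N : ℝ) ≤ (k + 1) * ((N : ℝ) - k) := by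
  have h' : (k : ℝ) + 1 ≤ N := by exact_mod_cast h
  have hk : (0 : ℝ) ≤ k := Nat.cast_nonneg k
  nlinarith

theorem tendsto_sub_atTop (hTlim : Tendsto T atTop atTop) :
    Tendsto (fun n => T n - k) atTop atTop :=
  (tendsto_sub_atTop_nat k).comp hTlim

/-- The Toeplitz average with weights 1, corrected by T/(T - k) → 1. -/
theorem tendsto_integral_centeredSum_sq (hs : ∀ n, (d n).IsSample (μ n) (T n) e D)
    (hT : ∀ n, k + 1 ≤ T n)
    (hTlim : Tendsto T atTop atTop) (he : IsPolicy e)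
    (hmix : ∀ᵐ P ∂D, ∃ τ ≤ t₀, IsMixingTime P e τ) (ht₀ : 0 < t₀)
    (hY : ∀ n i, ∀ t ∈ Finset.Icc 1 (T n), ∀ᵐ ω ∂(μ n), |(d n).Y i t ω| ≤ C) (s₀ : 𝒳 × ℋ) :
    ∃ v : ℕ → ℝ, Tendsto v atTop (𝓝 (longRunVariance (autocov e π D k s₀ C))) ∧ ∀ n i,
      ∫ ω, (√(T n : ℝ) / ((T n : ℝ) - k) * (d n).centeredSum (μ n) e π k (T n) i ω) ^ 2 ∂(μ n)
        = v n := by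
  obtain ⟨c, r, hr0, hr1, hγ⟩ := exists_abs_autocov_le (π := π) (k := k) hs hTlim he hmix ht₀ hY s₀
  refine ⟨_, by simpa using (tendsto_natCast_div_sub hT hTlim).mul (tendsto_average_toeplitz hr0 hr1
    hγ (fun _ _ => 1) (by simp) (fun _ => tendsto_const_nhds) (tendsto_sub_atTop (k := k) hTlim)),
    fun n i => ?_⟩
  simp_rw [mul_pow, centeredSum_sq]
  rw [integral_const_mul, (hs n).integral_centeredQuadratic he hmix ht₀ (hY n i) s₀, div_pow,
    Real.sq_sqrt (Nat.cast_nonneg _), Nat.cast_sub (by have := hT n; omega)]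
  simp only [one_mul]
  generalize (T n : ℝ) - k = m
  ring

/-- Asymptotic normality of the estimator. -/
theorem tendstoInDistribution_estimator (hs : ∀ n, (d n).IsSample (μ n) (T n) e D)
    (hT : ∀ n, k + 1 ≤ T n)
    (hTlim : Tendsto T atTop atTop) (he : IsPolicy e)
    (hmix : ∀ᵐ P ∂D, ∃ τ ≤ t₀, IsMixingTime P e τ) (ht₀ : 0 < t₀)
    (hY : ∀ n i, ∀ t ∈ Finset.Icc 1 (T n), ∀ᵐ ω ∂(μ n), |(d n).Y i t ω| ≤ C) (s₀ : 𝒳 × ℋ)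
    {σ2 : ℝ≥0} (hσ : (σ2 : ℝ) = longRunVariance (autocov e π D k s₀ C)) :
    TendstoInDistribution
      (fun (n : ℕ) (ω : Ω n) => Real.sqrt ((n : ℝ) * T n) *
        ((d n).estimator e π k (T n) ω - (d n).estimatorMean (μ n) e π k (T n) ω))
      atTop (fun x : ℝ => x) μ (gaussianReal 0 σ2) := by
  obtain ⟨c, r, hc, hr0, hr1, hM⟩ := exists_isGeometricMixingale (π := π) (k := k) hs he hmix ht₀ hY
  obtain ⟨v, hv, hv2⟩ := tendsto_integral_centeredSum_sq (π := π) hs hT hTlim he hmix ht₀ hY s₀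
  rw [← hσ] at hv
  refine TendstoInDistribution.congr (fun n => (hs n).sqrt_mul_estimator_sub_ae_eq (hY n))
    EventuallyEq.rfl ?_
  refine tendstoInDistribution_inv_sqrt_mul_sum_row μ
    (fun n i ω => √(T n : ℝ) / ((T n : ℝ) - k) * (d n).centeredSum (μ n) e π k (T n) i ω)
    (fun n i => ?_) (fun n => ?_) v σ2 hv
    -- With m = T - k ≥ 1 the fourth moment of the sum is at most m² times the bracket; the scaling
    -- T²/m⁴ then leaves (T/m)² ≤ (k + 1)².
    ((k + 1) ^ 2 * (8 * (4 * (c + 2 * (c / (1 - r))) ^ 4) + 8 * (c / (1 - r)) ^ 4))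
    (fun n i => ?_) (fun n i => ?_) hv2 (fun n i => ?_)
  · exact (((d n).measurable_history_centeredSum (μ n) e π k (T n) i).mono
      ((hs n).history_le i _) le_rfl).const_mul _
  · exact (hs n).iIndepFun_of_measurable_history fun i =>
      ((d n).measurable_history_centeredSum (μ n) e π k (T n) i).const_mul _
  · simp_rw [mul_pow]
    exact ((hM n i).integrable_sum_pow 4).const_mul _
  · rw [integral_const_mul, (hs n).integral_centeredSum (hY n i), mul_zero]
  · simp_rw [mul_pow]
    rw [integral_const_mul]
    have hTn := hT n
    have h1 := (hM n i).integral_sum_pow_four_le hc hr0 hr1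
    have h2 := natCast_le_mul_sub hTn
    rw [Nat.cast_sub (by omega)] at h1
    set m : ℝ := (T n : ℝ) - k with hm
    have hm1 : 1 ≤ m := by
      have : (k : ℝ) + 1 ≤ T n := by exact_mod_cast hTn
      linarith
    have h3 : (√(T n : ℝ) / m) ^ 4 = (T n : ℝ) ^ 2 / m ^ 4 := by
      rw [div_pow, show (4 : ℕ) = 2 * 2 by norm_num, pow_mul (√(T n : ℝ)),
        Real.sq_sqrt (Nat.cast_nonneg _)]
    rw [h3]
    have h4 : 8 * (4 * m ^ 2 * (c + 2 * (c / (1 - r))) ^ 4) + 8 * (c / (1 - r)) ^ 4 ≤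
        m ^ 2 * (8 * (4 * (c + 2 * (c / (1 - r))) ^ 4) + 8 * (c / (1 - r)) ^ 4) := by
      have : 1 ≤ m ^ 2 := one_le_pow₀ hm1
      have h5 : 0 ≤ 8 * (c / (1 - r)) ^ 4 := by positivity
      nlinarith
    calc _ ≤ (T n : ℝ) ^ 2 / m ^ 4 *
          (m ^ 2 * (8 * (4 * (c + 2 * (c / (1 - r))) ^ 4) + 8 * (c / (1 - r)) ^ 4)) := by
          refine mul_le_mul_of_nonneg_left (le_trans h1 h4) (by positivity)
      _ ≤ ((k + 1) * m) ^ 2 / m ^ 4 *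
          (m ^ 2 * (8 * (4 * (c + 2 * (c / (1 - r))) ^ 4) + 8 * (c / (1 - r)) ^ 4)) := by
          gcongr
      _ = _ := by field_simp

/-- Consistency of the kernel variance estimator. -/
theorem tendsto_measure_varianceEstimator (hs : ∀ n, (d n).IsSample (μ n) (T n) e D)
    (hT : ∀ n, k + 1 ≤ T n)
    (hTlim : Tendsto T atTop atTop) (he : IsPolicy e)
    (hmix : ∀ᵐ P ∂D, ∃ τ ≤ t₀, IsMixingTime P e τ) (ht₀ : 0 < t₀)
    (hY : ∀ n i, ∀ t ∈ Finset.Icc 1 (T n), ∀ᵐ ω ∂(μ n), |(d n).Y i t ω| ≤ C) (s₀ : 𝒳 × ℋ)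
    {B : ℕ → ℝ} (hB : Tendsto B atTop atTop)
    (hBT : Tendsto (fun n => B n / Real.sqrt (T n)) atTop (𝓝 0)) {ε : ℝ} (hε : 0 < ε) :
    Tendsto (fun n => μ n {ω | ε ≤ |(d n).varianceEstimator (μ n) e π k (T n) (B n) ω -
      longRunVariance (autocov e π D k s₀ C)|}) atTop (𝓝 0) := by
  obtain ⟨c, r, hc, hr0, hr1, hM⟩ := exists_isGeometricMixingale (π := π) (k := k) hs he hmix ht₀ hY
  obtain ⟨c', r', hr0', hr1', hγ⟩ :=
    exists_abs_autocov_le (π := π) (k := k) hs hTlim he hmix ht₀ hY s₀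
  simp_rw [varianceEstimator_eq]
  have hq := tendsto_average_toeplitz hr0' hr1' hγ (fun n l => parzen (l / B n))
    (fun n l => by rw [abs_of_nonneg (parzen_nonneg _)]; exact parzen_le_one _)
    (fun l => tendsto_parzen_div hB l) (tendsto_sub_atTop (k := k) hTlim)
  refine tendsto_measure_le_abs_average_sub μ
    (fun n i ω => 1 / ((T n : ℝ) - k) *
      (d n).centeredQuadratic (μ n) e π k (T n) (fun l => parzen (l / B n)) i ω)
    (fun n => ?_) (fun n i => ?_) hq (K := 2 * (c ^ 2 + 4 * (c / (1 - r)) * c) ^ 2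
      + 8 * ((k + 1) * (c * (c + 2 * (c / (1 - r)))) ^ 2)) (fun n i => ?_) ?_ hε
  · exact (hs n).iIndepFun_of_measurable_history fun i =>
      ((d n).measurable_history_centeredQuadratic (μ n) e π k (T n) _ i).const_mul _
  · refine MemLp.const_mul ?_ _
    refine memLp_finsetSum _ fun l hl => memLp_finsetSum _ fun j hj => ?_
    have hl := Finset.mem_range.1 hl
    have hj := Finset.mem_range.1 hj
    simp_rw [mul_assoc]
    refine MemLp.const_mul (MemLp.of_bound (((hM n i).integrable hl).1.mul
      ((hM n i).integrable hj).1) (c * c) ?_) _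
    filter_upwards [(hM n i).bound l hl, (hM n i).bound j hj] with ω h1 h2
    rw [Pi.mul_apply, norm_mul, Real.norm_eq_abs, Real.norm_eq_abs]
    gcongr
  · rw [integral_const_mul, (hs n).integral_centeredQuadratic he hmix ht₀ (hY n i) s₀,
      Nat.cast_sub (by have := hT n; omega)]
  · have hBT1 : ∀ᶠ n in atTop, B n / √(T n : ℝ) < 1 := hBT.eventually (gt_mem_nhds one_pos)
    filter_upwards [hB.eventually_gt_atTop 0, hBT1] with n hBn hBTn i
    have hTn := hT n
    have h2 := natCast_le_mul_sub hTn
    have h1 := (hM n i).integral_quadratic_sq_le hc hr0 hr1 (antitone_parzen_div hBn)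
      (fun _ => parzen_nonneg _) (parzen_le_one _) (sum_parzen_div_le hBn)
    simp_rw [mul_pow]
    rw [integral_const_mul]
    rw [Nat.cast_sub (by omega)] at h1
    set m : ℝ := (T n : ℝ) - k with hm
    have hm1 : 1 ≤ m := by
      have : (k : ℝ) + 1 ≤ T n := by exact_mod_cast hTn
      linarith
    have hTpos : (0 : ℝ) < T n := by exact_mod_cast (show 0 < T n by omega)
    -- Only B ≤ √T is needed: it keeps the part of order B²/m in the normalized second moment
    -- bounded, and averaging over units removes the noise.
    have hB2 : B n ^ 2 ≤ (k + 1) * m := by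
      rw [div_lt_one (Real.sqrt_pos.2 hTpos)] at hBTn
      have : B n ^ 2 ≤ √(T n : ℝ) ^ 2 := by gcongr
      rw [Real.sq_sqrt hTpos.le] at this
      exact this.trans h2
    set c₁ := c / (1 - r) with hc₁
    have hc₁0 : 0 ≤ c₁ := div_nonneg hc (by linarith)
    calc _ ≤ (1 / m) ^ 2 * (2 * (m * (c ^ 2 + 4 * c₁ * c)) ^ 2
          + 8 * (m * (c * B n * (c + 2 * c₁)) ^ 2)) :=
          mul_le_mul_of_nonneg_left h1 (by positivity)
      _ = 2 * (c ^ 2 + 4 * c₁ * c) ^ 2 + 8 * (B n ^ 2 / m * (c * (c + 2 * c₁)) ^ 2) := by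
          have : m ≠ 0 := by linarith
          field_simp
      _ ≤ _ := by
          have : B n ^ 2 / m ≤ k + 1 := by rwa [div_le_iff₀ (by linarith)]
          have := mul_le_mul_of_nonneg_right this (sq_nonneg (c * (c + 2 * c₁)))
          linarith

end Panel

/-! ### The main theorem -/

theorem proposition2
    {𝒳 ℋ : Type*} [Fintype 𝒳] [Fintype ℋ]
    [MeasurableSpace 𝒳] [MeasurableSpace ℋ]
    [MeasurableSingletonClass 𝒳] [MeasurableSingletonClass ℋ]
    {A : ℕ} (e π : 𝒳 → Fin A → ℝ)
    (D : Measure (Transition 𝒳 ℋ A)) [IsProbabilityMeasure D]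
    (ζ t₀ M₁ M₂ : ℝ) (hD : PopulationConditions e π D ζ t₀ M₁ M₂) (k : ℕ) :
    ∃ σ2 : ℝ≥0,
      ∀ (T : ℕ → ℕ), (∀ n, k + 1 ≤ T n) → Tendsto T atTop atTop →
      ∀ (Ω : ℕ → Type*) [∀ n, MeasurableSpace (Ω n)]
        (μ : (n : ℕ) → Measure (Ω n)) [∀ n, IsProbabilityMeasure (μ n)]
        (d : (n : ℕ) → Panel 𝒳 ℋ A n (Ω n)),
      (∀ n, (d n).IsSample (μ n) (T n) e D) →
      ∀ C : ℝ, (∀ n i, ∀ t ∈ Finset.Icc 1 (T n), ∀ᵐ ω ∂(μ n), |(d n).Y i t ω| ≤ C) →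
      -- `σ2` is the asymptotic variance of the estimator of the policy value
      TendstoInDistribution
        (fun (n : ℕ) (ω : Ω n) => Real.sqrt ((n : ℝ) * T n) *
          ((d n).estimator e π k (T n) ω - (d n).estimatorMean (μ n) e π k (T n) ω))
        atTop (fun x : ℝ => x) μ (gaussianReal 0 σ2) ∧
      -- the kernel variance estimator is consistent for `σ2`
      ∀ B : ℕ → ℝ, Tendsto B atTop atTop →
        Tendsto (fun n => B n / Real.sqrt (T n)) atTop (𝓝 0) →
        ∀ ε > 0, Tendsto
          (fun n => μ n {ω | ε ≤ |(d n).varianceEstimator (μ n) e π k (T n) (B n) ω - σ2|})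
          atTop (𝓝 0) := by
  -- A probability measure charges some law with a mixing time, which forces t₀ > 0.
  obtain ⟨P₀, τ, hτ, hτ0⟩ := hD.mixing_behavior.exists
  have ht₀ : 0 < t₀ := hτ0.1.trans_le hτ
  rcases isEmpty_or_nonempty (𝒳 × ℋ) with hemp | ⟨⟨s₀⟩⟩
  · refine ⟨0, fun T _ _ Ω _ μ _ d _ C _ => ?_⟩
    -- Without states there is no sample: the row n = 1 already has a unit with a state.
    exact hemp.elim ((d 1).state 0 1 (nonempty_of_isProbabilityMeasure (μ 1)).some)
  -- The limit over truncation levels N lets σ² be fixed before C; given a sample, the sequence is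
  -- constant from N ≥ C on.
  refine ⟨(limUnder atTop fun N : ℕ => longRunVariance (autocov e π D k s₀ (N : ℝ))).toNNReal,
    fun T hT hTlim Ω _ μ _ d hs C hY => ?_⟩
  have hlim : limUnder atTop (fun N : ℕ => longRunVariance (autocov e π D k s₀ (N : ℝ)))
      = longRunVariance (autocov e π D k s₀ C) := by
    refine Tendsto.limUnder_eq (tendsto_const_nhds.congr' ?_)
    filter_upwards [tendsto_natCast_atTop_atTop.eventually_ge_atTop C] with N hN
    congr 1
    ext l
    exact (Panel.autocov_eq_autocov_of_le hs hTlim hD.behavior hD.mixing_behavior ht₀ hY s₀ hN l).symm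
  obtain ⟨v, hv, hv2⟩ := Panel.tendsto_integral_centeredSum_sq (π := π) hs hT hTlim hD.behavior
    hD.mixing_behavior ht₀ hY s₀
  have hnonneg : 0 ≤ longRunVariance (autocov e π D k s₀ C) := by
    -- The long-run variance is a limit of second moments of one unit, hence nonnegative.
    refine ge_of_tendsto hv ?_
    filter_upwards [eventually_gt_atTop 0] with n hn
    rw [← hv2 n ⟨0, hn⟩]
    exact integral_nonneg fun ω => sq_nonneg _
  have hσ : ((limUnder atTop fun N : ℕ =>
      longRunVariance (autocov e π D k s₀ (N : ℝ))).toNNReal : ℝ)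
      = longRunVariance (autocov e π D k s₀ C) := by
    rw [hlim, Real.coe_toNNReal _ hnonneg]
  refine ⟨Panel.tendstoInDistribution_estimator hs hT hTlim hD.behavior hD.mixing_behavior ht₀ hY
    s₀ hσ, fun B hB hBT ε hε => ?_⟩
  rw [hσ]
  exact Panel.tendsto_measure_varianceEstimator hs hT hTlim hD.behavior hD.mixing_behavior ht₀ hY
    s₀ hB hBT hε
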